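/- **Conventions.** Let $k$ be an algebraically closed field. Algebraic groups are separated group schemes of finite type over $k$, and a variety is an integral separated scheme of finite type over $k$. For a $k$-vector space $E$ (possibly of infinite dimension) write $\mathbb P(E)=\operatorname{Proj}\operatorname{Sym}_k E$, which parametrizes the invertible quotients of $E$. For a $k$-scheme $S$ put $E_S=\mathcal O_S\otimes_k E$, so that $\mathbb P_S(E_S)=S\times\mathbb P(E)$. * An automorphism $\bar\tau$ of the $S$-scheme $\mathbb P_S(E_S)$ is a *projectivity* if, Zariski locally on $S$, it is induced by an $\mathcal O_S$-linear automorphism $T$ of $E_S$. It is a *coherent projectivity* if every point of $S$ has an affine open neighbourhood $\operatorname{Spec}A$ over which $\bar\tau$ is induced by an automorphism $T$ of $A\otimes_kE$ such that $A[T]\cdot s$ is a finitely generated $A$-module for every $s\in A\otimes_k E$. * A subspace $V\subseteq E$ (a linear subsystem) is *stable* under $\bar\tau$ if every point of $S$ has an affine open neighbourhood $\operatorname{Spec}A$ over which $\bar\tau$ is induced by an automorphism $T$ of $A\otimes_kE$ with $T(A\otimes_kV)\subseteq A\otimes_kV$. * If $G$ acts on $X$ by $\tau\colon G\times X\to X$,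 an invertible sheaf $\mathcal L$ on $X$ is *$G$-invariant* if $\tau^*\mathcal L\simeq p_1^*\mathcal N\otimes p_2^*\mathcal L$ for some invertible sheaf $\mathcal N$ on $G$, where $p_1,p_2$ are the projections of $G\times X$. * For an invertible sheaf $\mathcal L$ on $X$ and $E=H^0(X,\mathcal L)$, let $\mathcal B\subseteq X$ be the locus where $\mathcal O_X\otimes_kE\to\mathcal L$ is not surjective, and let $\nu\colon X-\mathcal B\to\mathbb P(E)$ be the induced morphism, which sends a point $x$ to the quotient $E\to\mathcal L_x$, $s\mapsto s(x)$. **Theorem.** Let $G$ be a smooth connected algebraic group acting on a variety $X$, let $\mathcal L$ be a $G$-invariant invertible sheaf on $X$, and let $E=H^0(X,\mathcal L)$. Then there is an action of $G$ on $\mathbb P(E)$ with the following properties. 1. It extends the action of $G$ on $X$: the open subscheme $X-\mathcal B$ is $G$-stable and $\nu\colon X-\mathcal B\to\mathbb P(E)$ is $G$-equivariant. 2. It is an action by coherent projectivities: the automorphism $(g,p)\mapsto(g,gp)$ of the $G$-scheme $G\times\mathbb P(E)=\mathbb P_G(E_G)$ is a coherent projectivity. 3. The complete linear system is the union of its finite-dimensional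 $G$-stable linear subsystems: every $e\in E$ lies in a finite-dimensional subspace $V\subseteq E$ that is stable under the projectivity $(g,p)\mapsto(g,gp)$ of $\mathbb P_G(E_G)$. -/

import Mathlib

open CategoryTheory Limits AlgebraicGeometry MonoidalCategory CartesianMonoidalCategory MonObj
open scoped TensorProduct

universe u

namespace ProjAction

noncomputable section

section Sym

variable (R M : Type*) [CommRing R] [AddCommGroup M] [Module R M]

/-- The grading of `Sym_R M` by degree: the degree `n` part is spanned by the `n`-fold products of
elements of `M`. -/
def symGrading : ℕ → Submodule R (SymmetricAlgebra R M) :=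
  fun n => LinearMap.range (SymmetricAlgebra.ι R M) ^ n

variable {M} in
theorem ι_mem (m : M) : SymmetricAlgebra.ι R M m ∈ symGrading R M 1 := by
  simp [symGrading]

instance symGradedMonoid : SetLike.GradedMonoid (symGrading R M) :=
  inferInstanceAs (SetLike.GradedMonoid (LinearMap.range (SymmetricAlgebra.ι R M) ^ ·))

/-- Auxiliary: the inclusion of `M` as the degree one part. -/
def symGradingι : M →ₗ[R] DirectSum ℕ (fun i => ↥(symGrading R M i)) :=
  DirectSum.lof R ℕ (fun i => ↥(symGrading R M i)) 1 ∘ₗ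
    (SymmetricAlgebra.ι R M).codRestrict _ (ι_mem R)

instance symGraded : GradedAlgebra (symGrading R M) :=
  GradedAlgebra.ofAlgHom _ (SymmetricAlgebra.lift (symGradingι R M))
    (by
      apply SymmetricAlgebra.algHom_ext
      ext m
      change DirectSum.coeAlgHom (symGrading R M)
        (SymmetricAlgebra.lift (symGradingι R M) (SymmetricAlgebra.ι R M m)) = _
      rw [SymmetricAlgebra.lift_ι_apply]
      simp [symGradingι, DirectSum.lof_eq_of])
    fun i x => by
    obtain ⟨x, hx⟩ := x
    dsimp only [Subtype.coe_mk, DirectSum.lof_eq_of]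
    unfold symGrading at hx
    induction hx using Submodule.pow_induction_on_left' with
    | algebraMap r =>
      rw [AlgHom.commutes, DirectSum.algebraMap_apply]; rfl
    | add x y i hx hy ihx ihy =>
      rw [map_add, ihx, ihy, ← map_add]
      rfl
    | mem_mul m hm i x hx ih =>
      obtain ⟨_, rfl⟩ := hm
      rw [map_mul, ih, SymmetricAlgebra.lift_ι_apply]
      simp only [symGradingι, LinearMap.comp_apply, DirectSum.lof_eq_of]
      rw [DirectSum.of_mul_of]
      exact DirectSum.of_eq_of_gradedMonoid_eq (Sigma.subtype_ext (add_comm _ _) rfl)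

end Sym

section SymMap

variable {R S M N : Type*} [CommRing R] [CommRing S] [Algebra R S]
  [AddCommGroup M] [Module R M] [AddCommGroup N] [Module S N] [Module R N] [IsScalarTower R S N]

/-- The ring homomorphism `Sym_R M → Sym_S N` extending an `R`-linear map `f : M → N`. -/
def symAlgMap (f : M →ₗ[R] N) : SymmetricAlgebra R M →ₐ[R] SymmetricAlgebra S N :=
  SymmetricAlgebra.lift (((SymmetricAlgebra.ι S N).restrictScalars R) ∘ₗ f)

theorem symAlgMap_ι (f : M →ₗ[R] N) (m : M) :
    symAlgMap (S := S) f (SymmetricAlgebra.ι R M m) = SymmetricAlgebra.ι S N (f m) := by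
  rw [symAlgMap, SymmetricAlgebra.lift_ι_apply]; rfl

/-- `symAlgMap f` as a homomorphism of graded rings. -/
def symGradedMap (f : M →ₗ[R] N) : GradedRingHom (symGrading R M) (symGrading S N) where
  toRingHom := (symAlgMap (S := S) f).toRingHom
  map_mem {i x} hx := by
    change symAlgMap (S := S) f x ∈ _
    unfold symGrading at hx
    induction hx using Submodule.pow_induction_on_left' with
    | algebraMap r =>
      rw [AlgHom.commutes, IsScalarTower.algebraMap_apply R S]
      exact SetLike.algebraMap_mem_graded (symGrading S N) _
    | add x y i hx hy ihx ihy => rw [map_add]; exact add_mem ihx ihy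
    | mem_mul m hm i x hx ih =>
      obtain ⟨m, rfl⟩ := hm
      rw [map_mul, symAlgMap_ι, Nat.succ_eq_add_one, add_comm]
      exact SetLike.mul_mem_graded (ι_mem S _) ih

open HomogeneousIdeal in
theorem irrelevant_le_map (f : M →ₗ[R] N) (hf : Submodule.span S (Set.range f) = ⊤) :
    irrelevant (symGrading S N) ≤ (irrelevant (symGrading R M)).map (symGradedMap (S := S) f) := by
  have key : ∀ n : N, SymmetricAlgebra.ι S N n ∈
      ((irrelevant (symGrading R M)).map (symGradedMap (S := S) f)).toIdeal := by
    intro n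
    have hn : n ∈ Submodule.span S (Set.range f) := hf ▸ Submodule.mem_top
    induction hn using Submodule.span_induction with
    | mem x hx =>
      obtain ⟨m, rfl⟩ := hx
      rw [← symAlgMap_ι]
      exact Ideal.mem_map_of_mem (symGradedMap (S := S) f)
        (mem_irrelevant_of_mem _ one_pos (ι_mem R m))
    | zero => simp
    | add x y _ _ hx hy => rw [map_add]; exact add_mem hx hy
    | smul a x _ hx =>
      rw [map_smul, Algebra.smul_def]
      exact Ideal.mul_mem_left _ _ hx
  rw [irrelevant_le]
  intro i hi x hx
  change x ∈ ((irrelevant (symGrading R M)).map (symGradedMap (S := S) f)).toIdeal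
  replace hx : x ∈ LinearMap.range (SymmetricAlgebra.ι S N) ^ i := hx
  obtain ⟨j, rfl⟩ := Nat.exists_eq_succ_of_ne_zero hi.ne'
  rw [Nat.succ_eq_add_one, pow_succ] at hx
  refine Submodule.mul_induction_on hx ?_ (fun _ _ h h' => add_mem h h')
  rintro a _ _ ⟨n, rfl⟩
  exact Ideal.mul_mem_left _ _ (key n)

end SymMap

section ProjSpace

/-- The projective space `ℙ_R(M) = Proj (Sym_R M)` of an `R`-module `M`, whose points are
the invertible quotients of `M`. -/
abbrev projSpace (R M : Type u) [CommRing R] [AddCommGroup M] [Module R M] : Scheme.{u} :=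
  Proj (symGrading R M)

/-- The structure morphism `ℙ_R(M) → Spec R`. -/
def projSpaceStr (R M : Type u) [CommRing R] [AddCommGroup M] [Module R M] :
    projSpace R M ⟶ Spec (.of R) :=
  Proj.toSpecZero (symGrading R M) ≫
    Spec.map (CommRingCat.ofHom (algebraMap R (symGrading R M 0)))

/-- The morphism `ℙ_S(N) → ℙ_R(M)` induced by an `R`-linear map `f : M → N` whose image spans
the `S`-module `N`. -/
def projMap {R S M N : Type u} [CommRing R] [CommRing S] [Algebra R S]
    [AddCommGroup M] [Module R M] [AddCommGroup N] [Module S N] [Module R N] [IsScalarTower R S N]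
    (f : M →ₗ[R] N) (hf : Submodule.span S (Set.range f) = ⊤) :
    projSpace S N ⟶ projSpace R M :=
  Proj.map (symGradedMap (S := S) f) (irrelevant_le_map f hf)

/-- The automorphism `[T]` of `ℙ_A(M)` induced by an automorphism `T` of the `A`-module `M`. -/
def projAut {A M : Type u} [CommRing A] [AddCommGroup M] [Module A M] (T : M ≃ₗ[A] M) :
    projSpace A M ⟶ projSpace A M :=
  projMap (S := A) T.toLinearMap (by
    rw [← LinearMap.coe_range, Submodule.span_eq]; exact LinearEquiv.range T)

theorem span_range_mk (R A M : Type*) [CommRing R] [CommRing A] [Algebra R A] [AddCommGroup M]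
    [Module R M] : Submodule.span A (Set.range (TensorProduct.mk R A M 1)) = ⊤ := by
  rw [eq_top_iff]
  rintro x -
  induction x using TensorProduct.induction_on with
  | zero => exact zero_mem _
  | tmul a m =>
    have : a ⊗ₜ[R] m = a • TensorProduct.mk R A M 1 m := by
      simp [TensorProduct.smul_tmul']
    rw [this]
    exact Submodule.smul_mem _ _ (Submodule.subset_span ⟨m, rfl⟩)
  | add x y hx hy => exact add_mem hx hy

/-- The base change morphism `ℙ_A(A ⊗ M) → ℙ_R(M)`. -/
def projBaseChange (R A M : Type u) [CommRing R] [CommRing A] [Algebra R A] [AddCommGroup M]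
    [Module R M] : projSpace A (A ⊗[R] M) ⟶ projSpace R M :=
  projMap (S := A) (TensorProduct.mk R A M 1) (span_range_mk R A M)

theorem projMap_str {R S M N : Type u} [CommRing R] [CommRing S] [Algebra R S]
    [AddCommGroup M] [Module R M] [AddCommGroup N] [Module S N] [Module R N] [IsScalarTower R S N]
    (f : M →ₗ[R] N) (hf : Submodule.span S (Set.range f) = ⊤) :
    projMap f hf ≫ projSpaceStr R M =
      projSpaceStr S N ≫ Spec.map (CommRingCat.ofHom (algebraMap R S)) := by
  refine (Proj.mapAffineOpenCover (symGradedMap (S := S) f)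
    (irrelevant_le_map f hf)).openCover.hom_ext _ _ ?_
  have key : ∀ {i : ℕ} (hi : 0 < i) (s : SymmetricAlgebra R M) (hs : s ∈ symGrading R M i),
      Proj.awayι (symGrading S N) (symGradedMap (S := S) f s)
          ((symGradedMap (S := S) f).map_mem hs) hi ≫ projMap f hf ≫ projSpaceStr R M =
      Proj.awayι (symGrading S N) (symGradedMap (S := S) f s)
          ((symGradedMap (S := S) f).map_mem hs) hi ≫
        projSpaceStr S N ≫ Spec.map (CommRingCat.ofHom (algebraMap R S)) := by
    intro i hi s hs
    rw [projMap, projSpaceStr, projSpaceStr, Proj.awayι_comp_map_assoc _ _ hi s hs,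
      Proj.awayι_toSpecZero_assoc, Category.assoc, Proj.awayι_toSpecZero_assoc]
    simp only [← Spec.map_comp, ← CommRingCat.ofHom_comp]
    congr 2
    ext r
    have h : symGradedMap (S := S) f (algebraMap R (SymmetricAlgebra R M) r) =
        algebraMap S (SymmetricAlgebra S N) (algebraMap R S r) := by
      rw [← IsScalarTower.algebraMap_apply R S]
      exact (symAlgMap (S := S) f).commutes r
    refine (HomogeneousLocalization.val_mk _).trans
      (Eq.trans ?_ (HomogeneousLocalization.val_mk _).symm)
    refine congrArg₂ Localization.mk h (Subtype.ext ?_)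
    exact map_one (symGradedMap (S := S) f)
  exact fun s => key s.1.2 s.2.1 s.2.2

end ProjSpace
section Away

variable {A R : Type u} [CommRing A] [CommRing R] {σ : Type*} [SetLike σ A]
    [AddSubgroupClass σ A] (𝒜 : ℕ → σ) [GradedRing 𝒜]
/-- For a graded ring `A = ⨁ A_n`, a ring homomorphism `φ : A → R` and `t` such that `φ t` is
invertible, the ring homomorphism `A_(t) → R`, `a / t ^ n ↦ φ a / φ t ^ n`. -/
def awayHom (φ : A →+* R) (t : A) (ht : IsUnit (φ t)) :
    HomogeneousLocalization.Away 𝒜 t →+* R :=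
  (Localization.awayLift φ t ht).comp
    (algebraMap (HomogeneousLocalization.Away 𝒜 t) (Localization.Away t))

theorem awayHom_mk (φ : A →+* R) (t : A) (ht : IsUnit (φ t))
    (c : HomogeneousLocalization.NumDenSameDeg 𝒜 (Submonoid.powers t)) :
    awayHom 𝒜 φ t ht (HomogeneousLocalization.mk c) * φ c.den = φ c.num := by
  have h : algebraMap A (Localization.Away t) (c.den : A) *
      (HomogeneousLocalization.mk c).val = algebraMap A (Localization.Away t) c.num := by
    rw [HomogeneousLocalization.val_mk, Localization.mk_eq_mk']
    exact IsLocalization.mk'_spec' _ _ (⟨_, c.den_mem⟩ : Submonoid.powers t)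
  have h2 := congrArg (Localization.awayLift φ t ht) h
  rw [map_mul] at h2
  simp only [Localization.awayLift, IsLocalization.Away.lift_eq] at h2
  rw [mul_comm]; exact h2

theorem awayHom_twist (φ ψ : A →+* R) (t : A) (ht : IsUnit (φ t)) (ht' : IsUnit (ψ t)) (w : R)
    (h : ∀ n, ∀ a ∈ 𝒜 n, φ a = w ^ n * ψ a) : awayHom 𝒜 φ t ht = awayHom 𝒜 ψ t ht' := by
  ext z
  obtain ⟨c, rfl⟩ := HomogeneousLocalization.mk_surjective z
  have hden : IsUnit (φ c.den) := by
    obtain ⟨n, hn⟩ := c.den_mem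
    rw [← hn]; simpa using ht.pow n
  apply hden.mul_right_cancel
  rw [awayHom_mk, h _ _ c.num.2, h _ _ c.den.2, ← awayHom_mk 𝒜 ψ t ht' c]
  ring

theorem awayHom_comp_awayMap (φ : A →+* R) {t g x : A} {m : ℕ} (hg : g ∈ 𝒜 m) (hx : x = t * g)
    (ht : IsUnit (φ t)) (h : IsUnit (φ x)) :
    (awayHom 𝒜 φ x h).comp (HomogeneousLocalization.awayMap 𝒜 hg hx) = awayHom 𝒜 φ t ht := by
  have key : (Localization.awayLift φ x h).comp (Localization.awayLift (algebraMap A _) _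
    (isUnit_of_dvd_unit (map_dvd _ ⟨_, hx⟩) (IsLocalization.Away.algebraMap_isUnit x))) =
      Localization.awayLift φ t ht := by
    apply IsLocalization.ringHom_ext (M := .powers t)
    ext a
    simp [Localization.awayLift, IsLocalization.Away.lift_eq]
  ext z
  change Localization.awayLift φ x h (HomogeneousLocalization.awayMap 𝒜 hg hx z).val = _
  rw [HomogeneousLocalization.val_awayMap, ← RingHom.comp_apply, key]
  rfl

theorem comp_awayHom {R' : Type u} [CommRing R'] (φ : A →+* R) (t : A) (ht : IsUnit (φ t))
    (r : R →+* R') (h : IsUnit (r.comp φ t)) :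
    r.comp (awayHom 𝒜 φ t ht) = awayHom 𝒜 (r.comp φ) t h := by
  rw [awayHom, awayHom, ← RingHom.comp_assoc]
  congr 1
  apply IsLocalization.ringHom_ext (M := .powers t)
  ext a
  simp [Localization.awayLift, IsLocalization.Away.lift_eq]

theorem SpecMap_awayHom_awayι_eq (φ ψ : A →+* R) {t t' : A} (ht : IsUnit (φ t)) (ht' : IsUnit (ψ t'))
    (h1 : t ∈ 𝒜 1) (h1' : t' ∈ 𝒜 1) (w : R) (hw : IsUnit w)
    (h : ∀ n, ∀ a ∈ 𝒜 n, φ a = w ^ n * ψ a) :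
    Spec.map (CommRingCat.ofHom (awayHom 𝒜 φ t ht)) ≫ Proj.awayι 𝒜 t h1 one_pos =
      Spec.map (CommRingCat.ofHom (awayHom 𝒜 ψ t' ht')) ≫ Proj.awayι 𝒜 t' h1' one_pos := by
  have hψ : IsUnit (ψ t) := by
    have := h _ _ h1
    rw [this] at ht
    exact isUnit_of_mul_isUnit_right ht
  have hψ2 : IsUnit (ψ (t * t')) := by rw [map_mul]; exact hψ.mul ht'
  have hφ2 : IsUnit (φ (t * t')) := by
    rw [map_mul, h _ _ h1']; exact ht.mul ((hw.pow 1).mul ht')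
  rw [← awayHom_comp_awayMap 𝒜 φ h1' rfl ht hφ2,
    ← awayHom_comp_awayMap 𝒜 ψ h1 (mul_comm t t') ht' hψ2, awayHom_twist 𝒜 φ ψ _ hφ2 hψ2 w h]
  simp only [CommRingCat.ofHom_comp, Spec.map_comp, Category.assoc]
  rw [Proj.SpecMap_awayMap_awayι, Proj.SpecMap_awayMap_awayι]

end Away

section Schemes

variable {k : Type u} [Field k]

/-- The sections of `𝒪_X` over an open subset `U` of a `k`-scheme `X` form a `k`-algebra. -/
instance sectionsAlgebra (X : Over (Spec (.of k))) (U : X.left.Opens) : Algebra k Γ(X.left, U) :=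
  ((Scheme.ΓSpecIso (.of k)).inv ≫ X.hom.appTop ≫
    X.left.presheaf.map (homOfLE le_top).op).hom.toAlgebra

/-- The space of global sections `H⁰(X, L)`. -/
def H0 (X : Over (Spec (.of k))) (L : X.left.Modules) : Type u := Γ(L, ⊤)

instance (X : Over (Spec (.of k))) (L : X.left.Modules) : AddCommGroup (H0 X L) :=
  inferInstanceAs (AddCommGroup Γ(L, ⊤))

instance (X : Over (Spec (.of k))) (L : X.left.Modules) : Module Γ(X.left, ⊤) (H0 X L) :=
  inferInstanceAs (Module Γ(X.left, ⊤) Γ(L, ⊤))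

/-- `H⁰(X, L)` is a `k`-vector space through `k → H⁰(X, 𝒪_X)`. -/
instance (X : Over (Spec (.of k))) (L : X.left.Modules) : Module k (H0 X L) :=
  Module.compHom _ (algebraMap k Γ(X.left, ⊤))

/-- The tensor product of two `𝒪_X`-modules: the sheaf associated with `U ↦ M(U) ⊗ N(U)`. -/
def modTensor {X : Scheme.{u}} (M N : X.Modules) : X.Modules :=
  (PresheafOfModules.sheafification (𝟙 X.ringCatSheaf.obj)).obj
    (PresheafOfModules.Monoidal.tensorObj (R := X.presheaf) M.val N.val)

/-- An invertible sheaf: an `𝒪_X`-module which is locally isomorphic to `𝒪_X`. -/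
def IsInvertible {X : Scheme.{u}} (L : X.Modules) : Prop :=
  ∀ x : X, ∃ U : X.Opens, x ∈ U ∧
    Nonempty (L.restrict U.ι ≅ SheafOfModules.unit U.toScheme.ringCatSheaf)

/-- The projective space `ℙ(E)` as a `k`-scheme. -/
def projOver (k E : Type u) [Field k] [AddCommGroup E] [Module k E] : Over (Spec (.of k)) :=
  Over.mk (projSpaceStr k E)

theorem toSpecΓ_algebraMap (X : Over (Spec (.of k))) (U : X.left.Opens) :
    U.toSpecΓ ≫ Spec.map (CommRingCat.ofHom (algebraMap k Γ(X.left, U))) = U.ι ≫ X.hom := by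
  change U.toSpecΓ ≫ Spec.map ((Scheme.ΓSpecIso (.of k)).inv ≫ X.hom.appTop ≫
    X.left.presheaf.map (homOfLE le_top).op) = _
  rw [Spec.map_comp, Spec.map_comp, Category.assoc,
    Scheme.Opens.toSpecΓ_SpecMap_presheaf_map_top_assoc, ← Scheme.toSpecΓ_naturality_assoc,
    toSpecΓ_SpecMap_ΓSpecIso_inv, Category.comp_id]

section LinearSystem

variable (X : Over (Spec (.of k))) (L : X.left.Modules)

/-- The restriction of a global section of `L` to an open subset `U`. -/
def resTo (U : X.left.Opens) (s : H0 X L) : Γ(L, U) :=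
  L.presheaf.map (homOfLE le_top : U ⟶ ⊤).op s

/-- The global section `s` is a frame of `L` over `U`: multiplication by `s` is an isomorphism
`𝒪_U ≃ L|_U`. -/
def IsFrame (s : H0 X L) (U : X.left.Opens) : Prop :=
  ∀ V ≤ U, Function.Bijective (fun r : Γ(X.left, V) => r • resTo X L V s)

/-- A global section together with an open subset on which it is a frame. -/
structure Frame where
  s : H0 X L
  U : X.left.Opens
  isFrame : IsFrame X L s U

/-- The complement `X - B` of the base locus `B` of an invertible sheaf `L`: the open subset of
the points near which `L` is generated by a global section. -/
def nonBase : X.left.Opens := ⨆ F : Frame X L, F.U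

/-- `X - B` as a `k`-scheme. -/
def nonBaseOver : Over (Spec (.of k)) := Over.mk ((nonBase X L).ι ≫ X.hom)

/-- The inclusion of `X - B` in `X`. -/
def nonBaseι : nonBaseOver X L ⟶ X := Over.homMk (nonBase X L).ι

variable {X L}

theorem resTo_add (U : X.left.Opens) (s t : H0 X L) :
    resTo X L U (s + t) = resTo X L U s + resTo X L U t := map_add _ _ _

theorem res_algebraMap {U V : X.left.Opens} (h : V ≤ U) (c : k) :
    X.left.presheaf.map (homOfLE h).op (algebraMap k Γ(X.left, U) c) =
      algebraMap k Γ(X.left, V) c := by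
  have := X.left.presheaf.map_comp (homOfLE le_top : U ⟶ ⊤).op (homOfLE h).op
  exact (congrArg (fun f => f.hom (X.hom.appTop.hom ((Scheme.ΓSpecIso (.of k)).inv.hom c)))
    this).symm

theorem resTo_smul (U : X.left.Opens) (c : k) (s : H0 X L) :
    resTo X L U (c • s) = algebraMap k Γ(X.left, U) c • resTo X L U s := by
  refine (Scheme.Modules.map_smul L _ (algebraMap k Γ(X.left, ⊤) c) s).trans ?_
  congr 1
  exact res_algebraMap le_top c

theorem resTo_res {U V : X.left.Opens} (h : V ≤ U) (s : H0 X L) :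
    L.presheaf.map (homOfLE h).op (resTo X L U s) = resTo X L V s := by
  have := L.presheaf.map_comp (homOfLE le_top : U ⟶ ⊤).op (homOfLE h).op
  exact (congrArg (fun f => f.hom s) this).symm

namespace Frame

/-- The quotient `e / s`, a function on `U`, of a global section `e` by the frame `s`. -/
def quot (F : Frame X L) : H0 X L →ₗ[k] Γ(X.left, F.U) where
  toFun e := (Equiv.ofBijective _ (F.isFrame F.U le_rfl)).symm (resTo X L F.U e)
  map_add' e e' := by
    rw [Equiv.symm_apply_eq, Equiv.ofBijective_apply, add_smul, resTo_add]
    congr 1 <;> exact ((Equiv.ofBijective _ (F.isFrame F.U le_rfl)).apply_symm_apply _).symm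
  map_smul' c e := by
    rw [Equiv.symm_apply_eq, Equiv.ofBijective_apply, resTo_smul, RingHom.id_apply,
      Algebra.smul_def, mul_smul]
    congr 1
    exact ((Equiv.ofBijective _ (F.isFrame F.U le_rfl)).apply_symm_apply _).symm

theorem quot_smul (F : Frame X L) (e : H0 X L) :
    F.quot e • resTo X L F.U F.s = resTo X L F.U e :=
  (Equiv.ofBijective _ (F.isFrame F.U le_rfl)).apply_symm_apply _

/-- The algebra homomorphism `Sym E → 𝒪(U)`, `e ↦ e / s`. -/
def ringHom (F : Frame X L) : SymmetricAlgebra k (H0 X L) →ₐ[k] Γ(X.left, F.U) :=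
  SymmetricAlgebra.lift F.quot

theorem quot_self (F : Frame X L) : F.quot F.s = 1 := by
  apply (F.isFrame F.U le_rfl).1
  simp [quot_smul]

theorem ringHom_self (F : Frame X L) : F.ringHom (SymmetricAlgebra.ι k _ F.s) = 1 := by
  rw [ringHom, SymmetricAlgebra.lift_ι_apply, quot_self]

end Frame

namespace Frame

/-- The morphism `U → ℙ(E)` defined by a frame: the composite `U → Spec (Sym E)_(s) ⊆ ℙ(E)` given
by the functions `e / s`. -/
def toProj (F : Frame X L) : F.U.toScheme ⟶ projSpace k (H0 X L) :=
  F.U.toSpecΓ ≫ Spec.map (CommRingCat.ofHom (awayHom (symGrading k (H0 X L)) F.ringHom.toRingHom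
      (SymmetricAlgebra.ι k _ F.s) (by
        change IsUnit (F.ringHom _); rw [ringHom_self]; exact isUnit_one))) ≫
    Proj.awayι (symGrading k (H0 X L)) (SymmetricAlgebra.ι k _ F.s) (ι_mem k F.s) one_pos

theorem toProj_compat (F F' : Frame X L) :
    X.left.homOfLE (inf_le_left : F.U ⊓ F'.U ≤ F.U) ≫ F.toProj =
      X.left.homOfLE (inf_le_right : F.U ⊓ F'.U ≤ F'.U) ≫ F'.toProj := by
  rw [toProj, toProj, ← Scheme.Opens.toSpecΓ_SpecMap_presheaf_map_assoc,
    ← Scheme.Opens.toSpecΓ_SpecMap_presheaf_map_assoc]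
  congr 1
  set r := (X.left.presheaf.map (homOfLE (inf_le_left : F.U ⊓ F'.U ≤ F.U)).op).hom with hr
  set r' := (X.left.presheaf.map (homOfLE (inf_le_right : F.U ⊓ F'.U ≤ F'.U)).op).hom with hr'
  have e1 : r (F.ringHom (SymmetricAlgebra.ι k _ F.s)) = 1 := by rw [ringHom_self, map_one]
  have e1' : r' (F'.ringHom (SymmetricAlgebra.ι k _ F'.s)) = 1 := by rw [ringHom_self, map_one]
  have h1 : IsUnit ((r.comp F.ringHom.toRingHom) (SymmetricAlgebra.ι k _ F.s)) := by
    change IsUnit (r (F.ringHom (SymmetricAlgebra.ι k _ F.s))); rw [e1]; exact isUnit_one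
  have h2 : IsUnit ((r'.comp F'.ringHom.toRingHom) (SymmetricAlgebra.ι k _ F'.s)) := by
    change IsUnit (r' (F'.ringHom (SymmetricAlgebra.ι k _ F'.s))); rw [e1']; exact isUnit_one
  have q : ∀ e, r (F.quot e) = r (F.quot F'.s) * r' (F'.quot e) := by
    intro e
    apply (F.isFrame (F.U ⊓ F'.U) inf_le_left).1
    have a1 : ∀ e, r (F.quot e) • resTo X L (F.U ⊓ F'.U) F.s = resTo X L (F.U ⊓ F'.U) e := by
      intro e
      rw [← resTo_res inf_le_left F.s, ← resTo_res inf_le_left e, ← F.quot_smul e]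
      exact (Scheme.Modules.map_smul L _ _ _).symm
    have a2 : r' (F'.quot e) • resTo X L (F.U ⊓ F'.U) F'.s = resTo X L (F.U ⊓ F'.U) e := by
      rw [← resTo_res inf_le_right F'.s, ← resTo_res inf_le_right e, ← F'.quot_smul e]
      exact (Scheme.Modules.map_smul L _ _ _).symm
    change r (F.quot e) • resTo X L (F.U ⊓ F'.U) F.s =
      (r (F.quot F'.s) * r' (F'.quot e)) • resTo X L (F.U ⊓ F'.U) F.s
    rw [a1, mul_comm, mul_smul, a1, a2]
  have hw : IsUnit (r (F.quot F'.s)) := by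
    have := q F.s
    rw [quot_self, map_one] at this
    exact IsUnit.of_mul_eq_one _ this.symm
  have tw : ∀ n, ∀ a ∈ symGrading k (H0 X L) n, (r.comp F.ringHom.toRingHom) a =
      r (F.quot F'.s) ^ n * (r'.comp F'.ringHom.toRingHom) a := by
    intro n a ha
    unfold symGrading at ha
    induction ha using Submodule.pow_induction_on_left' with
    | algebraMap c =>
      change r (F.ringHom _) = _ * r' (F'.ringHom _)
      rw [AlgHom.commutes, AlgHom.commutes, hr, hr', pow_zero, _root_.one_mul]
      exact (res_algebraMap _ c).trans (res_algebraMap _ c).symm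
    | add x y i hx hy ihx ihy => rw [map_add, ihx, ihy, map_add, mul_add]
    | mem_mul m hm i x hx ih =>
      obtain ⟨m, rfl⟩ := hm
      have : (r.comp F.ringHom.toRingHom) (SymmetricAlgebra.ι k _ m) =
          r (F.quot F'.s) * (r'.comp F'.ringHom.toRingHom) (SymmetricAlgebra.ι k _ m) := by
        change r (F.ringHom _) = _ * r' (F'.ringHom _)
        rw [ringHom, ringHom, SymmetricAlgebra.lift_ι_apply, SymmetricAlgebra.lift_ι_apply, q]
      rw [map_mul, ih, this, map_mul, Nat.succ_eq_add_one]
      ring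
  have key := SpecMap_awayHom_awayι_eq (symGrading k (H0 X L)) (r.comp F.ringHom.toRingHom)
    (r'.comp F'.ringHom.toRingHom) h1 h2 (ι_mem k F.s) (ι_mem k F'.s) _ hw tw
  rw [← comp_awayHom _ F.ringHom.toRingHom _ (by
      change IsUnit (F.ringHom _); rw [ringHom_self]; exact isUnit_one),
    ← comp_awayHom _ F'.ringHom.toRingHom _ (by
      change IsUnit (F'.ringHom _); rw [ringHom_self]; exact isUnit_one)] at key
  simp only [CommRingCat.ofHom_comp, Spec.map_comp, Category.assoc] at key
  exact key

theorem toProj_str (F : Frame X L) : F.toProj ≫ projSpaceStr k (H0 X L) = F.U.ι ≫ X.hom := by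
  rw [← toSpecΓ_algebraMap, toProj, projSpaceStr, Category.assoc, Category.assoc,
    Proj.awayι_toSpecZero_assoc, ← Spec.map_comp, ← Spec.map_comp, ← CommRingCat.ofHom_comp,
    ← CommRingCat.ofHom_comp]
  congr 3
  ext c
  have h := awayHom_mk (symGrading k (H0 X L)) F.ringHom.toRingHom
    (SymmetricAlgebra.ι k _ F.s) (by
      change IsUnit (F.ringHom _); rw [ringHom_self]; exact isUnit_one)
    ⟨0, algebraMap k (symGrading k (H0 X L) 0) c, 1, Submonoid.one_mem _⟩
  have h1 : F.ringHom.toRingHom ((1 : symGrading k (H0 X L) 0) : SymmetricAlgebra k (H0 X L)) = 1 :=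
    map_one F.ringHom
  rw [h1, _root_.mul_one] at h
  exact h.trans (F.ringHom.commutes c)

end Frame

theorem toProj_glue (F F' : Frame X L) :
    pullback.fst (X.left.homOfLE (le_iSup (fun F : Frame X L => F.U) F))
        (X.left.homOfLE (le_iSup (fun F : Frame X L => F.U) F')) ≫ F.toProj =
      pullback.snd (X.left.homOfLE (le_iSup (fun F : Frame X L => F.U) F))
        (X.left.homOfLE (le_iSup (fun F : Frame X L => F.U) F')) ≫ F'.toProj := by
  let e := (isPullback_opens_inf_le (le_iSup (fun F : Frame X L => F.U) F)
    (le_iSup (fun F : Frame X L => F.U) F')).isoPullback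
  rw [← cancel_epi e.hom]
  simpa [e] using Frame.toProj_compat F F'

variable (X L) in
/-- The morphism `ν : X - B → ℙ(E)`, `E = H⁰(X, L)`, which sends a point `x` to the quotient
`E → L_x`, `s ↦ s(x)`; over an open subset on which `s` is a frame, `ν` is given by the functions
`e / s`. -/
def nu : (nonBase X L).toScheme ⟶ projSpace k (H0 X L) :=
  (Scheme.Opens.iSupOpenCover (fun F : Frame X L => F.U)).glueMorphisms (fun F => F.toProj)
    toProj_glue

theorem Frame.le_nonBase (F : Frame X L) : F.U ≤ nonBase X L :=
  le_iSup (fun F : Frame X L => F.U) F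

theorem homOfLE_nu (F : Frame X L) : X.left.homOfLE F.le_nonBase ≫ nu X L = F.toProj :=
  (Scheme.Opens.iSupOpenCover (fun F : Frame X L => F.U)).ι_glueMorphisms
    (fun F => F.toProj) toProj_glue F

theorem nu_str : nu X L ≫ projSpaceStr k (H0 X L) = (nonBase X L).ι ≫ X.hom := by
  have key : ∀ F : Frame X L, X.left.homOfLE F.le_nonBase ≫ nu X L ≫ projSpaceStr k (H0 X L) =
      X.left.homOfLE F.le_nonBase ≫ (nonBase X L).ι ≫ X.hom := by
    intro F
    rw [reassoc_of% (homOfLE_nu F), Scheme.homOfLE_ι_assoc]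
    exact Frame.toProj_str F
  exact (Scheme.Opens.iSupOpenCover (fun F : Frame X L => F.U)).hom_ext _ _ key

variable (X L) in
/-- `ν` as a morphism of `k`-schemes. -/
def nuOver : nonBaseOver X L ⟶ projOver k (H0 X L) :=
  Over.homMk (nu X L) (nu_str)

end LinearSystem

/-- For a group scheme `G` acting on `X` through `τ : G × X → X`, an `𝒪_X`-module `L` is
`G`-invariant if `τ^* L` is isomorphic to `p₁^* N ⊗ p₂^* L` for some invertible sheaf `N`
on `G`. -/
def IsInvariant (G X : Over (Spec (.of k))) [GrpObj G] [ModObj G X] (L : X.left.Modules) : Prop :=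
  ∃ N : G.left.Modules, IsInvertible N ∧
    Nonempty ((Scheme.Modules.pullback (γ[G, X] : G ⊗ X ⟶ X).left).obj L ≅
      modTensor ((Scheme.Modules.pullback (fst G X).left).obj N)
        ((Scheme.Modules.pullback (snd G X).left).obj L))

section Projectivities

variable (S : Over (Spec (.of k))) (E : Type u) [AddCommGroup E] [Module k E]

/-- `Γ(U, 𝒪) ⊗ E`, the sections over an affine open `U` of the quasi-coherent module
`E_S = 𝒪_S ⊗ E`. -/
abbrev sectionsOn (U : S.left.Opens) : Type u := Γ(S.left, U) ⊗[k] E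

theorem affineStr {U : S.left.Opens} (hU : IsAffineOpen U) :
    hU.fromSpec ≫ S.hom = Spec.map (CommRingCat.ofHom (algebraMap k Γ(S.left, U))) := by
  have h := toSpecΓ_algebraMap S U
  rw [← hU.isoSpec_inv_ι, Category.assoc, ← h, hU.isoSpec_inv_toSpecΓ_assoc]

/-- For an affine open `U = Spec A` of `S`, the open immersion
`ℙ_A(A ⊗ E) = U × ℙ(E) → S × ℙ(E)`. -/
def chart {U : S.left.Opens} (hU : IsAffineOpen U) :
    Over.mk (projSpaceStr Γ(S.left, U) (sectionsOn S E U) ≫ hU.fromSpec ≫ S.hom) ⟶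
      S ⊗ projOver k E :=
  lift (Over.homMk (projSpaceStr Γ(S.left, U) (sectionsOn S E U) ≫ hU.fromSpec) (by simp))
    (Over.homMk (projBaseChange k Γ(S.left, U) E) (by
      simp [projOver, projBaseChange, projMap_str, affineStr]))

variable {S E}

/-- The endomorphism `τ` of `ℙ_S(E_S) = S × ℙ(E)` is induced over the affine open `U` by the
automorphism `T` of `E_S|_U`. -/
def IsInducedOn (τ : S ⊗ projOver k E ⟶ S ⊗ projOver k E) {U : S.left.Opens}
    (hU : IsAffineOpen U) (T : sectionsOn S E U ≃ₗ[Γ(S.left, U)] sectionsOn S E U) : Prop :=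
  (chart S E hU).left ≫ τ.left = projAut T ≫ (chart S E hU).left

/-- An endomorphism `T` of an `A`-module `M` is coherent if `A[T] ⬝ m` is a finitely generated
`A`-module for all `m` in `M`. -/
def IsCoherentEnd {A M : Type*} [CommRing A] [AddCommGroup M] [Module A M] (T : M →ₗ[A] M) :
    Prop :=
  ∀ m : M, (Submodule.span A (Set.range fun n : ℕ => (T ^ n) m)).FG

/-- An automorphism of the `S`-scheme `ℙ_S(E_S) = S × ℙ(E)` is a coherent projectivity if, locally
on `S`, it is induced by a coherent automorphism of the module `E_S`. -/
def IsCoherentProjectivity (τ : S ⊗ projOver k E ⟶ S ⊗ projOver k E) : Prop :=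
  IsIso τ ∧ τ ≫ fst S (projOver k E) = fst S (projOver k E) ∧
    ∀ s : S.left, ∃ (U : S.left.Opens) (hU : IsAffineOpen U)
      (T : sectionsOn S E U ≃ₗ[Γ(S.left, U)] sectionsOn S E U),
      s ∈ U ∧ IsInducedOn τ hU T ∧ IsCoherentEnd T.toLinearMap

/-- A subspace `V` of `E` (i.e. a linear subsystem) is stable under the projectivity `τ` of
`ℙ_S(E_S)` if, locally on `S`, `τ` is induced by an automorphism of `E_S` that maps `V_S` into
itself. -/
def IsStableUnder (τ : S ⊗ projOver k E ⟶ S ⊗ projOver k E) (V : Submodule k E) : Prop :=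
  ∀ s : S.left, ∃ (U : S.left.Opens) (hU : IsAffineOpen U)
    (T : sectionsOn S E U ≃ₗ[Γ(S.left, U)] sectionsOn S E U),
    s ∈ U ∧ IsInducedOn τ hU T ∧
      (V.baseChange Γ(S.left, U)).map T.toLinearMap ≤ V.baseChange Γ(S.left, U)

end Projectivities

end Schemes

end

end ProjAction

/-!
Write `E = H⁰(X, L)`, and let `τ : G × X → X` be the action. Over an affine open subset `U` of `G`
on which the sheaf `N` of the invariance isomorphism `τ^* L ≃ p₁^* N ⊗ p₂^* L` has a frame, this
isomorphism turns `τ^* e`, for `e` in `E`, into a section of `p₂^* L` over `U × X`. As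
`H⁰(U × X, p₂^* L) = 𝒪(U) ⊗ E`, also when `E` has infinite dimension
(`exists_tensor_of_frames`), this gives an
endomorphism `T` of the `𝒪(U)`-module `𝒪(U) ⊗ E`; it is an automorphism, because `L` can be
transported back along `(g, y) ↦ (g, g⁻¹ y)` (`exists_transport`). It is characterized up to units
by `IsTransport`: the value of `T e` at a point `x` is proportional to the value of `e` at `g x`.
Two such automorphisms over overlapping open sets differ by the ratio of the frames, so that they
glue to a morphism `G × ℙ(E) → ℙ(E)` (`AutSystem.mor`).

That this morphism is an action means that `T_{gh}` and `T_h T_g` are proportional, as families over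
`G × G`. Since both transport sections along `gh`, they differ by a scalar at the generic point, and
this scalar is a unit of `B ⊗ F`, where `B` is a coordinate ring of `G × G` and `F` is the function
field of `X`. It has to be shown that it comes from `B`. If the scalar equals `1` at a `k`-point of
`Spec B`, this is so by a theorem in the spirit of Rosenlicht's on the units of a product
(`exists_eq_one_tmul_of_unit`): every valuation ring of `F` over `k` contains the coordinates of
such a unit with respect to a `k`-basis of `B`, hence these coordinates lie in `k`. After `T` is
normalized to be the identity at the neutral element, this applies near the point `(1, 1)` of
`G × G`, and the proportionality spreads from there to all of `G × G`, which is integral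
(`AutSystem.proportional_mul`).

For `e` in `E`, let `V` be the space of coefficients of `T e`, the smallest subspace with
`T e ∈ 𝒪(U) ⊗ V` for a neighbourhood `U` of the neutral element. It has finite dimension and contains `e`.
For `g` near the neutral element `T_h T_g e` is proportional to `T_{gh} e`, which has its
coefficients in `V`; as the coefficients of `T_g e` span `V`, it follows that `T_h` maps `V` into
itself (`AutSystem.exists_stable`). Coherence follows, as the rings `𝒪(U)` are noetherian
(`isCoherentEnd_of_stable`).

Finally `G × (X - B)` is reduced and `ℙ(E)` is separated, so that the equivariance of
`ν : X - B → ℙ(E)` may be checked at points with values in fields; there it is the proportionality of the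
functionals `e ↦ (T e)(x)` and `e ↦ e(g x)` (`nuOver_equivariant`).
-/

namespace ProjAction

noncomputable section

/-! ### Frames of sheaves of modules and their pullbacks -/

section Frames
variable {X Y : Scheme.{u}}

/-- The restriction of sections of a sheaf of modules. -/
def resM (M : X.Modules) {U V : X.Opens} (h : V ≤ U) (s : Γ(M, U)) : Γ(M, V) :=
  M.presheaf.map (homOfLE h).op s

theorem resM_resM (M : X.Modules) {U V W : X.Opens} (h : V ≤ U) (h' : W ≤ V) (s : Γ(M, U)) :
    resM M h' (resM M h s) = resM M (h'.trans h) s := by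
  have := M.presheaf.map_comp (homOfLE h).op (homOfLE h').op
  exact (congrArg (fun f => f.hom s) this).symm

theorem resM_self (M : X.Modules) {U : X.Opens} (s : Γ(M, U)) : resM M le_rfl s = s := by
  have := M.presheaf.map_id (.op U)
  exact (congrArg (fun f => f.hom s) this)

theorem resM_add (M : X.Modules) {U V : X.Opens} (h : V ≤ U) (s t : Γ(M, U)) :
    resM M h (s + t) = resM M h s + resM M h t := map_add _ _ _

/-- The restriction of functions. -/
def resO (X : Scheme.{u}) {U V : X.Opens} (h : V ≤ U) : Γ(X, U) →+* Γ(X, V) :=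
  (X.presheaf.map (homOfLE h).op).hom

theorem resM_smul (M : X.Modules) {U V : X.Opens} (h : V ≤ U) (r : Γ(X, U)) (s : Γ(M, U)) :
    resM M h (r • s) = resO X h r • resM M h s := Scheme.Modules.map_smul M _ r s

theorem app_resM {M N : X.Modules} (φ : M ⟶ N) {U V : X.Opens} (h : V ≤ U) (s : Γ(M, U)) :
    φ.app V (resM M h s) = resM N h (φ.app U s) := by
  have := φ.mapPresheaf.naturality (homOfLE h).op
  exact congr($this s)

/-- The section `s` over `U` is a frame of `M`: over every open subset of `U` multiplication by `s`
is an isomorphism from functions to sections of `M`. -/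
def IsFrameOn (M : X.Modules) {U : X.Opens} (s : Γ(M, U)) : Prop :=
  ∀ V (h : V ≤ U), Function.Bijective (fun r : Γ(X, V) => r • resM M h s)

theorem IsFrameOn.res {M : X.Modules} {U V : X.Opens} {s : Γ(M, U)} (hs : IsFrameOn M s)
    (h : V ≤ U) : IsFrameOn M (resM M h s) := by
  intro W hW
  simpa only [resM_resM] using hs W (hW.trans h)

theorem IsFrameOn.map_iso {M N : X.Modules} (φ : M ≅ N) {U : X.Opens} {s : Γ(M, U)}
    (hs : IsFrameOn M s) : IsFrameOn N (φ.hom.app U s) := by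
  intro V hV
  have h1 : Function.Bijective (φ.hom.app V) := by
    have : IsIso (φ.hom.app V) := inferInstance
    exact ConcreteCategory.bijective_of_isIso _
  convert! h1.comp (hs V hV) using 1
  ext r
  simp [app_resM, Scheme.Modules.Hom.app_smul]

/-- The pullback `f^* s` of a section `s` of `M` over `U`, as a section of `f^* M` over `f⁻¹ U`. -/
def pb (f : Y ⟶ X) (M : X.Modules) (U : X.Opens) (s : Γ(M, U)) :
    Γ((Scheme.Modules.pullback f).obj M, f ⁻¹ᵁ U) :=
  ((Scheme.Modules.pullbackPushforwardAdjunction f).unit.app M).app U s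

theorem pb_smul (f : Y ⟶ X) (M : X.Modules) (U : X.Opens) (r : Γ(X, U)) (s : Γ(M, U)) :
    pb f M U (r • s) = f.app U r • pb f M U s :=
  Scheme.Modules.Hom.app_smul ((Scheme.Modules.pullbackPushforwardAdjunction f).unit.app M) r s

theorem pb_res (f : Y ⟶ X) (M : X.Modules) {U V : X.Opens} (h : V ≤ U) (s : Γ(M, U)) :
    pb f M V (resM M h s) = resM _ (f.preimage_mono h) (pb f M U s) :=
  app_resM ((Scheme.Modules.pullbackPushforwardAdjunction f).unit.app M) h s


/-- A morphism of sheaves of modules, from its components. -/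
def homMk (M N : X.Modules) (f : ∀ U : X.Opens, Γ(M, U) →+ Γ(N, U))
    (hsmul : ∀ U (r : Γ(X, U)) (m : Γ(M, U)), f U (r • m) = r • f U m)
    (hres : ∀ U V (h : V ≤ U) (m : Γ(M, U)), f V (resM M h m) = resM N h (f U m)) : M ⟶ N :=
  ⟨{ app := fun U => ModuleCat.ofHom (X := M.val.obj U) (Y := N.val.obj U)
        { toFun := f U.unop
          map_add' := map_add _
          map_smul' := hsmul U.unop }
     naturality := by
      intro U V g
      ext m
      exact hres U.unop V.unop (leOfHom g.unop) m }⟩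

theorem resM_bijective (M : X.Modules) {U V : X.Opens} (h : V ≤ U) (e : U = V) :
    Function.Bijective (resM M h) := by
  subst e
  have : resM M h = id := funext fun s => resM_self M s
  rw [this]; exact Function.bijective_id

/-- The sheaf `Q` is the direct image of its restriction to `V`: sections over `U` are the same as
sections over `U ∩ V`. -/
def IsDirectImageFrom (Q : X.Modules) (V : X.Opens) : Prop :=
  ∀ U, Function.Bijective (resM Q (inf_le_left : U ⊓ V ≤ U))

/-- A frame `s` of `M` over `V` has the universal property of a basis with respect to the sheaves
`Q` which are direct images from `V`. Together with `isFrameOn_of_existsUnique` this characterizes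
frames by mapping properties, which are preserved by pullback because pullback is left adjoint to
direct image. -/
theorem IsFrameOn.existsUnique_hom {M Q : X.Modules} {V : X.Opens} {s : Γ(M, V)}
    (hs : IsFrameOn M s) (hQ : IsDirectImageFrom Q V) (q : Γ(Q, V)) :
    ∃! g₀ : M ⟶ Q, g₀.app V s = q := by
  -- `c m` is the coordinate of `m` over `U ∩ V`; the morphism sought sends `m` to `c m • q`.
  let c (U : X.Opens) (m : Γ(M, U)) : Γ(X, U ⊓ V) :=
    (Equiv.ofBijective _ (hs (U ⊓ V) inf_le_right)).symm (resM M inf_le_left m)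
  have hc U m : c U m • resM M inf_le_right s = resM M inf_le_left m :=
    (Equiv.ofBijective _ (hs (U ⊓ V) inf_le_right)).apply_symm_apply _
  have hc' U (m) (r) (h : r • resM M inf_le_right s = resM M inf_le_left m) : c U m = r :=
    (hs (U ⊓ V) inf_le_right).1 ((hc U m).trans h.symm)
  let d (U : X.Opens) (m : Γ(M, U)) : Γ(Q, U) :=
    (Equiv.ofBijective _ (hQ U)).symm (c U m • resM Q inf_le_right q)
  have hd U m : resM Q inf_le_left (d U m) = c U m • resM Q inf_le_right q :=
    (Equiv.ofBijective _ (hQ U)).apply_symm_apply _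
  refine ⟨homMk M Q (fun U => AddMonoidHom.mk' (d U) ?_) ?_ ?_, ?_, ?_⟩
  · intro a b
    apply (hQ U).1
    rw [resM_add, hd, hd, hd, ← add_smul]
    congr 1
    apply hc'
    rw [add_smul, hc, hc, resM_add]
  · intro U r m
    apply (hQ U).1
    change resM Q _ (d U _) = resM Q _ (_ • d U _)
    rw [resM_smul, hd, hd, ← mul_smul]
    congr 1
    apply hc'
    rw [mul_smul, hc, resM_smul]
  · intro U W h m
    apply (hQ W).1
    change resM Q _ (d W _) = resM Q _ (resM Q _ (d U _))
    rw [resM_resM, hd, ← resM_resM Q inf_le_left (inf_le_inf_right V h), hd, resM_smul, resM_resM]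
    congr 1
    apply hc'
    rw [resM_resM, ← resM_resM M inf_le_left (inf_le_inf_right V h), ← hc, resM_smul, resM_resM]
  · change d V s = q
    apply (hQ V).1
    rw [hd, hc' V s 1 (by rw [one_smul]), one_smul]
  · intro g₀ hg₀
    apply Scheme.Modules.hom_ext
    intro U
    ext m
    apply (hQ U).1
    change resM Q _ (g₀.app U m) = resM Q _ (d U m)
    rw [hd, ← app_resM, ← hc, Scheme.Modules.Hom.app_smul, app_resM, hg₀]

theorem isDirectImageFrom_pushforward_restrict (M : X.Modules) (V : X.Opens) :
    IsDirectImageFrom ((Scheme.Modules.pushforward V.ι).obj (M.restrict V.ι)) V := by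
  intro U
  refine resM_bijective M (V.ι.image_mono (V.ι.preimage_mono inf_le_left)) ?_
  congr 1
  ext x
  have : V.ι x ∈ V := x.2
  simpa using fun _ => this

theorem smul_pushforward_restrict (M : X.Modules) (V U : X.Opens) (r : Γ(X, U))
    (m : Γ((Scheme.Modules.pushforward V.ι).obj (M.restrict V.ι), U)) :
    r • m = (M.smul (resO X (V.ι.image_preimage_le U) r)).hom m := by
  change (M.smul ((V.ι.appIso (V.ι ⁻¹ᵁ U)).inv (V.ι.app U r))).hom m = _
  have : (V.ι.appIso (V.ι ⁻¹ᵁ U)).inv (V.ι.app U r) = resO X (V.ι.image_preimage_le U) r :=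
    congr($(V.ι.app_appIso_inv U).hom r)
  rw [this]

/-- A section with the universal property of a basis is a frame. -/
theorem isFrameOn_of_existsUnique {M : X.Modules} {V : X.Opens} {t : Γ(M, V)}
    (H : ∀ Q, IsDirectImageFrom Q V → ∀ q : Γ(Q, V), ∃! g₀ : M ⟶ Q, g₀.app V t = q) :
    IsFrameOn M t := by
  let O : X.Modules := SheafOfModules.unit X.ringCatSheaf
  let Q1 := (Scheme.Modules.pushforward V.ι).obj (O.restrict V.ι)
  let Q2 := (Scheme.Modules.pushforward V.ι).obj (M.restrict V.ι)
  have le (U : X.Opens) : V.ι ''ᵁ V.ι ⁻¹ᵁ U ≤ U := V.ι.image_preimage_le U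
  have leV (U : X.Opens) : V.ι ''ᵁ V.ι ⁻¹ᵁ U ≤ V := by
    rintro _ ⟨x, -, rfl⟩; exact x.2
  -- the dual coordinate `δ`: the morphism to the direct image of `𝒪_V` which sends `t` to `1`
  let o : Γ(Q1, V) := (1 : Γ(X, V.ι ''ᵁ V.ι ⁻¹ᵁ V))
  obtain ⟨δ, hδ, -⟩ := H Q1 (isDirectImageFrom_pushforward_restrict O V) o
  let d (U : X.Opens) (m : Γ(M, U)) : Γ(X, V.ι ''ᵁ V.ι ⁻¹ᵁ U) := δ.app U m
  have d_smul U r m : d U (r • m) = resO X (le U) r * d U m :=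
    (Scheme.Modules.Hom.app_smul δ r m).trans (smul_pushforward_restrict O V U r _)
  have d_res U W (h : W ≤ U) m : d W (resM M h m) =
      resO X (V.ι.image_mono (V.ι.preimage_mono h)) (d U m) := app_resM δ h m
  -- `m ↦ δ(m) t` and `m ↦ m` are morphisms to the direct image of `M|_V`; both send `t` to `t`,
  -- so that they agree by uniqueness.
  let κ : M ⟶ Q2 := homMk M Q2 (fun U => AddMonoidHom.mk'
      (fun m => (d U m • resM M (leV U) t : Γ(M, V.ι ''ᵁ V.ι ⁻¹ᵁ U))) (by
        intro a b
        have : d U (a + b) = d U a + d U b := map_add (δ.app U).hom a b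
        rw [this, add_smul]; rfl))
      (fun U r m => by
        refine Eq.trans ?_ (smul_pushforward_restrict M V U r _).symm
        change d U (r • m) • resM M (leV U) t = resO X (le U) r • d U m • resM M (leV U) t
        rw [d_smul, mul_smul])
      (fun U W h m => by
        change d W (resM M h m) • resM M (leV W) t =
          resM M (V.ι.image_mono (V.ι.preimage_mono h)) (d U m • resM M (leV U) t)
        rw [d_res, resM_smul, resM_resM])
  let υ : M ⟶ Q2 := homMk M Q2 (fun U => AddMonoidHom.mk'
      (fun m => (resM M (le U) m : Γ(M, V.ι ''ᵁ V.ι ⁻¹ᵁ U))) (resM_add M (le U)))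
      (fun U r m => (resM_smul M (le U) r m).trans (smul_pushforward_restrict M V U r _).symm)
      (fun U W h m => by
        change resM M (le W) (resM M h m) =
          resM M (V.ι.image_mono (V.ι.preimage_mono h)) (resM M (le U) m)
        rw [resM_resM, resM_resM])
  have e : κ = υ := (H Q2 (isDirectImageFrom_pushforward_restrict M V) (resM M (le V) t)).unique
    (by
      change d V t • resM M (leV V) t = resM M (le V) t
      have : d V t = 1 := hδ
      rw [this, one_smul]) rfl
  intro W hW
  have eq : W = V.ι ''ᵁ V.ι ⁻¹ᵁ W := by
    ext x
    simp only [SetLike.mem_coe]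
    exact ⟨fun hx => ⟨⟨x, hW hx⟩, hx, rfl⟩, fun hx => le W hx⟩
  have key (m : Γ(M, W)) : d W m • resM M (leV W) t = resM M (le W) m := congr($(e).app W m)
  have hO : Function.Bijective (resO X (le W)) := resM_bijective O (le W) eq
  have hM := resM_bijective M (le W) eq
  constructor
  · intro a b hab
    apply hO.1
    have h1 (r : Γ(X, W)) : d W (r • resM M hW t) = resO X (le W) r := by
      rw [d_smul, d_res]
      have : d V t = 1 := hδ
      rw [this, map_one, _root_.mul_one]
    rw [← h1, ← h1]
    exact congrArg _ hab
  · intro m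
    obtain ⟨r, hr⟩ := hO.2 (d W m)
    refine ⟨r, hM.1 ?_⟩
    change resM M _ (r • resM M hW t) = _
    rw [resM_smul, hr, resM_resM, key]

/-- The pullback of a frame is a frame. -/
theorem IsFrameOn.pb {M : X.Modules} {V : X.Opens} {s : Γ(M, V)} (hs : IsFrameOn M s)
    (f : Y ⟶ X) : IsFrameOn _ (pb f M V s) := by
  apply isFrameOn_of_existsUnique
  intro Q hQ q
  have hQ' : IsDirectImageFrom ((Scheme.Modules.pushforward f).obj Q) V := fun U => hQ (f ⁻¹ᵁ U)
  let e := (Scheme.Modules.pullbackPushforwardAdjunction f).homEquiv M Q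
  refine (e.existsUnique_congr (q := fun g₀ => g₀.app V s = q) ?_).mpr
    (hs.existsUnique_hom hQ' q)
  intro g₀
  simp only [e, Adjunction.homEquiv_apply]
  rfl
end Frames

/-! ### Coordinates with respect to a frame, and frames of tensor products -/

section Frames
variable {X Y : Scheme.{u}}

/-- The coordinate of a section with respect to a frame, i.e. the quotient of the two. -/
def IsFrameOn.coord {M : X.Modules} {V : X.Opens} {s : Γ(M, V)} (hs : IsFrameOn M s)
    {W : X.Opens} (h : W ≤ V) : Γ(M, W) ≃ₗ[Γ(X, W)] Γ(X, W) :=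
  (LinearEquiv.ofBijective (LinearMap.toSpanSingleton Γ(X, W) Γ(M, W) (resM M h s)) (hs W h)).symm

theorem IsFrameOn.coord_smul {M : X.Modules} {V : X.Opens} {s : Γ(M, V)} (hs : IsFrameOn M s)
    {W : X.Opens} (h : W ≤ V) (m : Γ(M, W)) : hs.coord h m • resM M h s = m :=
  (LinearEquiv.ofBijective (LinearMap.toSpanSingleton Γ(X, W) Γ(M, W) (resM M h s))
    (hs W h)).apply_symm_apply m

theorem IsFrameOn.coord_eq {M : X.Modules} {V : X.Opens} {s : Γ(M, V)} (hs : IsFrameOn M s)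
    {W : X.Opens} (h : W ≤ V) {m : Γ(M, W)} {r : Γ(X, W)} (e : r • resM M h s = m) :
    hs.coord h m = r := (hs W h).1 ((hs.coord_smul h m).trans e.symm)

theorem IsFrameOn.coord_res {M : X.Modules} {V : X.Opens} {s : Γ(M, V)} (hs : IsFrameOn M s)
    {W W' : X.Opens} (h : W ≤ V) (h' : W' ≤ W) (m : Γ(M, W)) :
    hs.coord (h'.trans h) (resM M h' m) = resO X h' (hs.coord h m) := by
  apply hs.coord_eq
  rw [← resM_resM M h h', ← resM_smul, hs.coord_smul]

/-- The section `m ⊗ n` of `M ⊗ N`. -/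
def tens {M N : X.Modules} {U : X.Opens} (m : Γ(M, U)) (n : Γ(N, U)) : Γ(modTensor M N, U) :=
  ((PresheafOfModules.sheafificationAdjunction (𝟙 X.ringCatSheaf.obj)).unit.app
    (PresheafOfModules.Monoidal.tensorObj (R := X.presheaf) M.val N.val)).app (.op U)
    (show TensorProduct Γ(X, U) Γ(M, U) Γ(N, U) from m ⊗ₜ n)

/-- The morphism out of the presheaf tensor product given by bilinear maps which are compatible with
restrictions. -/
def presheafTensorLift (M N Q : X.Modules)
    (f : ∀ U : X.Opens, Γ(M, U) →ₗ[Γ(X, U)] Γ(N, U) →ₗ[Γ(X, U)] Γ(Q, U))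
    (hf : ∀ U V (h : V ≤ U) m n, f V (resM M h m) (resM N h n) = resM Q h (f U m n)) :
    PresheafOfModules.Monoidal.tensorObj (R := X.presheaf) M.val N.val ⟶
      (SheafOfModules.forget _ ⋙ PresheafOfModules.restrictScalars (𝟙 X.ringCatSheaf.obj)).obj Q where
  app U := ModuleCat.MonoidalCategory.tensorLift (R := X.presheaf.obj U)
    (M₁ := M.val.obj U) (M₂ := N.val.obj U) (M₃ := Q.val.obj U)
    (fun m n => f U.unop m n) (fun a b c => LinearMap.map_add₂ (f U.unop) a b c)
    (fun a b c => LinearMap.map_smul₂ (f U.unop) a b c)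
    (fun a b c => LinearMap.map_add (f U.unop a) b c)
    (fun a b c => LinearMap.map_smul (f U.unop b) a c)
  naturality {U V} g := ModuleCat.MonoidalCategory.tensor_ext fun m n => hf _ _ (leOfHom g.unop) m n

theorem presheafTensor_hom_ext {M N Q : X.Modules}
    {f g : PresheafOfModules.Monoidal.tensorObj (R := X.presheaf) M.val N.val ⟶
      (SheafOfModules.forget _ ⋙ PresheafOfModules.restrictScalars (𝟙 X.ringCatSheaf.obj)).obj Q}
    (h : ∀ (U : X.Opens) (m : Γ(M, U)) (n : Γ(N, U)),
      f.app (.op U) (show TensorProduct Γ(X, U) Γ(M, U) Γ(N, U) from m ⊗ₜ n) =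
      g.app (.op U) (show TensorProduct Γ(X, U) Γ(M, U) Γ(N, U) from m ⊗ₜ n)) : f = g := by
  apply PresheafOfModules.hom_ext
  intro U
  exact ModuleCat.MonoidalCategory.tensor_ext fun m n => h _ m n

theorem resM_tens {M N : X.Modules} {U V : X.Opens} (h : V ≤ U) (m : Γ(M, U)) (n : Γ(N, U)) :
    resM _ h (tens m n) = tens (resM M h m) (resM N h n) := by
  have := PresheafOfModules.naturality_apply
    ((PresheafOfModules.sheafificationAdjunction (𝟙 X.ringCatSheaf.obj)).unit.app
      (PresheafOfModules.Monoidal.tensorObj (R := X.presheaf) M.val N.val)) (homOfLE h).op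
    (show TensorProduct Γ(X, U) Γ(M, U) Γ(N, U) from m ⊗ₜ n)
  exact this.symm

theorem smul_tens {M N : X.Modules} {U : X.Opens} (r : Γ(X, U)) (m : Γ(M, U)) (n : Γ(N, U)) :
    tens (r • m) n = r • tens m n := by
  have := (((PresheafOfModules.sheafificationAdjunction (𝟙 X.ringCatSheaf.obj)).unit.app
      (PresheafOfModules.Monoidal.tensorObj (R := X.presheaf) M.val N.val)).app (.op U)).hom.map_smul r
    (show TensorProduct Γ(X, U) Γ(M, U) Γ(N, U) from m ⊗ₜ n)
  exact this

theorem tens_smul {M N : X.Modules} {U : X.Opens} (r : Γ(X, U)) (m : Γ(M, U)) (n : Γ(N, U)) :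
    tens m (r • n) = r • tens m n := by
  have := (((PresheafOfModules.sheafificationAdjunction (𝟙 X.ringCatSheaf.obj)).unit.app
      (PresheafOfModules.Monoidal.tensorObj (R := X.presheaf) M.val N.val)).app (.op U)).hom.map_smul r
    (show TensorProduct Γ(X, U) Γ(M, U) Γ(N, U) from m ⊗ₜ n)
  refine Eq.trans ?_ this
  change ((PresheafOfModules.sheafificationAdjunction (𝟙 X.ringCatSheaf.obj)).unit.app
      (PresheafOfModules.Monoidal.tensorObj (R := X.presheaf) M.val N.val)).app (.op U)
    (show TensorProduct Γ(X, U) Γ(M, U) Γ(N, U) from m ⊗ₜ (r • n)) = _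
  rw [TensorProduct.tmul_smul]
  rfl

/-- The tensor product of two frames is a frame, by the mapping properties which characterize
frames. -/
theorem IsFrameOn.tens {M N : X.Modules} {V : X.Opens} {m : Γ(M, V)} {n : Γ(N, V)}
    (hm : IsFrameOn M m) (hn : IsFrameOn N n) : IsFrameOn (modTensor M N) (tens m n) := by
  apply isFrameOn_of_existsUnique
  intro Q hQ q
  let e : (modTensor M N ⟶ Q) ≃ _ :=
    (PresheafOfModules.sheafificationAdjunction (𝟙 X.ringCatSheaf.obj)).homEquiv
      (PresheafOfModules.Monoidal.tensorObj (R := X.presheaf) M.val N.val) Q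
  have he (ψ) (U) (a : Γ(M, U)) (b : Γ(N, U)) : (e ψ).app (.op U)
      (show TensorProduct Γ(X, U) Γ(M, U) Γ(N, U) from a ⊗ₜ b) = ψ.app U (ProjAction.tens a b) := by
    simp only [e, Adjunction.homEquiv_apply]
    rfl
  have hQs (U) (r : Γ(X, U)) (x : Γ(Q, U ⊓ V)) : (Equiv.ofBijective _ (hQ U)).symm
      (resO X (inf_le_left : U ⊓ V ≤ U) r • x) = r • (Equiv.ofBijective _ (hQ U)).symm x := by
    apply (hQ U).1
    rw [resM_smul]
    have h1 := (Equiv.ofBijective _ (hQ U)).apply_symm_apply (resO X (inf_le_left : U ⊓ V ≤ U) r • x)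
    have h2 := (Equiv.ofBijective _ (hQ U)).apply_symm_apply x
    exact h1.trans congr(_ • $h2).symm
  have hQa (U) (x y : Γ(Q, U ⊓ V)) : (Equiv.ofBijective _ (hQ U)).symm
      (x + y) = (Equiv.ofBijective _ (hQ U)).symm x + (Equiv.ofBijective _ (hQ U)).symm y := by
    apply (hQ U).1
    rw [resM_add]
    have h1 := (Equiv.ofBijective _ (hQ U)).apply_symm_apply (x + y)
    have h2 := (Equiv.ofBijective _ (hQ U)).apply_symm_apply x
    have h3 := (Equiv.ofBijective _ (hQ U)).apply_symm_apply y
    exact h1.trans congr($h2 + $h3).symm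
  let f (U : X.Opens) : Γ(M, U) →ₗ[Γ(X, U)] Γ(N, U) →ₗ[Γ(X, U)] Γ(Q, U) :=
    LinearMap.mk₂ _ (fun a b => (Equiv.ofBijective _ (hQ U)).symm
      ((hm.coord inf_le_right (resM M inf_le_left a) * hn.coord inf_le_right (resM N inf_le_left b)) •
        resM Q inf_le_right q))
      (by intro a a' b; rw [resM_add, map_add, add_mul, add_smul, hQa])
      (by intro r a b; rw [resM_smul, map_smul (hm.coord _), smul_eq_mul, _root_.mul_assoc, mul_smul, hQs])
      (by intro a b b'; rw [resM_add, map_add, mul_add, add_smul, hQa])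
      (by intro r a b; rw [resM_smul, map_smul (hn.coord _), smul_eq_mul, mul_left_comm, mul_smul, hQs])
  have hf (U a b) : resM Q inf_le_left (f U a b) =
      (hm.coord inf_le_right (resM M inf_le_left a) * hn.coord inf_le_right (resM N inf_le_left b)) •
        resM Q inf_le_right q := (Equiv.ofBijective _ (hQ U)).apply_symm_apply _
  have hf' (U W) (h : W ≤ U) (a b) : f W (resM M h a) (resM N h b) = resM Q h (f U a b) := by
    apply (hQ W).1
    rw [hf, resM_resM, resM_resM, resM_resM, ← resM_resM M inf_le_left (inf_le_inf_right V h),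
      ← resM_resM N inf_le_left (inf_le_inf_right V h), hm.coord_res inf_le_right,
      hn.coord_res inf_le_right, ← resM_resM Q inf_le_left (inf_le_inf_right V h), hf, resM_smul,
      resM_resM, map_mul]
  obtain ⟨ψ₀, hψ₀⟩ := e.surjective (presheafTensorLift M N Q f hf')
  have he₀ (U) (a : Γ(M, U)) (b : Γ(N, U)) : ψ₀.app U (ProjAction.tens a b) = f U a b :=
    (he ψ₀ U a b).symm.trans congr(($hψ₀).app (.op U)
      (show TensorProduct Γ(X, U) Γ(M, U) Γ(N, U) from a ⊗ₜ b))
  refine ⟨ψ₀, ?_, ?_⟩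
  · change ψ₀.app V (ProjAction.tens m n) = q
    rw [he₀]
    apply (hQ V).1
    rw [hf, hm.coord_eq (r := 1), hn.coord_eq (r := 1)]
    · simp
    · rw [one_smul]
    · rw [one_smul]
  · intro ψ hψ
    apply e.injective
    apply presheafTensor_hom_ext
    intro U a b
    refine (he ψ U a b).trans (Eq.trans ?_ (he ψ₀ U a b).symm)
    rw [he₀]
    apply (hQ U).1
    rw [hf, ← app_resM, resM_tens, ← hm.coord_smul inf_le_right (resM M _ a),
      ← hn.coord_smul inf_le_right (resM N _ b), smul_tens, tens_smul,
      Scheme.Modules.Hom.app_smul, Scheme.Modules.Hom.app_smul, ← resM_tens, app_resM, hψ, mul_smul,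
      hm.coord_smul, hn.coord_smul]

theorem isFrameOn_unit (X : Scheme.{u}) :
    IsFrameOn (X := X) (SheafOfModules.unit X.ringCatSheaf) (U := ⊤) (1 : Γ(X, ⊤)) := by
  intro V h
  have h1 : resM (X := X) (SheafOfModules.unit X.ringCatSheaf) h (1 : Γ(X, ⊤)) = (1 : Γ(X, V)) :=
    map_one (X.presheaf.map (homOfLE h).op).hom
  rw [h1]
  have : (fun r : Γ(X, V) => r • (1 : Γ(X, V))) = id := by ext; simp
  exact this ▸ Function.bijective_id

theorem IsInvertible.exists_frame {L : X.Modules} (hL : IsInvertible L) (x : X) (U' : X.Opens)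
    (hx : x ∈ U') :
    ∃ (V : X.Opens) (s : Γ(L, V)), x ∈ V ∧ V ≤ U' ∧ IsAffineOpen V ∧ IsFrameOn L s := by
  obtain ⟨U, hxU, ⟨e⟩⟩ := hL x
  have h := (isFrameOn_unit U.toScheme).map_iso (M := SheafOfModules.unit _) e.symm
  obtain ⟨V, hV, hxV, hle⟩ := (TopologicalSpace.Opens.isBasis_iff_nbhd.mp X.isBasis_affineOpens)
    (show x ∈ U ⊓ U' from ⟨hxU, hx⟩)
  let s : Γ(L, U.ι ''ᵁ ⊤) := e.symm.hom.val.app (.op ⊤) (1 : Γ(U.toScheme, ⊤))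
  have hs : IsFrameOn L s := by
    intro W hW
    obtain ⟨W', rfl⟩ : ∃ W', W = U.ι ''ᵁ W' := by
      refine ⟨U.ι ⁻¹ᵁ W, ?_⟩
      ext x
      simp only [SetLike.mem_coe]
      refine ⟨fun hx => ?_, fun hx => U.ι.image_preimage_le W hx⟩
      have := hW hx
      simp at this
      exact ⟨⟨x, this⟩, hx, rfl⟩
    have h1 := h W' le_top
    have h2 : Function.Bijective (U.ι.appIso W').hom := ConcreteCategory.bijective_of_isIso _
    convert! h1.comp h2 using 1
    ext r
    change _ = (L.smul ((U.ι.appIso W').inv ((U.ι.appIso W').hom r))).hom _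
    have h3 : (U.ι.appIso W').inv ((U.ι.appIso W').hom r) = r :=
      congr($((U.ι.appIso W').hom_inv_id).hom r)
    rw [h3]
    rfl
  exact ⟨V, resM L (hle.trans (inf_le_left.trans (by simp))) s, hxV, hle.trans inf_le_right, hV,
    hs.res _⟩
end Frames

/-! ### Units of tensor products over an algebraically closed field -/

section Algebra
variable {k : Type*} [Field k]

theorem exists_fg_subalgebra_tensor {A B : Type*} [CommRing A] [Algebra k A] [CommRing B] [Algebra k B]
    (x y : A ⊗[k] B) : ∃ (A' : Subalgebra k A), A'.FG ∧ ∃ x' y' : A' ⊗[k] B,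
      Algebra.TensorProduct.map A'.val (AlgHom.id k B) x' = x ∧
      Algebra.TensorProduct.map A'.val (AlgHom.id k B) y' = y := by
  have key (x : A ⊗[k] B) : ∃ (A' : Subalgebra k A), A'.FG ∧ ∀ A'' ≥ A',
      x ∈ (Algebra.TensorProduct.map A''.val (AlgHom.id k B)).range := by
    induction x using TensorProduct.induction_on with
    | zero => exact ⟨⊥, Subalgebra.fg_bot, fun _ _ => zero_mem _⟩
    | tmul a b =>
      refine ⟨Algebra.adjoin k {a}, ⟨{a}, by simp⟩, fun A'' h => ⟨⟨a, h (Algebra.subset_adjoin rfl)⟩ ⊗ₜ b, ?_⟩⟩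
      simp
    | add x y hx hy =>
      obtain ⟨A1, h1, h1'⟩ := hx
      obtain ⟨A2, h2, h2'⟩ := hy
      exact ⟨A1 ⊔ A2, h1.sup h2, fun A'' h => add_mem (h1' _ (le_sup_left.trans h))
        (h2' _ (le_sup_right.trans h))⟩
  obtain ⟨A1, h1, h1'⟩ := key x
  obtain ⟨A2, h2, h2'⟩ := key y
  obtain ⟨x', hx'⟩ := h1' (A1 ⊔ A2) le_sup_left
  obtain ⟨y', hy'⟩ := h2' (A1 ⊔ A2) le_sup_right
  exact ⟨_, h1.sup h2, x', y', hx', hy'⟩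

/-- Nullstellensatz: a nonzero function on an affine variety does not vanish at some `k`-point. -/
theorem exists_algHom_ne_zero [IsAlgClosed k] {A : Type*} [CommRing A] [IsDomain A] [Algebra k A]
    [Algebra.FiniteType k A] {a : A} (ha : a ≠ 0) : ∃ φ : A →ₐ[k] k, φ a ≠ 0 := by
  have : IsJacobsonRing A := isJacobsonRing_of_finiteType (A := k)
  have h1 : (⊥ : Ideal A).jacobson = ⊥ := by
    exact IsJacobsonRing.out ‹_› (Ideal.radical_eq_iff.mp
      (Ideal.radical_bot_of_isReduced (R := A)))
  have h2 : a ∉ (⊥ : Ideal A).jacobson := by rw [h1]; exact ha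
  rw [Ideal.jacobson, Ideal.mem_sInf] at h2
  push Not at h2
  obtain ⟨m, ⟨-, hm⟩, ham⟩ := h2
  let := Ideal.Quotient.field m
  have : Algebra.IsIntegral k (A ⧸ m) := by
    have : Module.Finite k (A ⧸ m) := finite_of_finite_type_of_isJacobsonRing k (A ⧸ m)
    infer_instance
  let e := (AlgEquiv.ofBijective (Algebra.ofId k (A ⧸ m))
    (IsAlgClosed.algebraMap_bijective_of_isIntegral))
  refine ⟨e.symm.toAlgHom.comp (Ideal.Quotient.mkₐ k m), ?_⟩
  simpa [Ideal.Quotient.eq_zero_iff_mem] using ham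

theorem baseChange_repr_map {R S B I : Type*} [CommRing R] [Algebra k R] [CommRing S] [Algebra k S]
    [CommRing B] [Algebra k B] (b : Module.Basis I k B) (f : R →ₐ[k] S) (z : R ⊗[k] B) (i : I) :
    (b.baseChange S).repr (Algebra.TensorProduct.map f (AlgHom.id k B) z) i =
      f ((b.baseChange R).repr z i) := by
  induction z using TensorProduct.induction_on with
  | zero => simp
  | add x y hx hy => simp [hx, hy]
  | tmul a c => simp [Module.Basis.baseChange_repr_tmul]

/-- The tensor product of two domains over an algebraically closed field is a domain. -/
theorem isDomain_tensor [IsAlgClosed k] {A B : Type*} [CommRing A] [IsDomain A] [Algebra k A]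
    [CommRing B] [IsDomain B] [Algebra k B] : IsDomain (A ⊗[k] B) := by
  have : Nontrivial (A ⊗[k] B) := inferInstance
  suffices NoZeroDivisors (A ⊗[k] B) from NoZeroDivisors.to_isDomain _
  constructor
  intro x y hxy
  -- After reduction to a finitely generated `A`, some `k`-point of `Spec A` is not a zero of a
  -- given coordinate of `x` and of one of `y`; evaluation at it leads to the domain `k ⊗ B`.
  obtain ⟨A', hA', x, y, rfl, rfl⟩ := exists_fg_subalgebra_tensor x y
  have : Algebra.FiniteType k A' := (Subalgebra.fg_iff_finiteType A').mp hA'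
  have hinj : Function.Injective (Algebra.TensorProduct.map A'.val (AlgHom.id k B)) :=
    Module.Flat.rTensor_preserves_injective_linearMap A'.val.toLinearMap Subtype.val_injective
  rw [← map_mul, map_eq_zero_iff _ hinj] at hxy
  rw [map_eq_zero_iff _ hinj, map_eq_zero_iff _ hinj]
  let b := (Module.Basis.ofVectorSpace k B).baseChange A'
  by_contra! h
  obtain ⟨i, hi⟩ : ∃ i, b.repr x i ≠ 0 := by
    by_contra! h'; exact h.1 (b.repr.injective (by ext; simp [h']))
  obtain ⟨j, hj⟩ : ∃ j, b.repr y j ≠ 0 := by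
    by_contra! h'; exact h.2 (b.repr.injective (by ext; simp [h']))
  obtain ⟨φ, hφ⟩ := exists_algHom_ne_zero (k := k) (mul_ne_zero hi hj)
  have : IsDomain (k ⊗[k] B) := (Algebra.TensorProduct.lid k B).toMulEquiv.isDomain _
  have h0 := congrArg (Algebra.TensorProduct.map φ (AlgHom.id k B)) hxy
  rw [map_mul, map_zero] at h0
  rw [map_mul] at hφ
  rcases mul_eq_zero.mp h0 with h0 | h0
  · exact hφ (by rw [← baseChange_repr_map, h0]; simp)
  · exact hφ (by rw [mul_comm, ← baseChange_repr_map, h0]; simp)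

/-- The `K`-algebra homomorphism `K ⊗ B → K` induced by a `k`-point `ε : B → k`. -/
def augMap (K : Type*) [CommRing K] [Algebra k K] {B : Type*} [CommRing B] [Algebra k B] (ε : B →ₐ[k] k) :
    K ⊗[k] B →ₐ[K] K :=
  Algebra.TensorProduct.lift (AlgHom.id K K) ((Algebra.ofId k K).comp ε) (fun _ _ => mul_comm _ _)

theorem augMap_tmul {K : Type*} [CommRing K] [Algebra k K] {B : Type*} [CommRing B] [Algebra k B]
    (ε : B →ₐ[k] k) (a : K) (b : B) : augMap K ε (a ⊗ₜ b) = a * algebraMap k K (ε b) :=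
  Algebra.TensorProduct.lift_tmul _ _ _ _ _

theorem augMap_map {R S B : Type*} [CommRing R] [Algebra k R] [CommRing S] [Algebra k S]
    [CommRing B] [Algebra k B] (ε : B →ₐ[k] k) (f : R →ₐ[k] S) (z : R ⊗[k] B) :
    augMap S ε (Algebra.TensorProduct.map f (AlgHom.id k B) z) = f (augMap R ε z) := by
  induction z using TensorProduct.induction_on with
  | zero => simp
  | add x y hx hy => simp [hx, hy]
  | tmul a c => simp [augMap_tmul]

/-- Let `u` be a unit of `K ⊗ B` with value `1` at a `k`-point of `Spec B`. Then every valuation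
ring `V` of `K` over `k` contains the coordinates of `u` with respect to a basis of `B`: scaled to
have nonzero reduction, `u` and `u⁻¹` would otherwise have product zero in the domain `κ ⊗ B`, where
`κ` is the residue field of `V`. -/
theorem repr_mem_valuationSubring [IsAlgClosed k] {K : Type*} [Field K] [Algebra k K] {B I : Type*}
    [CommRing B] [IsDomain B] [Algebra k B] (ε : B →ₐ[k] k) {u v : K ⊗[k] B} (huv : u * v = 1)
    (hu : augMap K ε u = 1) (b : Module.Basis I k B) (V : ValuationSubring K)
    (hV : ∀ c : k, algebraMap k K c ∈ V) (i : I) : (b.baseChange K).repr u i ∈ V := by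
  let : Algebra k V := ((algebraMap k K).codRestrict V hV).toAlgebra
  let f : V →ₐ[k] K := { V.subtype with commutes' := fun _ => rfl }
  let κ := IsLocalRing.ResidueField V
  let q : V →ₐ[k] κ := IsScalarTower.toAlgHom k V κ
  have hq (x : V) (hx : V.valuation x < 1) : q x = 0 :=
    IsLocalRing.residue_eq_zero_iff _ |>.mpr ((V.valuation_lt_one_iff x).mpr hx)
  have hdom : IsDomain (κ ⊗[k] B) := isDomain_tensor
  have hv : augMap K ε v = 1 := by simpa [hu] using congrArg (augMap K ε) huv
  -- `u = c u'`, where `c` is a coordinate of `u` of maximal valuation: `u'` has coordinates in `V`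
  -- and has nonzero reduction.
  have scale (u : K ⊗[k] B) (hu : u ≠ 0) : ∃ (c : K) (u' : V ⊗[k] B), c ≠ 0 ∧
      u = c • Algebra.TensorProduct.map f (AlgHom.id k B) u' ∧
      Algebra.TensorProduct.map q (AlgHom.id k B) u' ≠ 0 ∧
      ∀ i, V.valuation ((b.baseChange K).repr u i) ≤ V.valuation c := by
    set r := (b.baseChange K).repr u with hr
    have hne : r.support.Nonempty := by
      rw [Finsupp.support_nonempty_iff, hr]
      simpa using hu
    obtain ⟨i₀, hi₀, hmax⟩ := r.support.exists_max_image (fun i => V.valuation (r i)) hne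
    have hc : r i₀ ≠ 0 := Finsupp.mem_support_iff.mp hi₀
    have hmax (i) : V.valuation (r i) ≤ V.valuation (r i₀) := by
      by_cases h : r i = 0
      · simp [h]
      · exact hmax i (Finsupp.mem_support_iff.mpr h)
    have hmem (i) : r i / r i₀ ∈ V := by
      apply V.mem_of_valuation_le_one
      rw [map_div₀]
      exact div_le_one_of_le₀ (hmax i) zero_le
    let w : I →₀ V := Finsupp.onFinset r.support (fun i => ⟨r i / r i₀, hmem i⟩) (fun i hi => by
      contrapose! hi
      exact Subtype.ext (by simp [Finsupp.notMem_support_iff.mp hi]))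
    refine ⟨r i₀, (b.baseChange V).repr.symm w, hc, ?_, ?_, hmax⟩
    · apply (b.baseChange K).repr.injective
      ext i
      rw [map_smul, Finsupp.smul_apply, baseChange_repr_map, LinearEquiv.apply_symm_apply, smul_eq_mul]
      exact (mul_div_cancel₀ _ hc).symm
    · intro h
      have := congr((b.baseChange κ).repr $h i₀)
      rw [baseChange_repr_map, LinearEquiv.apply_symm_apply] at this
      have h1 : w i₀ = 1 := Subtype.ext (div_self hc)
      simp [h1] at this
  obtain ⟨c, u', hc, hu', hqu, hcmax⟩ := scale u (by rintro rfl; simp at hu)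
  obtain ⟨d, v', hd, hv', hqv, -⟩ := scale v (by rintro rfl; simp at hv)
  -- As the value of `u = c u'` at the `k`-point is `1`, the valuation of `c` is at least `1`.
  have hle (c : K) (u : K ⊗[k] B) (u' : V ⊗[k] B) (hu : augMap K ε u = 1)
      (hu' : u = c • Algebra.TensorProduct.map f (AlgHom.id k B) u') : 1 ≤ V.valuation c := by
    rw [hu', map_smul, augMap_map, smul_eq_mul] at hu
    have h2 := (V.valuation_le_one (augMap V ε u'))
    have h3 := congrArg V.valuation hu
    rw [map_mul, map_one] at h3
    rw [← h3]
    exact mul_le_of_le_one_right' h2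
  have h1 := hle c u u' hu hu'
  have h2 := hle d v v' hv hv'
  have h3 : V.valuation c ≤ 1 := by
    by_contra! h3
    -- `u' v' = (c d)⁻¹` reduces to zero, although `u'` and `v'` do not.
    have he : V.valuation (c * d)⁻¹ < 1 := by
      rw [map_inv₀, map_mul]
      apply inv_lt_one_of_one_lt₀
      exact lt_of_lt_of_le h3 (le_mul_of_one_le_right' h2)
    let e : V := ⟨_, V.mem_of_valuation_le_one _ he.le⟩
    have h4 : u' * v' = algebraMap V _ e := by
      apply (b.baseChange V).repr.injective
      ext i
      rw [hu', hv', smul_mul_smul_comm] at huv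
      have h5 : Algebra.TensorProduct.map f (AlgHom.id k B) (u' * v') =
          Algebra.TensorProduct.map f (AlgHom.id k B) (algebraMap V _ e) := by
        rw [map_mul]
        refine (eq_inv_smul_iff₀ (mul_ne_zero hc hd)).mpr huv |>.trans ?_
        rw [Algebra.TensorProduct.algebraMap_apply, Algebra.TensorProduct.map_tmul, map_one,
          Algebra.TensorProduct.one_def, TensorProduct.smul_tmul', smul_eq_mul, _root_.mul_one]
        rfl
      have := congr((b.baseChange K).repr $h5 i)
      rwa [baseChange_repr_map, baseChange_repr_map] at this
    have h5 := congrArg (Algebra.TensorProduct.map q (AlgHom.id k B)) h4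
    rw [map_mul] at h5
    have h6 : Algebra.TensorProduct.map q (AlgHom.id k B) (algebraMap V _ e) = 0 := by
      rw [Algebra.TensorProduct.algebraMap_apply, Algebra.TensorProduct.map_tmul]
      simp [hq e he]
    rw [h6] at h5
    exact (mul_ne_zero hqu hqv) h5
  exact V.mem_of_valuation_le_one _ ((hcmax i).trans h3)

theorem exists_algebraMap_of_isIntegral [IsAlgClosed k] {K : Type*} [Field K] [Algebra k K] {x : K}
    (hx : IsIntegral k x) : ∃ c : k, algebraMap k K c = x := by
  let x' : integralClosure k K := ⟨x, hx⟩
  obtain ⟨c, hc⟩ := (IsAlgClosed.algebraMap_bijective_of_isIntegral (k := k)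
    (K := integralClosure k K)).2 x'
  exact ⟨c, congrArg Subtype.val hc⟩

/-- A unit of `K ⊗ B` which has the value `1` at a `k`-point of `Spec B` lies in `B`: its
coordinates lie in every valuation ring of `K` over `k`, so that they are integral over `k`. -/
theorem exists_eq_one_tmul_of_unit [IsAlgClosed k] {K : Type*} [Field K] [Algebra k K] {B : Type*}
    [CommRing B] [IsDomain B] [Algebra k B] (ε : B →ₐ[k] k) {u v : K ⊗[k] B} (huv : u * v = 1)
    (hu : augMap K ε u = 1) : ∃ b : B, u = 1 ⊗ₜ b := by
  let b := Module.Basis.ofVectorSpace k B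
  have key (i) : ∃ c : k, algebraMap k K c = (b.baseChange K).repr u i := by
    have h1 : (b.baseChange K).repr u i ∈ (⨅ V : {V : ValuationSubring K //
        Set.range (algebraMap k K) ⊆ V.toSubring}, V.1.toSubring) := by
      rw [Subring.mem_iInf]
      intro V
      exact repr_mem_valuationSubring ε huv hu b V.1 (fun c => V.2 ⟨c, rfl⟩) i
    -- The intersection of the valuation rings over `k` is the integral closure of `k`.
    rw [iInf_valuationSubring_superset] at h1
    have h2 : IsIntegral (Subring.closure (Set.range (algebraMap k K))) ((b.baseChange K).repr u i) := h1
    let S := Subring.closure (Set.range (algebraMap k K))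
    have hS (x : K) (hx : x ∈ S) : ∃ c, algebraMap k K c = x := by
      rwa [← RingHom.mem_range, ← Subring.closure_eq (algebraMap k K).range]
    let : Algebra k S :=
      ((algebraMap k K).codRestrict S fun c => Subring.subset_closure ⟨c, rfl⟩).toAlgebra
    have : IsScalarTower k S K := .of_algebraMap_eq fun _ => rfl
    have : Algebra.IsIntegral k S := ⟨fun x => by
      obtain ⟨c, hc⟩ := hS x x.2
      have : x = algebraMap k S c := Subtype.ext hc.symm
      rw [this]
      exact isIntegral_algebraMap⟩
    have h3 : IsIntegral k ((b.baseChange K).repr u i) := isIntegral_trans (A := S) _ h2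
    exact exists_algebraMap_of_isIntegral h3
  choose c hc using key
  refine ⟨b.repr.symm (Finsupp.onFinset ((b.baseChange K).repr u).support c fun i hi => ?_), ?_⟩
  · rw [Finsupp.mem_support_iff, ← hc]
    simpa using hi
  · apply (b.baseChange K).repr.injective
    ext i
    rw [Module.Basis.baseChange_repr_tmul, LinearEquiv.apply_symm_apply]
    simp [← hc, Algebra.smul_def]
end Algebra

/-! ### Automorphisms of the modules `A ⊗ E` up to units -/

section BaseChange

variable {k : Type*} [Field k] {A B C E : Type*} [CommRing A] [Algebra k A] [CommRing B] [Algebra k B]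
  [CommRing C] [Algebra k C] [AddCommGroup E] [Module k E]

/-- The map `φ ⊗ 1 : A ⊗ E → B ⊗ E` for a homomorphism of `k`-algebras `φ : A → B`. -/
def tw (E : Type*) [AddCommGroup E] [Module k E] (φ : A →ₐ[k] B) : A ⊗[k] E →ₗ[k] B ⊗[k] E :=
  φ.toLinearMap.rTensor E

theorem tw_tmul (φ : A →ₐ[k] B) (a : A) (e : E) : tw E φ (a ⊗ₜ e) = φ a ⊗ₜ e := rfl

theorem tw_smul (φ : A →ₐ[k] B) (a : A) (z : A ⊗[k] E) : tw E φ (a • z) = φ a • tw E φ z := by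
  induction z using TensorProduct.induction_on with
  | zero => simp
  | add x y hx hy => simp [hx, hy]
  | tmul b e => simp [TensorProduct.smul_tmul', tw_tmul]

theorem tw_comp (φ : A →ₐ[k] B) (ψ : B →ₐ[k] C) (z : A ⊗[k] E) :
    tw E (ψ.comp φ) z = tw E ψ (tw E φ z) := by
  induction z using TensorProduct.induction_on with
  | zero => simp
  | add x y hx hy => simp [hx, hy]
  | tmul a e => rfl

theorem tw_id (z : A ⊗[k] E) : tw E (AlgHom.id k A) z = z :=
  LinearMap.rTensor_id_apply ..

theorem tw_injective {φ : A →ₐ[k] B} (h : Function.Injective φ) : Function.Injective (tw E φ) :=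
  Module.Flat.rTensor_preserves_injective_linearMap φ.toLinearMap h

theorem ext_one_tmul {M : Type*} [AddCommGroup M] [Module A M] {f g : A ⊗[k] E →ₗ[A] M}
    (h : ∀ e, f (1 ⊗ₜ e) = g (1 ⊗ₜ e)) : f = g := by
  ext z
  induction z using TensorProduct.induction_on with
  | zero => simp
  | add x y hx hy => simp [hx, hy]
  | tmul a e =>
    have : a ⊗ₜ[k] e = a • (1 ⊗ₜ[k] e) := by simp [TensorProduct.smul_tmul']
    rw [this, map_smul, map_smul, h]

/-- The base change along `φ : A → B` of an endomorphism of the `A`-module `A ⊗ E`. -/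
def bcEnd (φ : A →ₐ[k] B) (T : A ⊗[k] E →ₗ[A] A ⊗[k] E) : B ⊗[k] E →ₗ[B] B ⊗[k] E :=
  LinearMap.liftBaseChange B (tw E φ ∘ₗ T.restrictScalars k ∘ₗ TensorProduct.mk k A E 1)

theorem bcEnd_tw (φ : A →ₐ[k] B) (T : A ⊗[k] E →ₗ[A] A ⊗[k] E) (z : A ⊗[k] E) :
    bcEnd φ T (tw E φ z) = tw E φ (T z) := by
  induction z using TensorProduct.induction_on with
  | zero => simp
  | add x y hx hy => simp [hx, hy]
  | tmul a e =>
    have : a ⊗ₜ[k] e = a • (1 ⊗ₜ[k] e) := by simp [TensorProduct.smul_tmul']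
    rw [tw_tmul, bcEnd, LinearMap.liftBaseChange_tmul, this, map_smul, tw_smul]
    rfl

theorem bcEnd_one_tmul (φ : A →ₐ[k] B) (T : A ⊗[k] E →ₗ[A] A ⊗[k] E) (e : E) :
    bcEnd φ T (1 ⊗ₜ e) = tw E φ (T (1 ⊗ₜ e)) := by
  rw [← bcEnd_tw, tw_tmul, map_one]

theorem bcEnd_id (φ : A →ₐ[k] B) : bcEnd φ (LinearMap.id : A ⊗[k] E →ₗ[A] A ⊗[k] E) = .id :=
  ext_one_tmul fun e => by rw [bcEnd_one_tmul]; simp [tw_tmul]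

theorem bcEnd_comp (φ : A →ₐ[k] B) (T T' : A ⊗[k] E →ₗ[A] A ⊗[k] E) :
    bcEnd φ (T ∘ₗ T') = bcEnd φ T ∘ₗ bcEnd φ T' :=
  ext_one_tmul fun e => by rw [bcEnd_one_tmul, LinearMap.comp_apply, LinearMap.comp_apply,
    bcEnd_one_tmul, bcEnd_tw]

theorem bcEnd_bcEnd (φ : A →ₐ[k] B) (ψ : B →ₐ[k] C) (T : A ⊗[k] E →ₗ[A] A ⊗[k] E) :
    bcEnd ψ (bcEnd φ T) = bcEnd (ψ.comp φ) T :=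
  ext_one_tmul fun e => by rw [bcEnd_one_tmul, bcEnd_one_tmul, bcEnd_one_tmul, tw_comp]

/-- The base change along `φ : A → B` of an automorphism of the `A`-module `A ⊗ E`. -/
def bc (φ : A →ₐ[k] B) (T : A ⊗[k] E ≃ₗ[A] A ⊗[k] E) : B ⊗[k] E ≃ₗ[B] B ⊗[k] E :=
  LinearEquiv.ofLinearMap (bcEnd φ T.toLinearMap) (bcEnd φ T.symm.toLinearMap)
    (by rw [← bcEnd_comp]; simp [bcEnd_id]) (by rw [← bcEnd_comp]; simp [bcEnd_id])

theorem bc_tw (φ : A →ₐ[k] B) (T : A ⊗[k] E ≃ₗ[A] A ⊗[k] E) (z : A ⊗[k] E) :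
    bc φ T (tw E φ z) = tw E φ (T z) := bcEnd_tw φ T.toLinearMap z

theorem bc_one_tmul (φ : A →ₐ[k] B) (T : A ⊗[k] E ≃ₗ[A] A ⊗[k] E) (e : E) :
    bc φ T (1 ⊗ₜ e) = tw E φ (T (1 ⊗ₜ e)) := bcEnd_one_tmul φ T.toLinearMap e

theorem bc_bc (φ : A →ₐ[k] B) (ψ : B →ₐ[k] C) (T : A ⊗[k] E ≃ₗ[A] A ⊗[k] E) :
    bc ψ (bc φ T) = bc (ψ.comp φ) T :=
  LinearEquiv.toLinearMap_injective (bcEnd_bcEnd φ ψ T.toLinearMap)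

theorem bc_trans (φ : A →ₐ[k] B) (T T' : A ⊗[k] E ≃ₗ[A] A ⊗[k] E) :
    bc φ (T.trans T') = (bc φ T).trans (bc φ T') :=
  LinearEquiv.toLinearMap_injective (bcEnd_comp φ T'.toLinearMap T.toLinearMap)

theorem bc_id (T : A ⊗[k] E ≃ₗ[A] A ⊗[k] E) : bc (AlgHom.id k A) T = T :=
  LinearEquiv.toLinearMap_injective (ext_one_tmul fun e =>
    (bc_one_tmul _ _ _).trans (by rw [tw_id]; rfl))

/-- Two automorphisms of a module are proportional if they differ by a unit of the base ring. -/
def Proportional {M : Type*} [AddCommGroup M] [Module A M] (S S' : M ≃ₗ[A] M) : Prop :=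
  ∃ u : Aˣ, ∀ z, S z = (u : A) • S' z

theorem Proportional.symm {M : Type*} [AddCommGroup M] [Module A M] {S S' : M ≃ₗ[A] M}
    (h : Proportional S S') : Proportional S' S := by
  obtain ⟨u, hu⟩ := h
  exact ⟨u⁻¹, fun z => by rw [hu, smul_smul, Units.inv_mul, one_smul]⟩

theorem Proportional.trans {M : Type*} [AddCommGroup M] [Module A M] {S S' S'' : M ≃ₗ[A] M}
    (h : Proportional S S') (h' : Proportional S' S'') : Proportional S S'' := by
  obtain ⟨u, hu⟩ := h
  obtain ⟨v, hv⟩ := h'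
  exact ⟨u * v, fun z => by rw [hu, hv, smul_smul, Units.val_mul]⟩

theorem Proportional.comp {M : Type*} [AddCommGroup M] [Module A M] {S S' T T' : M ≃ₗ[A] M}
    (h : Proportional S S') (h' : Proportional T T') : Proportional (S.trans T) (S'.trans T') := by
  obtain ⟨u, hu⟩ := h
  obtain ⟨v, hv⟩ := h'
  refine ⟨u * v, fun z => ?_⟩
  rw [LinearEquiv.trans_apply, LinearEquiv.trans_apply, hu, hv, map_smul, smul_smul, Units.val_mul,
    mul_comm]

theorem Proportional.bc {S S' : A ⊗[k] E ≃ₗ[A] A ⊗[k] E} (h : Proportional S S') (φ : A →ₐ[k] B) :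
    Proportional (bc φ S) (bc φ S') := by
  obtain ⟨u, hu⟩ := h
  refine ⟨u.map φ, fun z => ?_⟩
  have : (ProjAction.bc φ S).toLinearMap = φ u • (ProjAction.bc φ S').toLinearMap :=
    ext_one_tmul fun e => by
      change ProjAction.bc φ S _ = φ u • ProjAction.bc φ S' _
      rw [bc_one_tmul, bc_one_tmul, hu, tw_smul]
  exact congr($this z)

/-- The pairing `A ⊗ E → K`, `a ⊗ e ↦ β(a) q(e)`. -/
def evt {K : Type*} [CommRing K] [Algebra k K] (β : A →ₐ[k] K) (q : E →ₗ[k] K) :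
    A ⊗[k] E →ₗ[k] K :=
  LinearMap.mul' k K ∘ₗ TensorProduct.map β.toLinearMap q

section
variable {K : Type*} [CommRing K] [Algebra k K] (β : A →ₐ[k] K) (q : E →ₗ[k] K)

theorem evt_tmul (a : A) (e : E) : evt β q (a ⊗ₜ e) = β a * q e := rfl

theorem evt_one_tmul (e : E) : evt β q (1 ⊗ₜ e) = q e := by simp [evt_tmul]

theorem evt_smul (a : A) (z : A ⊗[k] E) : evt β q (a • z) = β a * evt β q z := by
  induction z using TensorProduct.induction_on with
  | zero => simp
  | add x y hx hy => simp [hx, hy, mul_add]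
  | tmul b e => simp [TensorProduct.smul_tmul', evt_tmul, _root_.mul_assoc]

theorem evt_tw (φ : C →ₐ[k] A) (z : C ⊗[k] E) : evt β q (tw E φ z) = evt (β.comp φ) q z := by
  induction z using TensorProduct.induction_on with
  | zero => simp
  | add x y hx hy => simp [hx, hy]
  | tmul b e => simp [tw_tmul, evt_tmul]

theorem evt_smul_right (c : K) (z : A ⊗[k] E) : evt β (c • q) z = c * evt β q z := by
  induction z using TensorProduct.induction_on with
  | zero => simp
  | add x y hx hy => simp [hx, hy, mul_add]
  | tmul b e => simp [evt_tmul, mul_left_comm]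

theorem evt_eq_of_one_tmul {q' : E →ₗ[k] K} {c : K} {T T' : A ⊗[k] E →ₗ[A] A ⊗[k] E}
    (h : ∀ e, evt β q (T (1 ⊗ₜ e)) = c * evt β q' (T' (1 ⊗ₜ e))) (z : A ⊗[k] E) :
    evt β q (T z) = c * evt β q' (T' z) := by
  induction z using TensorProduct.induction_on with
  | zero => simp
  | add x y hx hy => simp [hx, hy, mul_add]
  | tmul a e =>
    have : a ⊗ₜ[k] e = a • (1 ⊗ₜ[k] e) := by simp [TensorProduct.smul_tmul']
    rw [this, LinearMap.map_smul T, LinearMap.map_smul T', evt_smul, evt_smul, h, mul_left_comm]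

end

end BaseChange

/-! ### Proportionality at the generic point -/

section Generic

variable {k : Type u} [Field k] [IsAlgClosed k] {B B' E : Type u} [CommRing B] [IsDomain B] [Algebra k B]
  [CommRing B'] [IsDomain B'] [Algebra k B'] [AddCommGroup E] [Module k E]
  {F : Type u} [Field F] [Algebra k F]

instance : IsDomain (B ⊗[k] F) := isDomain_tensor

/-- The function field of `Spec B × Spec F`. -/
abbrev GenField (k B F : Type u) [Field k] [IsAlgClosed k] [CommRing B] [IsDomain B] [Algebra k B]
    [Field F] [Algebra k F] : Type u := FractionRing (B ⊗[k] F)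

variable (k B F) in
/-- The inclusion of `B` in the function field of `Spec B × Spec F`. -/
def genLeft : B →ₐ[k] GenField k B F :=
  (IsScalarTower.toAlgHom k (B ⊗[k] F) (GenField k B F)).comp Algebra.TensorProduct.includeLeft

variable (k B F) in
/-- The inclusion of `F` in the function field of `Spec B × Spec F`. -/
def genRight : F →ₐ[k] GenField k B F :=
  (IsScalarTower.toAlgHom k (B ⊗[k] F) (GenField k B F)).comp Algebra.TensorProduct.includeRight

/-- The pairing with `j` at the generic point of `Spec B × Spec F` is the composite of `1 ⊗ j` and
the inclusion of `B ⊗ F` in its field of fractions. -/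
theorem evt_gen (j : E →ₗ[k] F) (z : B ⊗[k] E) :
    evt (genLeft k B F) ((genRight k B F).toLinearMap ∘ₗ j) z =
      algebraMap (B ⊗[k] F) (GenField k B F) (j.lTensor B z) := by
  induction z using TensorProduct.induction_on with
  | zero => simp
  | add x y hx hy => simp [hx, hy]
  | tmul b e =>
    rw [evt_tmul, LinearMap.lTensor_tmul]
    refine (map_mul (algebraMap (B ⊗[k] F) (GenField k B F)) (b ⊗ₜ 1) (1 ⊗ₜ j e)).symm.trans ?_
    simp

theorem evt_gen_injective {j : E →ₗ[k] F} (hj : Function.Injective j) :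
    Function.Injective (evt (genLeft k B F) ((genRight k B F).toLinearMap ∘ₗ j)) := by
  intro x y h
  rw [evt_gen, evt_gen] at h
  exact Module.Flat.lTensor_preserves_injective_linearMap j hj (IsFractionRing.injective _ _ h)

theorem lTensor_smul_mul (j : E →ₗ[k] F) (b : B) (z : B ⊗[k] E) :
    j.lTensor B (b • z) = b ⊗ₜ 1 * j.lTensor B z := by
  induction z using TensorProduct.induction_on with
  | zero => simp
  | add x y hx hy => rw [smul_add, map_add, map_add, hx, hy, mul_add]
  | tmul b' e => simp [TensorProduct.smul_tmul']

/-- If two automorphisms of `B ⊗ E` agree up to a scalar at the generic point of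
`Spec B × Spec F`, then this scalar is a unit of `B ⊗ F`. -/
theorem exists_unit_of_generic [Nontrivial E] {j : E →ₗ[k] F} (hj : Function.Injective j)
    {S S' : B ⊗[k] E ≃ₗ[B] B ⊗[k] E}
    {c : GenField k B F} (hc : c ≠ 0)
    (h : ∀ e, evt (genLeft k B F) ((genRight k B F).toLinearMap ∘ₗ j) (S (1 ⊗ₜ e)) =
      c * evt (genLeft k B F) ((genRight k B F).toLinearMap ∘ₗ j) (S' (1 ⊗ₜ e))) :
    ∃ w w' : B ⊗[k] F, w * w' = 1 ∧ ∀ z, j.lTensor B (S z) = w * j.lTensor B (S' z) := by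
  have h (z) := evt_eq_of_one_tmul (T := S.toLinearMap) (T' := S'.toLinearMap) _ _ h z
  simp only [evt_gen, LinearEquiv.coe_coe] at h
  obtain ⟨e, he⟩ := exists_ne (0 : E)
  have he' : j e ≠ 0 := by rwa [ne_eq, map_eq_zero_iff _ hj]
  -- A fixed vector `e ≠ 0` with `j e` in the field `F` exhibits `c` and `c⁻¹` as elements
  -- of `B ⊗ F`.
  set w := j.lTensor B (S (S'.symm (1 ⊗ₜ e))) * 1 ⊗ₜ (j e)⁻¹ with hw
  set w' := j.lTensor B (S' (S.symm (1 ⊗ₜ e))) * 1 ⊗ₜ (j e)⁻¹ with hw'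
  have hee : (1 ⊗ₜ j e * 1 ⊗ₜ (j e)⁻¹ : B ⊗[k] F) = 1 := by simp [he', Algebra.TensorProduct.one_def]
  have hcw : algebraMap (B ⊗[k] F) (GenField k B F) w = c := by
    rw [hw, map_mul, h, LinearEquiv.apply_symm_apply, LinearMap.lTensor_tmul, _root_.mul_assoc,
      ← map_mul, hee, map_one, _root_.mul_one]
  have hcw' : c * algebraMap (B ⊗[k] F) (GenField k B F) w' = 1 := by
    rw [hw', map_mul, ← _root_.mul_assoc, ← h, LinearEquiv.apply_symm_apply, LinearMap.lTensor_tmul,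
      ← map_mul, hee, map_one]
  refine ⟨w, w', IsFractionRing.injective _ (GenField k B F) ?_, fun z =>
    IsFractionRing.injective _ (GenField k B F) ?_⟩
  · rw [map_mul, map_one, hcw, hcw']
  · rw [map_mul, h, hcw]

theorem augMap_lTensor (ε : B →ₐ[k] k) (j : E →ₗ[k] F) (z : B ⊗[k] E) :
    augMap F ε (Algebra.TensorProduct.comm k B F (j.lTensor B z)) =
      evt (Algebra.ofId k F) j (tw E ε z) := by
  induction z using TensorProduct.induction_on with
  | zero => simp
  | add x y hx hy => simp [hx, hy]
  | tmul b e => simp [augMap_tmul, tw_tmul, evt_tmul, mul_comm, Algebra.ofId_apply]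

/-- Automorphisms of `B ⊗ E` which differ by a unit of `B ⊗ F` are proportional if this unit and its
inverse lie in `B`. -/
theorem proportional_of_lTensor {j : E →ₗ[k] F} (hj : Function.Injective j)
    {S S' : B ⊗[k] E ≃ₗ[B] B ⊗[k] E} {w w' : B ⊗[k] F} (hw : w * w' = 1)
    (h : ∀ z, j.lTensor B (S z) = w * j.lTensor B (S' z)) {b b' : B}
    (hb : w = b ⊗ₜ 1) (hb' : w' = b' ⊗ₜ 1) : Proportional S S' := by
  have h1 : b * b' = 1 := by
    apply Algebra.TensorProduct.includeLeft_injective (R := k) (S := k) (A := B) (B := F)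
      (algebraMap k F).injective
    rw [map_mul, map_one]
    rwa [hb, hb'] at hw
  refine ⟨⟨b, b', h1, by rwa [mul_comm]⟩, fun z => ?_⟩
  apply Module.Flat.lTensor_preserves_injective_linearMap (M := B) j hj
  rw [h, hb, lTensor_smul_mul]

/-- Two automorphisms of `B ⊗ E` which agree generically up to a scalar, and which agree up to a
scalar at a `k`-point of `Spec B`, are proportional. -/
theorem proportional_of_generic {j : E →ₗ[k] F} (hj : Function.Injective j)
    {S S' : B ⊗[k] E ≃ₗ[B] B ⊗[k] E}
    {c : GenField k B F} (hc : c ≠ 0)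
    (h : ∀ e, evt (genLeft k B F) ((genRight k B F).toLinearMap ∘ₗ j) (S (1 ⊗ₜ e)) =
      c * evt (genLeft k B F) ((genRight k B F).toLinearMap ∘ₗ j) (S' (1 ⊗ₜ e)))
    (ε : B →ₐ[k] k) (hε : Proportional (bc ε S) (bc ε S')) : Proportional S S' := by
  cases subsingleton_or_nontrivial E
  · refine ⟨1, fun z => Subsingleton.elim _ _⟩
  obtain ⟨w, w', hw, h⟩ := exists_unit_of_generic hj hc h
  obtain ⟨d, hd⟩ := hε
  obtain ⟨e, he⟩ := exists_ne (0 : E)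
  have he' : j e ≠ 0 := by rwa [ne_eq, map_eq_zero_iff _ hj]
  -- the value of `w` at the `k`-point is the constant `d`, so that `d⁻¹ w` has the value `1`
  let σ := Algebra.TensorProduct.comm k B F
  have haug : augMap F ε (σ w) = algebraMap k F d := by
    have h1 := congrArg (fun z => augMap F ε (σ z)) (h (S'.symm (1 ⊗ₜ e)))
    simp only [map_mul, σ, augMap_lTensor] at h1
    have h3 := bc_tw ε S' (S'.symm (1 ⊗ₜ e))
    rw [LinearEquiv.apply_symm_apply] at h3
    rw [← bc_tw ε S, hd, h3, LinearEquiv.apply_symm_apply, evt_smul] at h1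
    have h2 : evt (Algebra.ofId k F) j (tw E ε (1 ⊗ₜ e)) = j e := by simp [tw_tmul, evt_tmul]
    rw [h2] at h1
    exact (mul_right_cancel₀ he' h1).symm
  have hww : (algebraMap k (F ⊗[k] B) (d⁻¹ : kˣ) * σ w) * (algebraMap k (F ⊗[k] B) d * σ w') = 1 := by
    rw [_root_.mul_mul_mul_comm, ← map_mul, ← map_mul, hw]
    simp [← Algebra.TensorProduct.one_def]
  have hcomm (c : k) : augMap F ε (algebraMap k (F ⊗[k] B) c) = algebraMap k F c :=
    ((augMap F ε).restrictScalars k).commutes c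
  obtain ⟨b, hb⟩ := exists_eq_one_tmul_of_unit ε hww (by
    rw [map_mul, hcomm, haug, ← map_mul]; simp)
  rw [mul_comm] at hww
  have haug' : augMap F ε (algebraMap k (F ⊗[k] B) d * σ w') = 1 := by
    have := congrArg (augMap F ε) hww
    rw [map_mul, map_one, map_mul _ _ (σ w), hcomm, haug, ← map_mul] at this
    simpa using this
  obtain ⟨b', hb'⟩ := exists_eq_one_tmul_of_unit ε hww haug'
  refine proportional_of_lTensor (b := algebraMap k B d * b) (b' := algebraMap k B (d⁻¹ : kˣ) * b')
    hj hw h ?_ ?_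
  · apply σ.injective
    change _ = 1 ⊗ₜ[k] (algebraMap k B d * b)
    rw [← Algebra.smul_def, TensorProduct.tmul_smul, ← hb, Algebra.smul_def, ← _root_.mul_assoc,
      ← map_mul]
    simp [← Algebra.TensorProduct.one_def]
  · apply σ.injective
    change _ = 1 ⊗ₜ[k] (algebraMap k B (d⁻¹ : kˣ) * b')
    rw [← Algebra.smul_def, TensorProduct.tmul_smul, ← hb', Algebra.smul_def, ← _root_.mul_assoc,
      ← map_mul]
    simp [← Algebra.TensorProduct.one_def]

/-- Two automorphisms of `B ⊗ E` which agree generically up to a scalar, and which are proportional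
over a nonempty open subset of `Spec B`, are proportional. -/
theorem proportional_of_generic_of_injective {j : E →ₗ[k] F} (hj : Function.Injective j)
    {S S' : B ⊗[k] E ≃ₗ[B] B ⊗[k] E}
    {c : GenField k B F} (hc : c ≠ 0)
    (h : ∀ e, evt (genLeft k B F) ((genRight k B F).toLinearMap ∘ₗ j) (S (1 ⊗ₜ e)) =
      c * evt (genLeft k B F) ((genRight k B F).toLinearMap ∘ₗ j) (S' (1 ⊗ₜ e)))
    (ψ : B →ₐ[k] B') (hψ : Function.Injective ψ) (hε : Proportional (bc ψ S) (bc ψ S')) :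
    Proportional S S' := by
  cases subsingleton_or_nontrivial E
  · refine ⟨1, fun z => Subsingleton.elim _ _⟩
  obtain ⟨w, w', hw, h⟩ := exists_unit_of_generic hj hc h
  obtain ⟨d, hd⟩ := hε
  obtain ⟨e, he⟩ := exists_ne (0 : E)
  have he' : j e ≠ 0 := by rwa [ne_eq, map_eq_zero_iff _ hj]
  let Ψ : B ⊗[k] F →ₐ[k] B' ⊗[k] F := Algebra.TensorProduct.map ψ (AlgHom.id k F)
  have hΨ : Function.Injective Ψ := tw_injective (E := F) hψ
  have hnat (z) : Ψ (j.lTensor B z) = j.lTensor B' (tw E ψ z) := by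
    induction z using TensorProduct.induction_on with
    | zero => simp
    | add x y hx hy => simp [hx, hy]
    | tmul b e => simp [Ψ, tw_tmul]
  have hΨw : Ψ w = (d : B') ⊗ₜ 1 := by
    have h1 := congrArg Ψ (h (S'.symm (1 ⊗ₜ e)))
    rw [map_mul, hnat, hnat, ← bc_tw, hd, bc_tw, LinearEquiv.apply_symm_apply, tw_tmul, map_one,
      lTensor_smul_mul, LinearMap.lTensor_tmul] at h1
    have h2 := congrArg (· * 1 ⊗ₜ[k] (j e)⁻¹) h1
    simpa [_root_.mul_assoc, he', ← Algebra.TensorProduct.one_def] using h2.symm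
  have hΨw' : Ψ w' = ((d⁻¹ : B'ˣ) : B') ⊗ₜ 1 := by
    have h1 := congrArg Ψ hw
    rw [map_mul, hΨw, map_one] at h1
    have h2 := congrArg (((d⁻¹ : B'ˣ) : B') ⊗ₜ[k] (1 : F) * ·) h1
    simpa [← _root_.mul_assoc, ← Algebra.TensorProduct.one_def] using h2
  -- A retraction `ρ` of `k → F` shows that `(B ⊗ F) ∩ (B' ⊗ 1) = B ⊗ 1` inside `B' ⊗ F`.
  obtain ⟨ρ, hρ⟩ := LinearMap.exists_leftInverse_of_injective (Algebra.linearMap k F)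
    (LinearMap.ker_eq_bot.mpr (algebraMap k F).injective)
  have hρ1 : ρ 1 = 1 := by simpa using congr($hρ 1)
  have key (w : B ⊗[k] F) (d : B') (hw : Ψ w = d ⊗ₜ 1) : ∃ b, w = b ⊗ₜ 1 := by
    let r : B' ⊗[k] F →ₗ[k] B' := TensorProduct.rid k B' ∘ₗ ρ.lTensor B'
    let r₀ : B ⊗[k] F →ₗ[k] B := TensorProduct.rid k B ∘ₗ ρ.lTensor B
    have hr (w) : ψ (r₀ w) = r (Ψ w) := by
      induction w using TensorProduct.induction_on with
      | zero => simp
      | add x y hx hy => simp [hx, hy]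
      | tmul b e => simp [Ψ, r, r₀]
    refine ⟨r₀ w, hΨ ?_⟩
    rw [hw]
    simp only [Ψ, Algebra.TensorProduct.map_tmul, map_one, hr]
    simp [Ψ] at hw
    simp [hw, r, hρ1]
  obtain ⟨b, hb⟩ := key w _ hΨw
  obtain ⟨b', hb'⟩ := key w' _ hΨw'
  exact proportional_of_lTensor hj hw h hb hb'

end Generic

/-! ### Spaces of coefficients -/

section Coefficients

variable {k : Type u} [Field k] {A E F : Type u} [AddCommGroup A] [Module k A] [AddCommGroup E]
  [Module k E] [AddCommGroup F] [Module k F]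

open scoped Classical in
theorem equivFinsuppOfBasisLeft_lTensor {I : Type*} (b : Module.Basis I k A) (f : E →ₗ[k] F)
    (t : A ⊗[k] E) (i : I) : TensorProduct.equivFinsuppOfBasisLeft b (f.lTensor A t) i =
      f (TensorProduct.equivFinsuppOfBasisLeft b t i) := by
  induction t using TensorProduct.induction_on with
  | zero => simp
  | add x y hx hy => simp [hx, hy]
  | tmul a e => simp [TensorProduct.equivFinsuppOfBasisLeft_apply_tmul_apply]

open scoped Classical in
theorem mem_range_lTensor_iff {I : Type*} (b : Module.Basis I k A) (j : E →ₗ[k] F) (z : A ⊗[k] F) :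
    z ∈ LinearMap.range (j.lTensor A) ↔
      ∀ i, TensorProduct.equivFinsuppOfBasisLeft b z i ∈ LinearMap.range j := by
  constructor
  · rintro ⟨t, rfl⟩ i
    rw [equivFinsuppOfBasisLeft_lTensor]
    exact ⟨_, rfl⟩
  · intro h
    rw [← (TensorProduct.equivFinsuppOfBasisLeft b).symm_apply_apply z,
      TensorProduct.equivFinsuppOfBasisLeft_symm_apply]
    refine Submodule.sum_mem _ fun i _ => ?_
    obtain ⟨e, he⟩ := h i
    exact ⟨b i ⊗ₜ e, by rw [← he, LinearMap.lTensor_tmul]⟩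

open scoped Classical in
/-- An element `t` of `A ⊗ E` has a smallest space of coefficients `V ⊆ E`. -/
theorem exists_coefficientSpace (t : A ⊗[k] E) : ∃ V : Submodule k E, FiniteDimensional k V ∧
    t ∈ LinearMap.range (V.subtype.lTensor A) ∧
    ∀ {M : Type u} [AddCommGroup M] [Module k M] (f : E →ₗ[k] M),
      f.lTensor A t = 0 → V ≤ LinearMap.ker f := by
  obtain ⟨I, ⟨b⟩⟩ : ∃ I : Type u, Nonempty (Module.Basis I k A) :=
    ⟨_, ⟨Module.Basis.ofVectorSpace k A⟩⟩
  let r := TensorProduct.equivFinsuppOfBasisLeft b t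
  refine ⟨Submodule.span k (Set.range r), FiniteDimensional.span_of_finite k r.finite_range,
    ?_, ?_⟩
  · rw [mem_range_lTensor_iff b, Submodule.range_subtype]
    exact fun i => Submodule.subset_span ⟨i, rfl⟩
  · intro M _ _ f hf
    rw [Submodule.span_le]
    rintro _ ⟨i, rfl⟩
    have := equivFinsuppOfBasisLeft_lTensor b f t i
    rw [hf, map_zero, Finsupp.zero_apply] at this
    exact this.symm

open scoped Classical in
/-- For subspaces `P i` of `F` with intersection `E`, the intersection of the subspaces `A ⊗ P i` of
`A ⊗ F` is `A ⊗ E`, also when the family is infinite. -/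
theorem mem_range_lTensor {I : Type*} (P : I → Submodule k F) (j : E →ₗ[k] F)
    (hP : ⨅ i, P i ≤ LinearMap.range j) (z : A ⊗[k] F)
    (hz : ∀ i, z ∈ LinearMap.range ((P i).subtype.lTensor A)) :
    z ∈ LinearMap.range (j.lTensor A) := by
  obtain ⟨I, ⟨b⟩⟩ : ∃ I : Type u, Nonempty (Module.Basis I k A) :=
    ⟨_, ⟨Module.Basis.ofVectorSpace k A⟩⟩
  rw [mem_range_lTensor_iff b]
  refine fun i => hP (Submodule.mem_iInf _ |>.mpr fun l => ?_)
  simpa using (mem_range_lTensor_iff b _ _).mp (hz l) i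

end Coefficients

/-! ### Coherent automorphisms -/

section Coherent

variable {k : Type u} [Field k] {A E : Type u} [CommRing A] [Algebra k A] [AddCommGroup E]
  [Module k E]

/-- An automorphism of `A ⊗ E`, with `A` noetherian, is coherent if `E` is a union of
finite-dimensional subspaces which it stabilizes. -/
theorem isCoherentEnd_of_stable [IsNoetherianRing A] (T : A ⊗[k] E →ₗ[A] A ⊗[k] E)
    (h : ∀ e : E, ∃ V : Submodule k E, FiniteDimensional k V ∧ e ∈ V ∧
      (V.baseChange A).map T ≤ V.baseChange A) : IsCoherentEnd T := by
  have hmap (V : Submodule k E) : (V.baseChange A).map T ≤ V.baseChange A ↔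
      ∀ v ∈ V, T (1 ⊗ₜ v) ∈ V.baseChange A := by
    refine ⟨fun h v hv => h ⟨_, Submodule.tmul_mem_baseChange_of_mem 1 hv, rfl⟩, fun h => ?_⟩
    conv_lhs => rw [← Submodule.span_eq V, Submodule.baseChange_span]
    rw [Submodule.map_span, Submodule.span_le]
    rintro _ ⟨_, ⟨v, hv, rfl⟩, rfl⟩
    exact h v hv
  have hmono {V W : Submodule k E} (hVW : V ≤ W) : V.baseChange A ≤ W.baseChange A := by
    conv_lhs => rw [← Submodule.span_eq V, Submodule.baseChange_span]
    rw [Submodule.span_le]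
    rintro _ ⟨v, hv, rfl⟩
    exact Submodule.tmul_mem_baseChange_of_mem 1 (hVW hv)
  have key (z : A ⊗[k] E) : ∃ V : Submodule k E, FiniteDimensional k V ∧ z ∈ V.baseChange A ∧
      ∀ v ∈ V, T (1 ⊗ₜ v) ∈ V.baseChange A := by
    induction z using TensorProduct.induction_on with
    | zero =>
      refine ⟨⊥, inferInstance, zero_mem _, fun v hv => ?_⟩
      rw [(Submodule.mem_bot k).mp hv, TensorProduct.tmul_zero, map_zero]
      exact zero_mem _
    | tmul a e =>
      obtain ⟨V, hV, he, h⟩ := h e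
      exact ⟨V, hV, Submodule.tmul_mem_baseChange_of_mem _ he, (hmap V).mp h⟩
    | add x y hx hy =>
      obtain ⟨V, hV, he, h⟩ := hx
      obtain ⟨V', hV', he', h'⟩ := hy
      have h1 : V.baseChange A ≤ (V ⊔ V').baseChange A := hmono le_sup_left
      have h2 : V'.baseChange A ≤ (V ⊔ V').baseChange A := hmono le_sup_right
      refine ⟨V ⊔ V', inferInstance, add_mem (h1 he) (h2 he'), fun v hv => ?_⟩
      obtain ⟨x, hx, y, hy, rfl⟩ := Submodule.mem_sup.mp hv
      rw [TensorProduct.tmul_add, map_add]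
      exact add_mem (h1 (h _ hx)) (h2 (h' _ hy))
  intro m
  obtain ⟨V, hV, hm, h⟩ := key m
  rw [← hmap] at h
  have : Module.Finite A (V.baseChange A) := Module.Finite.range _
  refine isNoetherian_submodule.mp (isNoetherian_of_isNoetherianRing_of_finite A (V.baseChange A))
    _ (Submodule.span_le.mpr ?_)
  rintro _ ⟨n, rfl⟩
  induction n with
  | zero => simpa using hm
  | succ n ih =>
    simp only [pow_succ', Module.End.mul_apply]
    exact h ⟨_, ih, rfl⟩

end Coherent

/-! ### Points and affine charts of projective spaces -/

section Points

variable {R M : Type u} [CommRing R] [AddCommGroup M] [Module R M] {S S' : Type u} [CommRing S]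
  [CommRing S']

theorem sym_ringHom_ext {φ ψ : SymmetricAlgebra R M →+* S}
    (h0 : ∀ r, φ (algebraMap R _ r) = ψ (algebraMap R _ r))
    (h1 : ∀ m, φ (SymmetricAlgebra.ι R M m) = ψ (SymmetricAlgebra.ι R M m)) : φ = ψ := by
  refine RingHom.ext fun z => ?_
  induction z using SymmetricAlgebra.induction
  · exact h0 _
  · exact h1 _
  · rename_i a b ha hb
    rw [map_mul, map_mul, ha, hb]
  · rename_i a b ha hb
    rw [map_add, map_add, ha, hb]

theorem sym_ringHom_twist {φ ψ : SymmetricAlgebra R M →+* S} (w : S)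
    (h0 : ∀ r, φ (algebraMap R _ r) = ψ (algebraMap R _ r))
    (h1 : ∀ m, φ (SymmetricAlgebra.ι R M m) = w * ψ (SymmetricAlgebra.ι R M m)) (n : ℕ)
    (a : SymmetricAlgebra R M) (ha : a ∈ symGrading R M n) : φ a = w ^ n * ψ a := by
  unfold symGrading at ha
  induction ha using Submodule.pow_induction_on_left' with
  | algebraMap c => rw [pow_zero, _root_.one_mul, h0]
  | add x y i hx hy ihx ihy => rw [map_add, ihx, ihy, map_add, mul_add]
  | mem_mul m hm i x hx ih =>
    obtain ⟨m, rfl⟩ := hm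
    rw [map_mul, ih, h1, map_mul, Nat.succ_eq_add_one]
    ring

/-- The `S`-point of `ℙ_R(M)` given by a homomorphism `φ : Sym_R M → S` for which `φ m` is
invertible, i.e. by the quotient `φ|_M : M ⊗ S → S`. -/
def pt (φ : SymmetricAlgebra R M →+* S) (m : M) (h : IsUnit (φ (SymmetricAlgebra.ι R M m))) :
    Spec (.of S) ⟶ projSpace R M :=
  Spec.map (CommRingCat.ofHom (awayHom (symGrading R M) φ (SymmetricAlgebra.ι R M m) h)) ≫
    Proj.awayι (symGrading R M) (SymmetricAlgebra.ι R M m) (ι_mem R m) one_pos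

theorem pt_eq {φ ψ : SymmetricAlgebra R M →+* S} {m m' : M}
    {h : IsUnit (φ (SymmetricAlgebra.ι R M m))} {h' : IsUnit (ψ (SymmetricAlgebra.ι R M m'))}
    (w : S) (hw : IsUnit w) (h0 : ∀ r, φ (algebraMap R _ r) = ψ (algebraMap R _ r))
    (h1 : ∀ m, φ (SymmetricAlgebra.ι R M m) = w * ψ (SymmetricAlgebra.ι R M m)) :
    pt φ m h = pt ψ m' h' :=
  SpecMap_awayHom_awayι_eq _ φ ψ h h' _ _ w hw (sym_ringHom_twist w h0 h1)

theorem SpecMap_pt (φ : SymmetricAlgebra R M →+* S) (m : M)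
    (h : IsUnit (φ (SymmetricAlgebra.ι R M m))) (r : S →+* S') :
    Spec.map (CommRingCat.ofHom r) ≫ pt φ m h = pt (r.comp φ) m (h.map r) := by
  rw [pt, pt, ← comp_awayHom _ φ _ h, CommRingCat.ofHom_comp, Spec.map_comp, Category.assoc]

theorem awayHom_away_map {N : Type u} [AddCommGroup N] [Module S N]
    (f : GradedRingHom (symGrading R M) (symGrading S N)) (φ : SymmetricAlgebra S N →+* S')
    (t : SymmetricAlgebra R M) (ht : t ∈ symGrading R M 1) (h : IsUnit (φ (f t))) :
    (awayHom (symGrading S N) φ (f t) h).comp (HomogeneousLocalization.Away.map f t) =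
      awayHom (symGrading R M) (φ.comp f.toRingHom) t h := by
  ext z
  obtain ⟨n, x, hx, rfl⟩ := HomogeneousLocalization.Away.mk_surjective _ ht z
  apply (h.pow n).mul_right_cancel
  have h1 := awayHom_mk (symGrading R M) (φ.comp f.toRingHom) t h ⟨n • 1, ⟨x, hx⟩,
    ⟨t ^ n, SetLike.pow_mem_graded n ht⟩, ⟨n, rfl⟩⟩
  have h2 := awayHom_mk (symGrading S N) φ (f t) h ⟨n • 1, ⟨f x, f.map_mem hx⟩,
    ⟨f t ^ n, SetLike.pow_mem_graded n (f.map_mem ht)⟩, ⟨n, rfl⟩⟩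
  have h3 : (φ.comp f.toRingHom) (t ^ n) = φ (f t ^ n) := by rw [map_pow, map_pow]; rfl
  rw [RingHom.comp_apply, HomogeneousLocalization.Away.map_mk f t ht]
  rw [← map_pow]
  exact h2.trans (h1.symm.trans (congrArg _ h3))

/-- The action of the morphism induced by a linear map on points. -/
theorem pt_projMap {N : Type u} [AddCommGroup N] [Module S N] [Algebra R S] [Module R N]
    [IsScalarTower R S N] (f : M →ₗ[R] N) (hf : Submodule.span S (Set.range f) = ⊤)
    (φ : SymmetricAlgebra S N →+* S') (m : M) (h : IsUnit (φ (SymmetricAlgebra.ι S N (f m))))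
    (h' : IsUnit (φ.comp (symAlgMap (S := S) f).toRingHom (SymmetricAlgebra.ι R M m))) :
    pt φ (f m) h ≫ projMap f hf = pt (φ.comp (symAlgMap (S := S) f).toRingHom) m h' := by
  have key (t : SymmetricAlgebra S N) (ht : t ∈ symGrading S N 1) (hu : IsUnit (φ t))
      (htm : t = symGradedMap (S := S) f (SymmetricAlgebra.ι R M m)) :
      Spec.map (CommRingCat.ofHom (awayHom (symGrading S N) φ t hu)) ≫
        Proj.awayι (symGrading S N) t ht one_pos ≫ projMap f hf =
      pt (φ.comp (symAlgMap (S := S) f).toRingHom) m h' := by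
    subst htm
    rw [projMap, Proj.awayι_comp_map _ _ one_pos _ (ι_mem R m), ← Category.assoc,
      ← Spec.map_comp, ← CommRingCat.ofHom_comp, awayHom_away_map _ _ _ (ι_mem R m)]
    rfl
  rw [pt, Category.assoc]
  exact key _ (ι_mem S _) h (symAlgMap_ι f m).symm

theorem pt_str (φ : SymmetricAlgebra R M →+* S) (m : M)
    (h : IsUnit (φ (SymmetricAlgebra.ι R M m))) :
    pt φ m h ≫ projSpaceStr R M = Spec.map (CommRingCat.ofHom (φ.comp (algebraMap R _))) := by
  rw [pt, projSpaceStr, Category.assoc, Proj.awayι_toSpecZero_assoc, ← Spec.map_comp,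
    ← Spec.map_comp, ← CommRingCat.ofHom_comp, ← CommRingCat.ofHom_comp]
  congr 2
  ext c
  have h := awayHom_mk (symGrading R M) φ (SymmetricAlgebra.ι R M m) h
    ⟨0, algebraMap R (symGrading R M 0) c, 1, Submonoid.one_mem _⟩
  have h1 : φ ((1 : symGrading R M 0) : SymmetricAlgebra R M) = 1 := map_one φ
  rw [h1, _root_.mul_one] at h
  exact h

/-- The fraction `x / m` in the coordinate ring of `D₊(m) ⊆ ℙ_R(M)`. -/
def awayFrac (m x : M) : HomogeneousLocalization.Away (symGrading R M) (SymmetricAlgebra.ι R M m) :=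
  HomogeneousLocalization.mk ⟨1, ⟨_, ι_mem R x⟩, ⟨_, ι_mem R m⟩, ⟨1, pow_one _⟩⟩

/-- The coordinate ring of `D₊(m) ⊆ ℙ_R(M)` as an `R`-algebra. -/
def awayC (m : M) :
    R →+* HomogeneousLocalization.Away (symGrading R M) (SymmetricAlgebra.ι R M m) :=
  (algebraMap (symGrading R M 0) _).comp (algebraMap R (symGrading R M 0))

variable (R) in
/-- The dehomogenization `Sym_R M → 𝒪(D₊(m))`, `x ↦ x / m` for `x` in `M`. -/
def dehom (m : M) : SymmetricAlgebra R M →+*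
    HomogeneousLocalization.Away (symGrading R M) (SymmetricAlgebra.ι R M m) :=
  letI := (awayC (R := R) m).toAlgebra
  (SymmetricAlgebra.lift (R := R) (M := M)
    (A := HomogeneousLocalization.Away (symGrading R M) (SymmetricAlgebra.ι R M m))
    { toFun := awayFrac m
      map_add' := fun x y => by
        apply HomogeneousLocalization.val_injective
        rw [HomogeneousLocalization.val_add]
        simp only [awayFrac, HomogeneousLocalization.val_mk, Localization.add_mk_self, map_add]
      map_smul' := fun c x => by
        apply HomogeneousLocalization.val_injective
        rw [RingHom.id_apply, Algebra.smul_def, HomogeneousLocalization.val_mul]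
        change _ = (awayC m c).val * _
        have h : (awayC m c).val = Localization.mk (algebraMap R _ c) 1 :=
          (HomogeneousLocalization.val_mk _).trans rfl
        rw [h, awayFrac, awayFrac, HomogeneousLocalization.val_mk, HomogeneousLocalization.val_mk,
          Localization.mk_mul]
        congr 1
        · exact (map_smul _ c x).trans (Algebra.smul_def _ _)
        · exact (_root_.one_mul _).symm }).toRingHom

theorem dehom_algebraMap (m : M) (c : R) : dehom R m (algebraMap R _ c) = awayC m c := by
  letI := (awayC (R := R) m).toAlgebra
  exact AlgHom.commutes _ _

theorem dehom_ι (m x : M) : dehom R m (SymmetricAlgebra.ι R M x) = awayFrac m x := by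
  letI := (awayC (R := R) m).toAlgebra
  exact SymmetricAlgebra.lift_ι_apply ..

theorem dehom_self (m : M) : dehom R m (SymmetricAlgebra.ι R M m) = 1 := by
  rw [dehom_ι]
  apply HomogeneousLocalization.val_injective
  rw [HomogeneousLocalization.val_one, awayFrac, HomogeneousLocalization.val_mk]
  exact Localization.mk_self (⟨_, ⟨1, pow_one _⟩⟩ : Submonoid.powers (SymmetricAlgebra.ι R M m))

theorem dehom_eq (m : M) (n : ℕ) (x : SymmetricAlgebra R M) (hx : x ∈ symGrading R M n) :
    (dehom R m x).val * algebraMap _ _ (SymmetricAlgebra.ι R M m ^ n) = algebraMap _ _ x := by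
  unfold symGrading at hx
  induction hx using Submodule.pow_induction_on_left' with
  | algebraMap c =>
    rw [dehom_algebraMap, pow_zero, map_one, _root_.mul_one]
    rfl
  | add x y i hx hy ihx ihy =>
    rw [map_add, HomogeneousLocalization.val_add, add_mul, ihx, ihy, map_add]
  | mem_mul y hy i x hx ih =>
    obtain ⟨y, rfl⟩ := hy
    have : (awayFrac (R := R) m y).val * algebraMap _ _ (SymmetricAlgebra.ι R M m) =
        algebraMap _ _ (SymmetricAlgebra.ι R M y) := by
      rw [awayFrac, HomogeneousLocalization.val_mk, Localization.mk_eq_mk']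
      exact IsLocalization.mk'_spec _ _ (⟨_, ⟨1, pow_one _⟩⟩ : Submonoid.powers _)
    rw [map_mul, HomogeneousLocalization.val_mul, dehom_ι, Nat.succ_eq_add_one, pow_succ, map_mul,
      map_mul, ← this, ← ih]
    ring

theorem dehom_surjective (m : M) : Function.Surjective (dehom R m) := by
  intro z
  obtain ⟨n, x, hx, rfl⟩ := HomogeneousLocalization.Away.mk_surjective _ (ι_mem R m) z
  refine ⟨x, ?_⟩
  apply HomogeneousLocalization.val_injective
  have h := dehom_eq m n x (by simpa using hx)
  rw [HomogeneousLocalization.Away.val_mk, Localization.mk_eq_mk', eq_comm,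
    IsLocalization.mk'_eq_iff_eq_mul]
  exact h.symm

theorem awayHom_dehom (φ : SymmetricAlgebra R M →+* S) (m : M)
    (h : φ (SymmetricAlgebra.ι R M m) = 1) (h' : IsUnit (φ (SymmetricAlgebra.ι R M m))) :
    (awayHom (symGrading R M) φ (SymmetricAlgebra.ι R M m) h').comp (dehom R m) = φ := by
  refine sym_ringHom_ext (fun r => ?_) fun x => ?_
  · rw [RingHom.comp_apply, dehom_algebraMap]
    have h := awayHom_mk (symGrading R M) φ (SymmetricAlgebra.ι R M m) h'
      ⟨0, algebraMap R (symGrading R M 0) r, 1, Submonoid.one_mem _⟩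
    have h1 : φ ((1 : symGrading R M 0) : SymmetricAlgebra R M) = 1 := map_one φ
    rw [h1, _root_.mul_one] at h
    exact h
  · rw [RingHom.comp_apply, dehom_ι]
    have := awayHom_mk (symGrading R M) φ (SymmetricAlgebra.ι R M m) h'
      ⟨1, ⟨_, ι_mem R x⟩, ⟨_, ι_mem R m⟩, ⟨1, pow_one _⟩⟩
    rwa [h, _root_.mul_one] at this

theorem awayι_eq_pt (m : M) :
    Proj.awayι (symGrading R M) (SymmetricAlgebra.ι R M m) (ι_mem R m) one_pos =
      pt (dehom R m) m (by rw [dehom_self]; exact isUnit_one) := by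
  have : awayHom (symGrading R M) (dehom R m) (SymmetricAlgebra.ι R M m)
      (by rw [dehom_self]; exact isUnit_one) = RingHom.id _ := by
    rw [← RingHom.cancel_right (dehom_surjective m), awayHom_dehom _ _ (dehom_self m)]
    rfl
  rw [pt, this]
  exact ((congrArg (· ≫ _) (Spec.map_id _)).trans (Category.id_comp _)).symm

theorem awayι_str (m : M) :
    Proj.awayι (symGrading R M) (SymmetricAlgebra.ι R M m) (ι_mem R m) one_pos ≫ projSpaceStr R M =
      Spec.map (CommRingCat.ofHom (awayC m)) := by
  rw [awayι_eq_pt, pt_str]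
  congr 2
  ext c
  rw [RingHom.comp_apply, dehom_algebraMap]

theorem irrelevant_le_span {I : Type*} (s : I → M) (hs : Submodule.span R (Set.range s) = ⊤) :
    (HomogeneousIdeal.irrelevant (symGrading R M)).toIdeal ≤
      Ideal.span (Set.range fun i => SymmetricAlgebra.ι R M (s i)) := by
  have key (n : M) : SymmetricAlgebra.ι R M n ∈
      Ideal.span (Set.range fun i => SymmetricAlgebra.ι R M (s i)) := by
    have hn : n ∈ Submodule.span R (Set.range s) := hs ▸ Submodule.mem_top
    induction hn using Submodule.span_induction with
    | mem x hx =>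
      obtain ⟨m, rfl⟩ := hx
      exact Ideal.subset_span ⟨m, rfl⟩
    | zero => simp
    | add x y _ _ hx hy => rw [map_add]; exact add_mem hx hy
    | smul a x _ hx =>
      rw [map_smul, Algebra.smul_def]
      exact Ideal.mul_mem_left _ _ hx
  rw [HomogeneousIdeal.toIdeal_irrelevant_le]
  intro i hi x hx
  replace hx : x ∈ LinearMap.range (SymmetricAlgebra.ι R M) ^ i := hx
  obtain ⟨j, rfl⟩ := Nat.exists_eq_succ_of_ne_zero hi.ne'
  rw [Nat.succ_eq_add_one, pow_succ] at hx
  refine Submodule.mul_induction_on hx ?_ (fun _ _ h h' => add_mem h h')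
  rintro a _ _ ⟨n, rfl⟩
  exact Ideal.mul_mem_left _ _ (key n)

/-- The affine open cover of `ℙ_R(M)` by the `D₊(s i)`, for a family of generators `s i` of `M`. -/
def coverOfSpan {I : Type u} (s : I → M) (hs : Submodule.span R (Set.range s) = ⊤) :
    (projSpace R M).AffineOpenCover :=
  Proj.affineOpenCoverOfIrrelevantLESpan (symGrading R M)
    (fun i => SymmetricAlgebra.ι R M (s i)) (m := fun _ => 1) (fun i => ι_mem R (s i))
    (fun _ => one_pos) (irrelevant_le_span s hs)

theorem projSpace_hom_ext {Z : Scheme.{u}} {a b : projSpace R M ⟶ Z}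
    (h : ∀ m : M, Proj.awayι (symGrading R M) (SymmetricAlgebra.ι R M m) (ι_mem R m) one_pos ≫ a =
      Proj.awayι (symGrading R M) (SymmetricAlgebra.ι R M m) (ι_mem R m) one_pos ≫ b) : a = b :=
  (coverOfSpan (R := R) (M := M) id (by simp)).openCover.hom_ext _ _ h

end Points

/-! ### Morphisms between projective spaces -/

section Maps

variable {k : Type u} [Field k] {A B C E : Type u} [CommRing A] [Algebra k A] [CommRing B] [Algebra k B]
  [CommRing C] [Algebra k C] [AddCommGroup E] [Module k E]

/-- The composite of the morphisms induced by two linear maps is induced by their composite. The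
composite is a separate argument `h`, since it may be given in another form. -/
theorem projMap_comp_projMap {R S T M N P : Type u} [CommRing R] [CommRing S] [Algebra R S]
    [CommRing T] [Algebra S T] [Algebra R T] [AddCommGroup M] [Module R M] [AddCommGroup N]
    [Module S N] [Module R N] [IsScalarTower R S N] [AddCommGroup P] [Module T P] [Module S P]
    [IsScalarTower S T P] [Module R P] [IsScalarTower R T P] [IsScalarTower R S T]
    (f : M →ₗ[R] N) (hf : Submodule.span S (Set.range f) = ⊤) (g : N →ₗ[S] P)
    (hg : Submodule.span T (Set.range g) = ⊤) (h : M →ₗ[R] P)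
    (hh : Submodule.span T (Set.range h) = ⊤) (hgf : ∀ m, g (f m) = h m) :
    projMap g hg ≫ projMap f hf = projMap h hh := by
  rw [projMap, projMap, projMap, ← Proj.map_comp]
  congr 1
  apply GradedRingHom.ext
  intro x
  have : (symAlgMap (S := T) g).toRingHom.comp (symAlgMap (S := S) f).toRingHom =
      (symAlgMap (S := T) h).toRingHom := by
    refine sym_ringHom_ext (fun r => ?_) (fun m => ?_)
    · change symAlgMap (S := T) g (symAlgMap (S := S) f _) = symAlgMap (S := T) h _
      rw [AlgHom.commutes, AlgHom.commutes, IsScalarTower.algebraMap_apply R S, AlgHom.commutes,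
        IsScalarTower.algebraMap_apply R T (SymmetricAlgebra T P),
        IsScalarTower.algebraMap_apply S T (SymmetricAlgebra T P),
        ← IsScalarTower.algebraMap_apply R S T]
    · change symAlgMap (S := T) g (symAlgMap (S := S) f _) = symAlgMap (S := T) h _
      rw [symAlgMap_ι, symAlgMap_ι, symAlgMap_ι, hgf]
  exact congr($this x)

theorem projAut_comp {M : Type u} [AddCommGroup M] [Module A M] (S T : M ≃ₗ[A] M) :
    projAut S ≫ projAut T = projAut (T.trans S) :=
  projMap_comp_projMap _ _ _ _ _ _ fun _ => rfl

theorem projAut_id {M : Type u} [AddCommGroup M] [Module A M] :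
    projAut (LinearEquiv.refl A M) = 𝟙 _ := by
  rw [projAut, projMap, ← Proj.map_id]
  congr 1
  apply GradedRingHom.ext
  intro x
  have : (symAlgMap (S := A) (LinearEquiv.refl A M).toLinearMap).toRingHom = RingHom.id _ := by
    refine sym_ringHom_ext (fun r => AlgHom.commutes _ _) (fun m => symAlgMap_ι _ _)
  exact congr($this x)

/-- Proportional automorphisms of a module define the same projectivity. -/
theorem projAut_eq_of_proportional {M : Type u} [AddCommGroup M] [Module A M] {S S' : M ≃ₗ[A] M}
    (h : Proportional S S') : projAut S = projAut S' := by
  obtain ⟨u, hu⟩ := h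
  refine projSpace_hom_ext fun m => ?_
  obtain ⟨n, rfl⟩ := S.surjective m
  have h1 : IsUnit (dehom A (S n) (SymmetricAlgebra.ι A M (S n))) := by
    rw [dehom_self]; exact isUnit_one
  have h2 : IsUnit (dehom A (S n) (SymmetricAlgebra.ι A M (S' n))) := by
    have h4 : IsUnit (dehom A (S n) (SymmetricAlgebra.ι A M ((u : A) • S' n))) := by
      rw [← hu]; exact h1
    rw [map_smul, Algebra.smul_def, map_mul] at h4
    exact isUnit_of_mul_isUnit_right h4
  have h3 : pt (dehom A (S n)) (S n) h1 = pt (dehom A (S n)) (S' n) h2 :=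
    pt_eq 1 isUnit_one (fun _ => rfl) (fun _ => (_root_.one_mul _).symm)
  rw [awayι_eq_pt]
  refine (pt_projMap S.toLinearMap _ (dehom A (S n)) n h1 (by simpa [symAlgMap_ι] using h1)).trans ?_
  rw [h3]
  refine Eq.trans ?_ (pt_projMap S'.toLinearMap _ (dehom A (S n)) n h2
    (by simpa [symAlgMap_ι] using h2)).symm
  refine pt_eq (dehom A (S n) (algebraMap A _ u)) ((u.isUnit.map (algebraMap A _)).map
    (dehom A (S n))) (fun r => ?_) (fun x => ?_)
  · change dehom A (S n) (symAlgMap _ _) = dehom A (S n) (symAlgMap _ _)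
    rw [AlgHom.commutes, AlgHom.commutes]
  · change dehom A (S n) (symAlgMap _ _) = _ * dehom A (S n) (symAlgMap _ _)
    rw [symAlgMap_ι, symAlgMap_ι, ← map_mul, ← Algebra.smul_def, ← map_smul]
    exact congrArg _ (congrArg _ (hu x))

/-- The morphism `ℙ_B(B ⊗ E) → ℙ_A(A ⊗ E)` induced by a homomorphism of algebras `φ : A → B`. -/
def projTw (E : Type u) [AddCommGroup E] [Module k E] (φ : A →ₐ[k] B) :
    projSpace B (B ⊗[k] E) ⟶ projSpace A (A ⊗[k] E) :=
  letI := φ.toAlgebra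
  haveI : IsScalarTower k A B := .of_algHom φ
  projMap (R := A) (S := B)
    { toFun := tw E φ
      map_add' := map_add _
      map_smul' := fun a z => by
        rw [tw_smul]
        exact algebraMap_smul B a (tw E φ z) }
    (by
      rw [eq_top_iff, ← span_range_mk k B E]
      refine Submodule.span_mono ?_
      rintro _ ⟨e, rfl⟩
      exact ⟨1 ⊗ₜ e, by simp [tw_tmul]⟩)

theorem projTw_projBaseChange (φ : A →ₐ[k] B) :
    projTw E φ ≫ projBaseChange k A E = projBaseChange k B E := by
  letI := φ.toAlgebra
  haveI : IsScalarTower k A B := .of_algHom φ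
  exact projMap_comp_projMap _ _ _ _ _ _ fun e => by
    change tw E φ (1 ⊗ₜ e) = _
    simp [tw_tmul]

theorem projTw_str (φ : A →ₐ[k] B) : projTw E φ ≫ projSpaceStr A (A ⊗[k] E) =
    projSpaceStr B (B ⊗[k] E) ≫ Spec.map (CommRingCat.ofHom φ.toRingHom) := by
  letI := φ.toAlgebra
  haveI : IsScalarTower k A B := .of_algHom φ
  exact projMap_str _ _

theorem projAut_bc_projTw (φ : A →ₐ[k] B) (T : A ⊗[k] E ≃ₗ[A] A ⊗[k] E) :
    projAut (bc φ T) ≫ projTw E φ = projTw E φ ≫ projAut T := by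
  letI := φ.toAlgebra
  haveI : IsScalarTower k A B := .of_algHom φ
  have hs := span_range_mk k B E
  let h : A ⊗[k] E →ₗ[A] B ⊗[k] E :=
    { toFun := fun z => bc φ T (tw E φ z)
      map_add' := fun _ _ => by simp
      map_smul' := fun a z => by
        rw [tw_smul, map_smul]
        exact algebraMap_smul B a (bc φ T (tw E φ z)) }
  have hh : Submodule.span B (Set.range h) = ⊤ := by
    rw [eq_top_iff, ← Submodule.map_top (bc φ T).toLinearMap |>.trans (LinearEquiv.range _),
      ← span_range_mk k B E, Submodule.map_span]
    refine Submodule.span_mono ?_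
    rintro _ ⟨_, ⟨e, rfl⟩, rfl⟩
    exact ⟨1 ⊗ₜ e, by simp [h, tw_tmul]⟩
  exact (projMap_comp_projMap (R := A) (S := B) (T := B) _ _ _ _ h hh fun _ => rfl).trans
    (projMap_comp_projMap (R := A) (S := A) (T := B) T.toLinearMap _ _ _ h hh fun z => (bc_tw φ T z).symm).symm

theorem projAut_str {M : Type u} [AddCommGroup M] [Module A M] (T : M ≃ₗ[A] M) :
    projAut T ≫ projSpaceStr A M = projSpaceStr A M := by
  refine (projMap_str T.toLinearMap _).trans ?_
  exact (congrArg (_ ≫ ·) (Spec.map_id _)).trans (Category.comp_id _)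

end Maps

/-! ### Base change of projective spaces -/

section BaseChange

variable (k : Type u) [Field k] (A E : Type u) [CommRing A] [Algebra k A] [AddCommGroup E] [Module k E]

theorem isUnit_dehom_symAlgMap (e : E) : IsUnit (((dehom A ((1 : A) ⊗ₜ[k] e)).comp
      (symAlgMap (S := A) (TensorProduct.mk k A E 1)).toRingHom) (SymmetricAlgebra.ι k E e)) := by
  change IsUnit (dehom A _ (symAlgMap _ _))
  rw [symAlgMap_ι, TensorProduct.mk_apply, dehom_self]
  exact isUnit_one

section
variable {R' : Type u} [CommRing R'] (e : E)
  (f : HomogeneousLocalization.Away (symGrading k E) (SymmetricAlgebra.ι k E e) →+* R')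
  (g : A →+* R') (hfg : ∀ c : k, f (awayC (R := k) e c) = g (algebraMap k A c))

/-- The homomorphism `Sym_A (A ⊗ E) → R'` given by compatible homomorphisms from `A` and from the
coordinate ring of `D₊(e) ⊆ ℙ(E)`. -/
def pushoutHom : SymmetricAlgebra A (A ⊗[k] E) →+* R' :=
  letI := g.toAlgebra
  letI := (g.comp (algebraMap k A)).toAlgebra
  haveI : IsScalarTower k A R' := .of_algebraMap_eq fun _ => rfl
  (SymmetricAlgebra.lift (LinearMap.liftBaseChange A
    { toFun := fun x : E => f (dehom k e (SymmetricAlgebra.ι k E x))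
      map_add' := fun _ _ => by simp only [map_add]
      map_smul' := fun c x => by
        rw [map_smul, Algebra.smul_def, map_mul, map_mul, dehom_algebraMap, hfg, RingHom.id_apply,
          Algebra.smul_def]
        rfl })).toRingHom

theorem pushoutHom_algebraMap (a : A) : pushoutHom k A E e f g hfg (algebraMap A _ a) = g a := by
  letI := g.toAlgebra
  letI := (g.comp (algebraMap k A)).toAlgebra
  haveI : IsScalarTower k A R' := .of_algebraMap_eq fun _ => rfl
  exact AlgHom.commutes _ _

theorem pushoutHom_tmul (a : A) (x : E) : pushoutHom k A E e f g hfg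
    (SymmetricAlgebra.ι A _ (a ⊗ₜ[k] x)) = g a * f (dehom k e (SymmetricAlgebra.ι k E x)) := by
  letI := g.toAlgebra
  letI := (g.comp (algebraMap k A)).toAlgebra
  haveI : IsScalarTower k A R' := .of_algebraMap_eq fun _ => rfl
  exact (SymmetricAlgebra.lift_ι_apply ..).trans (LinearMap.liftBaseChange_tmul ..)

theorem pushoutHom_self : pushoutHom k A E e f g hfg
    (SymmetricAlgebra.ι A _ ((1 : A) ⊗ₜ[k] e)) = 1 := by
  rw [pushoutHom_tmul, dehom_self, map_one, map_one, _root_.mul_one]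

end

theorem awayHom_dehom_apply {R M : Type u} [CommRing R] [AddCommGroup M] [Module R M] {S : Type u}
    [CommRing S] (φ : SymmetricAlgebra R M →+* S) (m : M)
    (h : φ (SymmetricAlgebra.ι R M m) = 1) (h' : IsUnit (φ (SymmetricAlgebra.ι R M m)))
    (x : SymmetricAlgebra R M) :
    awayHom (symGrading R M) φ (SymmetricAlgebra.ι R M m) h' (dehom R m x) = φ x :=
  congr($(awayHom_dehom φ m h h') x)

/-- The homomorphism from the coordinate ring of `D₊(e) ⊆ ℙ(E)` to that of
`D₊(1 ⊗ e) ⊆ ℙ_A(A ⊗ E)`. -/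
def awayBase (e : E) : HomogeneousLocalization.Away (symGrading k E) (SymmetricAlgebra.ι k E e) →+*
    HomogeneousLocalization.Away (symGrading A (A ⊗[k] E))
      (SymmetricAlgebra.ι A (A ⊗[k] E) ((1 : A) ⊗ₜ[k] e)) :=
  awayHom (symGrading k E) ((dehom A ((1 : A) ⊗ₜ[k] e)).comp
      (symAlgMap (S := A) (TensorProduct.mk k A E 1)).toRingHom) (SymmetricAlgebra.ι k E e)
        (isUnit_dehom_symAlgMap k A E e)

theorem awayBase_dehom (e : E) (x : SymmetricAlgebra k E) : awayBase k A E e (dehom k e x) =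
    dehom A ((1 : A) ⊗ₜ[k] e) (symAlgMap (S := A) (TensorProduct.mk k A E 1) x) := by
  refine awayHom_dehom_apply _ _ ?_ _ _
  change dehom A _ (symAlgMap (S := A) (TensorProduct.mk k A E 1) _) = 1
  rw [symAlgMap_ι, TensorProduct.mk_apply, dehom_self]

section
variable {R' : Type u} [CommRing R'] (e : E)
  (f : HomogeneousLocalization.Away (symGrading k E) (SymmetricAlgebra.ι k E e) →+* R')
  (g : A →+* R') (hfg : ∀ c : k, f (awayC (R := k) e c) = g (algebraMap k A c))

/-- The homomorphism from the coordinate ring of `D₊(1 ⊗ e) ⊆ ℙ_A(A ⊗ E)` given by compatible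
homomorphisms from `A` and from the coordinate ring of `D₊(e) ⊆ ℙ(E)`. -/
def pushoutDesc : HomogeneousLocalization.Away (symGrading A (A ⊗[k] E))
      (SymmetricAlgebra.ι A (A ⊗[k] E) ((1 : A) ⊗ₜ[k] e)) →+* R' :=
  awayHom (symGrading A (A ⊗[k] E)) (pushoutHom k A E e f g hfg)
    (SymmetricAlgebra.ι A _ ((1 : A) ⊗ₜ[k] e)) (by rw [pushoutHom_self]; exact isUnit_one)

theorem pushoutDesc_dehom (x : SymmetricAlgebra A (A ⊗[k] E)) :
    pushoutDesc k A E e f g hfg (dehom A ((1 : A) ⊗ₜ[k] e) x) = pushoutHom k A E e f g hfg x := by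
  rw [pushoutDesc]
  exact awayHom_dehom_apply (pushoutHom k A E e f g hfg) ((1 : A) ⊗ₜ[k] e)
    (pushoutHom_self k A E e f g hfg) _ x

theorem pushoutDesc_awayBase : (pushoutDesc k A E e f g hfg).comp (awayBase k A E e) = f := by
  rw [← RingHom.cancel_right (dehom_surjective e)]
  refine sym_ringHom_ext (fun r => ?_) (fun x => ?_)
  · refine (congrArg (pushoutDesc k A E e f g hfg) (awayBase_dehom k A E e _)).trans ?_
    rw [pushoutDesc_dehom, AlgHom.commutes,
      IsScalarTower.algebraMap_apply k A (SymmetricAlgebra A (A ⊗[k] E)), pushoutHom_algebraMap,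
      RingHom.comp_apply, dehom_algebraMap, hfg]
  · refine (congrArg (pushoutDesc k A E e f g hfg) (awayBase_dehom k A E e _)).trans ?_
    rw [pushoutDesc_dehom, symAlgMap_ι, TensorProduct.mk_apply, pushoutHom_tmul, map_one,
      _root_.one_mul, RingHom.comp_apply]

theorem pushoutDesc_awayC : (pushoutDesc k A E e f g hfg).comp (awayC ((1 : A) ⊗ₜ[k] e)) = g := by
  ext a
  rw [RingHom.comp_apply, ← dehom_algebraMap, pushoutDesc_dehom, pushoutHom_algebraMap]

theorem away_hom_ext {h h' : HomogeneousLocalization.Away (symGrading A (A ⊗[k] E))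
      (SymmetricAlgebra.ι A (A ⊗[k] E) ((1 : A) ⊗ₜ[k] e)) →+* R'}
    (h1 : h.comp (awayBase k A E e) = h'.comp (awayBase k A E e))
    (h2 : h.comp (awayC ((1 : A) ⊗ₜ[k] e)) = h'.comp (awayC ((1 : A) ⊗ₜ[k] e))) : h = h' := by
  rw [← RingHom.cancel_right (dehom_surjective ((1 : A) ⊗ₜ[k] e))]
  have h2' (a : A) : h (dehom A ((1 : A) ⊗ₜ[k] e) (algebraMap A _ a)) =
      h' (dehom A ((1 : A) ⊗ₜ[k] e) (algebraMap A _ a)) := by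
    rw [dehom_algebraMap]
    exact congr($h2 a)
  refine sym_ringHom_ext h2' (fun x => ?_)
  rw [RingHom.comp_apply, RingHom.comp_apply]
  induction x using TensorProduct.induction_on with
  | zero => simp
  | add x y hx hy => simp only [map_add, hx, hy]
  | tmul a x =>
    have : a ⊗ₜ[k] x = a • (1 ⊗ₜ[k] x) := by simp [TensorProduct.smul_tmul']
    have h3 := congr($h1 (dehom k e (SymmetricAlgebra.ι k E x)))
    rw [RingHom.comp_apply, RingHom.comp_apply, awayBase_dehom, symAlgMap_ι,
      TensorProduct.mk_apply] at h3
    rw [this, map_smul, Algebra.smul_def, map_mul, map_mul, map_mul, h2', h3]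

end

/-- The coordinate ring of `D₊(1 ⊗ e) ⊆ ℙ_A(A ⊗ E)` is the base change to `A` of that of
`D₊(e) ⊆ ℙ(E)`. -/
theorem isPushout_away (e : E) : IsPushout (CommRingCat.ofHom (awayC (R := k) e))
    (CommRingCat.ofHom (algebraMap k A)) (CommRingCat.ofHom (awayBase k A E e))
    (CommRingCat.ofHom (awayC (R := A) ((1 : A) ⊗ₜ[k] e))) := by
  have w : CommRingCat.ofHom (awayC (R := k) e) ≫ CommRingCat.ofHom (awayBase k A E e) =
      CommRingCat.ofHom (algebraMap k A) ≫ CommRingCat.ofHom (awayC (R := A) ((1 : A) ⊗ₜ[k] e)) := by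
    rw [← CommRingCat.ofHom_comp, ← CommRingCat.ofHom_comp]
    congr 1
    ext c
    rw [RingHom.comp_apply, RingHom.comp_apply, ← dehom_algebraMap, awayBase_dehom,
      AlgHom.commutes, ← dehom_algebraMap,
      ← IsScalarTower.algebraMap_apply k A (SymmetricAlgebra A (A ⊗[k] E))]
  refine ⟨⟨w⟩, ⟨PushoutCocone.IsColimit.mk w
    (fun s => CommRingCat.ofHom (pushoutDesc k A E e s.inl.hom s.inr.hom fun c =>
      congr(($s.condition).hom c)))
    (fun s => CommRingCat.hom_ext (pushoutDesc_awayBase ..))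
    (fun s => CommRingCat.hom_ext (pushoutDesc_awayC ..))
    (fun s m h1 h2 => CommRingCat.hom_ext (away_hom_ext k A E e ?_ ?_))⟩⟩
  · exact (congr(($h1).hom)).trans (pushoutDesc_awayBase ..).symm
  · exact (congr(($h2).hom)).trans (pushoutDesc_awayC ..).symm

/-- `ℙ_A(A ⊗ E)` is the base change of `ℙ(E)` to `A`. -/
theorem isPullback_projBaseChange : IsPullback (projBaseChange k A E) (projSpaceStr A (A ⊗[k] E))
    (projSpaceStr k E) (Spec.map (CommRingCat.ofHom (algebraMap k A))) := by
  refine Scheme.isPullback_of_openCover _ _ _ _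
    (coverOfSpan (R := k) (M := E) id (by simp)).openCover fun e => ?_
  change E at e
  have h1 := awayι_eq_pt (R := A) ((1 : A) ⊗ₜ[k] e)
  have h2 : Proj.awayι (symGrading A (A ⊗[k] E)) (SymmetricAlgebra.ι A _ ((1 : A) ⊗ₜ[k] e))
      (ι_mem A _) one_pos ≫ projBaseChange k A E =
    Spec.map (CommRingCat.ofHom (awayBase k A E e)) ≫
      Proj.awayι (symGrading k E) (SymmetricAlgebra.ι k E e) (ι_mem k e) one_pos := by
    rw [h1]
    exact pt_projMap _ _ _ _ _ (isUnit_dehom_symAlgMap k A E e)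
  have h3 := IsOpenImmersion.isPullback _ _ _ _ h2 (by
    rw [Proj.opensRange_awayι, Proj.opensRange_awayι, projBaseChange, projMap,
      Proj.map_preimage_basicOpen]
    congr 1
    exact symAlgMap_ι _ _)
  have h4 := isPullback_SpecMap_of_isPushout _ _ _ _ (isPushout_away k A E e)
  refine h4.of_iso h3.flip.isoPullback (Iso.refl _) (Iso.refl _) (Iso.refl _) ?_ ?_ ?_ ?_
  · exact (Category.comp_id _).trans (h3.flip.isoPullback_hom_snd).symm
  · refine (Category.comp_id _).trans ?_
    refine (awayι_str _).symm.trans ?_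
    exact (congrArg (· ≫ projSpaceStr A (A ⊗[k] E)) h3.flip.isoPullback_hom_fst.symm).trans
      (Category.assoc _ _ _)
  · refine (Category.comp_id _).trans ?_
    rw [← awayι_str]
    exact (Category.id_comp _).symm
  · exact (Category.comp_id _).trans (Category.id_comp _).symm

end BaseChange

/-! ### Values of functions at points with values in rings -/

section EvalSpec

variable {Z Z' : Scheme.{u}} {R R' : CommRingCat.{u}}

/-- The value of functions on an open subset `U` of a scheme at an `R`-valued point of `U`. -/
def evC (f : Spec R ⟶ Z) (U : Z.Opens) (h : ⊤ ≤ f ⁻¹ᵁ U) : Γ(Z, U) ⟶ R :=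
  f.appLE U ⊤ h ≫ (Scheme.ΓSpecIso R).hom

theorem evC_res (f : Spec R ⟶ Z) {U V : Z.Opens} (hUV : V ≤ U) (h : ⊤ ≤ f ⁻¹ᵁ V) :
    Z.presheaf.map (homOfLE hUV).op ≫ evC f V h = evC f U (h.trans (f.preimage_mono hUV)) := by
  unfold evC
  rw [Scheme.Hom.map_appLE_assoc]

theorem evC_comp (f : Spec R ⟶ Z) (m : Z ⟶ Z') (U : Z'.Opens) (h : ⊤ ≤ (f ≫ m) ⁻¹ᵁ U) :
    evC (f ≫ m) U h = m.app U ≫ evC f (m ⁻¹ᵁ U) h := by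
  simp only [evC]
  rw [Scheme.Hom.comp_appLE, Category.assoc]

theorem evC_top (f : Spec R ⟶ Z) : evC f ⊤ le_rfl = f.appTop ≫ (Scheme.ΓSpecIso R).hom := by
  exact congrArg (· ≫ _) (Scheme.Hom.appLE_eq_app f)

theorem evC_SpecMap (φ : R ⟶ R') (f : Spec R ⟶ Z) (U : Z.Opens) (h : ⊤ ≤ f ⁻¹ᵁ U)
    (h' : ⊤ ≤ (Spec.map φ ≫ f) ⁻¹ᵁ U) : evC (Spec.map φ ≫ f) U h' = evC f U h ≫ φ := by
  rw [evC, ← Scheme.Hom.appLE_comp_appLE _ _ U ⊤ ⊤ h le_top, evC, Category.assoc, Category.assoc,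
    ← Scheme.ΓSpecIso_naturality]
  congr 2

theorem evC_fromSpec {U : Z.Opens} (hU : IsAffineOpen U) (h : ⊤ ≤ hU.fromSpec ⁻¹ᵁ U) :
    evC hU.fromSpec U h = 𝟙 _ := by
  have h1 := hU.fromSpec_app_self
  rw [evC, Scheme.Hom.appLE, h1]
  simp only [Category.assoc, ← Functor.map_comp_assoc]
  have : ∀ f : (Opposite.op ⊤ : (Spec Γ(Z, U)).Opensᵒᵖ) ⟶ Opposite.op ⊤, f = 𝟙 _ :=
    fun f => Subsingleton.elim _ _
  rw [this (_ ≫ _), CategoryTheory.Functor.map_id, Category.id_comp, Iso.inv_hom_id]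

theorem SpecMap_evC (f : Spec R ⟶ Z) {U : Z.Opens} (hU : IsAffineOpen U) (h : ⊤ ≤ f ⁻¹ᵁ U) :
    Spec.map (evC f U h) ≫ hU.fromSpec = f := by
  have h1 := hU.SpecMap_appLE_fromSpec f (isAffineOpen_top _) h
  rw [IsAffineOpen.fromSpec_top] at h1
  have h2 : Spec.map (Scheme.ΓSpecIso R).hom = (Spec R).isoSpec.hom := by
    simp [Scheme.isoSpec]
  rw [evC, Spec.map_comp, Category.assoc, h1, h2, Iso.hom_inv_id_assoc]

theorem evC_algebraMap {k B : Type u} [Field k] [CommRing B] [Algebra k B]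
    (X : Over (Spec (.of k))) (f : Spec (.of B) ⟶ X.left)
    (hf : f ≫ X.hom = Spec.map (CommRingCat.ofHom (algebraMap k B)))
    (U : X.left.Opens) (h : ⊤ ≤ f ⁻¹ᵁ U) (c : k) :
    (evC f U h).hom (algebraMap k Γ(X.left, U) c) = algebraMap k B c := by
  have h1 : (Scheme.ΓSpecIso (.of k)).inv ≫ X.hom.appTop ≫
      X.left.presheaf.map (homOfLE le_top : U ⟶ ⊤).op ≫ evC f U h =
        CommRingCat.ofHom (algebraMap k B) := by
    have h2 : X.hom.appTop ≫ evC f ⊤ le_top = evC (f ≫ X.hom) ⊤ le_top := (evC_comp _ _ _ _).symm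
    rw [evC_res, h2]
    have h3 : evC (f ≫ X.hom) ⊤ le_top = (f ≫ X.hom).appTop ≫ (Scheme.ΓSpecIso _).hom := evC_top _
    rw [h3, hf, Scheme.ΓSpecIso_naturality, Iso.inv_hom_id_assoc]
  exact congr($(h1).hom c)

end EvalSpec

section Points

variable {k : Type u} [Field k] {S S' : Over (Spec (.of k))}
  {B C : Type u} [CommRing B] [Algebra k B] [CommRing C] [Algebra k C]

variable (k B) in
/-- The spectrum of a `k`-algebra as a `k`-scheme. -/
def specOver : Over (Spec (.of k)) := Over.mk (Spec.map (CommRingCat.ofHom (algebraMap k B)))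

/-- The morphism of `k`-schemes `Spec C → Spec B` given by a homomorphism of `k`-algebras. -/
def specMap (φ : B →ₐ[k] C) : specOver k C ⟶ specOver k B :=
  Over.homMk (Spec.map (CommRingCat.ofHom φ.toRingHom)) (by
    simp only [specOver, Over.mk_hom, ← Spec.map_comp, ← CommRingCat.ofHom_comp, Over.mk_left]
    congr 2
    exact φ.comp_algebraMap)

theorem specMap_comp {D : Type u} [CommRing D] [Algebra k D] (φ : B →ₐ[k] C) (ψ : C →ₐ[k] D) :
    specMap ψ ≫ specMap φ = specMap (ψ.comp φ) := by
  ext1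
  exact (Spec.map_comp _ _).symm

/-- The value of functions on an open subset `U` at a `B`-valued point of `U`. -/
def ev (g : specOver k B ⟶ S) (U : S.left.Opens) (h : ∀ p, g.left p ∈ U) :
    Γ(S.left, U) →ₐ[k] B where
  toRingHom := (evC (R := .of B) g.left U (fun p _ => h p)).hom
  commutes' c := evC_algebraMap S g.left (Over.w g) U _ c

theorem ev_specMap (g : specOver k B ⟶ S) (U : S.left.Opens) (h : ∀ p, g.left p ∈ U)
    (φ : B →ₐ[k] C) (h' : ∀ p, (specMap φ ≫ g).left p ∈ U) :
    ev (specMap φ ≫ g) U h' = φ.comp (ev g U h) := by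
  ext f
  exact congr($(evC_SpecMap (CommRingCat.ofHom φ.toRingHom) g.left U (fun p _ => h p)
    (fun p _ => h' p)).hom f)

theorem ev_res (g : specOver k B ⟶ S) {U V : S.left.Opens} (hUV : V ≤ U)
    (h : ∀ p, g.left p ∈ V) (f : Γ(S.left, U)) :
    ev g V h (resO S.left hUV f) = ev g U (fun p => hUV (h p)) f :=
  congr($(evC_res (R := .of B) g.left hUV (fun p _ => h p)).hom f)

theorem ev_comp (g : specOver k B ⟶ S) (m : S ⟶ S') (U : S'.left.Opens)
    (h : ∀ p, (g ≫ m).left p ∈ U) (f : Γ(S'.left, U)) :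
    ev (g ≫ m) U h f = ev g (m.left ⁻¹ᵁ U) h (m.left.app U f) :=
  congr($(evC_comp (R := .of B) g.left m.left U (fun p _ => h p)).hom f)

/-- An affine open subset of `S`, as a point of `S` with values in its coordinate ring. -/
def affPt {U : S.left.Opens} (hU : IsAffineOpen U) : specOver k Γ(S.left, U) ⟶ S :=
  Over.homMk hU.fromSpec (affineStr S hU)

theorem affPt_mem {U : S.left.Opens} (hU : IsAffineOpen U) (p) : (affPt hU).left p ∈ U := by
  have : hU.fromSpec p ∈ Set.range hU.fromSpec := ⟨p, rfl⟩
  rwa [hU.range_fromSpec] at this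

theorem ev_affPt {U : S.left.Opens} (hU : IsAffineOpen U) :
    ev (affPt hU) U (affPt_mem hU) = AlgHom.id k _ := by
  ext f
  exact congr($(evC_fromSpec hU (fun p _ => affPt_mem hU p)).hom f)

theorem specMap_ev_affPt (g : specOver k B ⟶ S) {U : S.left.Opens} (hU : IsAffineOpen U)
    (h : ∀ p, g.left p ∈ U) : specMap (ev g U h) ≫ affPt hU = g := by
  ext1
  exact SpecMap_evC (R := .of B) g.left hU (fun p _ => h p)

/-- The restriction of functions as a homomorphism of `k`-algebras. -/
def resA (S : Over (Spec (.of k))) {U V : S.left.Opens} (h : V ≤ U) :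
    Γ(S.left, U) →ₐ[k] Γ(S.left, V) where
  toRingHom := resO S.left h
  commutes' := res_algebraMap h

theorem ev_resA (g : specOver k B ⟶ S) {U V : S.left.Opens} (hUV : V ≤ U)
    (h : ∀ p, g.left p ∈ V) :
    (ev g V h).comp (resA S hUV) = ev g U (fun p => hUV (h p)) :=
  AlgHom.ext fun f => ev_res g hUV h f

theorem specMap_resA {U V : S.left.Opens} (hU : IsAffineOpen U) (hV : IsAffineOpen V) (h : V ≤ U) :
    specMap (resA S h) ≫ affPt hU = affPt hV := by
  ext1
  exact hU.map_fromSpec hV (homOfLE h).op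

end Points

/-- In a separated scheme the intersection of two affine open subsets is affine. -/
theorem isAffineOpen_inf {k : Type u} [Field k] {S : Over (Spec (.of k))} [IsSeparated S.hom]
    {U V : S.left.Opens} (hU : IsAffineOpen U) (hV : IsAffineOpen V) : IsAffineOpen (U ⊓ V) := by
  have h1 : terminal.from S.left = S.hom ≫ terminal.from _ := Subsingleton.elim _ _
  haveI : IsSeparated (terminal.from S.left) := by rw [h1]; infer_instance
  exact hU.inf hV

/-! ### Charts of `S × ℙ(E)` -/

section Charts

variable {k : Type u} [Field k] {S : Over (Spec (.of k))}
  {B C E : Type u} [CommRing B] [Algebra k B] [CommRing C] [Algebra k C] [AddCommGroup E] [Module k E]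

variable (k B E) in
/-- The projective space `ℙ_B(B ⊗ E)` as a `k`-scheme. -/
def projB : Over (Spec (.of k)) :=
  Over.mk (projSpaceStr B (B ⊗[k] E) ≫ Spec.map (CommRingCat.ofHom (algebraMap k B)))

variable (k B E) in
/-- The structure morphism `ℙ_B(B ⊗ E) → Spec B`. -/
def projBStr : projB k B E ⟶ specOver k B := Over.homMk (projSpaceStr B (B ⊗[k] E)) rfl

variable (k B E) in
/-- The projection `ℙ_B(B ⊗ E) → ℙ(E)`. -/
def projBPr : projB k B E ⟶ projOver k E := Over.homMk (projBaseChange k B E) (projMap_str _ _)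

/-- For a `B`-valued point `g` of `S`, the morphism `ℙ_B(B ⊗ E) → S × ℙ(E)`. -/
def chartAt (E : Type u) [AddCommGroup E] [Module k E] (g : specOver k B ⟶ S) :
    projB k B E ⟶ S ⊗ projOver k E :=
  lift (projBStr k B E ≫ g) (projBPr k B E)

/-- The morphism of `k`-schemes `ℙ_C(C ⊗ E) → ℙ_B(B ⊗ E)` induced by `φ : B → C`. -/
def projTwOver (E : Type u) [AddCommGroup E] [Module k E] (φ : B →ₐ[k] C) :
    projB k C E ⟶ projB k B E :=
  Over.homMk (projTw E φ) (by
    change _ ≫ _ ≫ _ = _ ≫ _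
    refine (Category.assoc _ _ _).symm.trans ((congrArg (· ≫ _) (projTw_str φ)).trans ?_)
    rw [Category.assoc, ← Spec.map_comp, ← CommRingCat.ofHom_comp]
    congr 3
    exact φ.comp_algebraMap)

theorem projTwOver_str (φ : B →ₐ[k] C) :
    projTwOver E φ ≫ projBStr k B E = projBStr k C E ≫ specMap φ := by
  ext1
  exact projTw_str φ

theorem projTwOver_pr (φ : B →ₐ[k] C) : projTwOver E φ ≫ projBPr k B E = projBPr k C E := by
  ext1
  exact projTw_projBaseChange φ

theorem projTwOver_chartAt (φ : B →ₐ[k] C) (g : specOver k B ⟶ S) :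
    projTwOver E φ ≫ chartAt E g = chartAt E (specMap φ ≫ g) := by
  rw [chartAt, chartAt, comp_lift, projTwOver_pr, ← Category.assoc, projTwOver_str, Category.assoc]

/-- The automorphism of the `k`-scheme `ℙ_B(B ⊗ E)` defined by an automorphism of the module. -/
def projAutOver (T : B ⊗[k] E ≃ₗ[B] B ⊗[k] E) : projB k B E ⟶ projB k B E :=
  Over.homMk (projAut T) (by
    exact (Category.assoc _ _ _).symm.trans (congrArg (· ≫ _) (projAut_str T)))

theorem projAutOver_str (T : B ⊗[k] E ≃ₗ[B] B ⊗[k] E) :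
    projAutOver T ≫ projBStr k B E = projBStr k B E := by
  ext1
  exact projAut_str T

theorem projAutOver_bc (φ : B →ₐ[k] C) (T : B ⊗[k] E ≃ₗ[B] B ⊗[k] E) :
    projAutOver (bc φ T) ≫ projTwOver E φ = projTwOver E φ ≫ projAutOver T := by
  ext1
  exact projAut_bc_projTw φ T

theorem projAutOver_comp (T T' : B ⊗[k] E ≃ₗ[B] B ⊗[k] E) :
    projAutOver T ≫ projAutOver T' = projAutOver (T'.trans T) := by
  ext1
  exact projAut_comp T T'

theorem projAutOver_eq {T T' : B ⊗[k] E ≃ₗ[B] B ⊗[k] E} (h : Proportional T T') :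
    projAutOver T = projAutOver T' := by
  ext1
  exact projAut_eq_of_proportional h

theorem projAutOver_refl : projAutOver (LinearEquiv.refl B (B ⊗[k] E)) = 𝟙 _ := by
  ext1
  exact projAut_id

theorem isPullback_chartAt (g : specOver k B ⟶ S) :
    IsPullback (chartAt E g).left (projBStr k B E).left (fst S (projOver k E)).left g.left := by
  refine IsPullback.of_right (h₁₂ := (snd S (projOver k E)).left) (v₁₃ := projSpaceStr k E)
    (h₂₂ := S.hom) ?_ ?_ (IsPullback.of_hasPullback S.hom (projSpaceStr k E)).flip
  · have h1 : (chartAt E g).left ≫ (snd S (projOver k E)).left = projBaseChange k B E := by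
      rw [← Over.comp_left, chartAt, lift_snd]; rfl
    have h2 : g.left ≫ S.hom = Spec.map (CommRingCat.ofHom (algebraMap k B)) := Over.w g
    rw [h1, h2]
    exact isPullback_projBaseChange k B E
  · rw [← Over.comp_left, chartAt, lift_fst]; rfl

theorem isOpenImmersion_chartAt (g : specOver k B ⟶ S) [IsOpenImmersion g.left] :
    IsOpenImmersion (chartAt E g).left :=
  MorphismProperty.of_isPullback (P := @IsOpenImmersion) (isPullback_chartAt g).flip inferInstance

theorem range_chartAt (g : specOver k B ⟶ S) :
    Set.range (chartAt E g).left = (fst S (projOver k E)).left ⁻¹' Set.range g.left := by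
  rw [← Scheme.Pullback.range_fst, ← (isPullback_chartAt (E := E) g).isoPullback_hom_fst,
    Scheme.Hom.comp_base, TopCat.coe_comp]
  exact Function.Surjective.range_comp
    (isPullback_chartAt (E := E) g).isoPullback.hom.homeomorph.surjective _

instance {U : S.left.Opens} (hU : IsAffineOpen U) : IsOpenImmersion (affPt hU).left :=
  inferInstanceAs (IsOpenImmersion hU.fromSpec)

instance {U : S.left.Opens} (hU : IsAffineOpen U) :
    IsOpenImmersion (chartAt E (affPt hU)).left := isOpenImmersion_chartAt _

variable {I : Type u} {U : I → S.left.Opens} (hU : ∀ i, IsAffineOpen (U i))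

/-- The open cover of `S × ℙ(E)` given by an affine open cover of `S`. -/
def chartCover (hcov : ∀ x, ∃ i, x ∈ U i) (E : Type u) [AddCommGroup E] [Module k E] :
    Scheme.OpenCover (S ⊗ projOver k E).left :=
  Scheme.Cover.mkOfCovers I (fun i => (projB k Γ(S.left, U i) E).left)
    (fun i => (chartAt E (affPt (hU i))).left) (fun z => by
      obtain ⟨i, hi⟩ := hcov ((fst S (projOver k E)).left z)
      have h1 : z ∈ Set.range (chartAt E (affPt (hU i))).left := by
        rw [range_chartAt]
        change _ ∈ Set.range (hU i).fromSpec
        rw [(hU i).range_fromSpec]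
        exact hi
      obtain ⟨y, hy⟩ := h1
      exact ⟨i, y, hy⟩) (fun i => inferInstanceAs (IsOpenImmersion _))

theorem charts_hom_ext (hcov : ∀ x, ∃ i, x ∈ U i) {Z : Over (Spec (.of k))} {a b : S ⊗ projOver k E ⟶ Z}
    (h : ∀ i, chartAt E (affPt (hU i)) ≫ a = chartAt E (affPt (hU i)) ≫ b) : a = b := by
  ext1
  refine (chartCover hU hcov E).hom_ext _ _ fun i => ?_
  exact congr(($(h i)).left)

/-- Morphisms on the members of an affine open cover which agree on affine open subsets of the
intersections glue. -/
theorem exists_glue (hcov : ∀ x, ∃ i, x ∈ U i) [IsSeparated S.hom] {Z : Over (Spec (.of k))}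
    (f : ∀ i, projB k Γ(S.left, U i) E ⟶ Z)
    (hf : ∀ i j (V : S.left.Opens) (hV : IsAffineOpen V) (hi : V ≤ U i) (hj : V ≤ U j),
      projTwOver E (resA S hi) ≫ f i = projTwOver E (resA S hj) ≫ f j) :
    ∃ F : S ⊗ projOver k E ⟶ Z, ∀ i, chartAt E (affPt (hU i)) ≫ F = f i := by
  have hg : ∀ i j, pullback.fst ((chartCover hU hcov E).f i) ((chartCover hU hcov E).f j) ≫
      (f i).left = pullback.snd ((chartCover hU hcov E).f i) ((chartCover hU hcov E).f j) ≫
      (f j).left := by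
    intro (i : I) (j : I)
    have hV : IsAffineOpen (U i ⊓ U j) := isAffineOpen_inf (hU i) (hU j)
    let c := (chartAt E (affPt hV)).left
    let a := pullback.fst ((chartCover hU hcov E).f i) ((chartCover hU hcov E).f j)
    let b := pullback.snd ((chartCover hU hcov E).f i) ((chartCover hU hcov E).f j)
    have hab : a ≫ (chartAt E (affPt (hU i))).left = b ≫ (chartAt E (affPt (hU j))).left :=
      pullback.condition
    have hr : Set.range (a ≫ (chartAt E (affPt (hU i))).left) ⊆ Set.range c := by
      rintro _ ⟨y, rfl⟩
      rw [range_chartAt]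
      have h1 : ∀ (l) (y : (projB k Γ(S.left, U l) E).left),
          (fst S (projOver k E)).left ((chartAt E (affPt (hU l))).left y) ∈ U l := by
        intro l y
        have := range_chartAt (E := E) (affPt (hU l))
        have h2 : (chartAt E (affPt (hU l))).left y ∈
            Set.range (chartAt E (affPt (hU l))).left := ⟨y, rfl⟩
        rw [this] at h2
        change _ ∈ Set.range (hU l).fromSpec at h2
        rwa [(hU l).range_fromSpec] at h2
      change _ ∈ Set.range hV.fromSpec
      rw [hV.range_fromSpec]
      refine ⟨h1 i (a y), ?_⟩
      have h3 := h1 j (b y)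
      have h4 : (chartAt E (affPt (hU j))).left (b y) =
          (a ≫ (chartAt E (affPt (hU i))).left) y := by rw [hab]; rfl
      rwa [h4] at h3
    let l := IsOpenImmersion.lift c (a ≫ (chartAt E (affPt (hU i))).left) hr
    have hl : l ≫ c = a ≫ (chartAt E (affPt (hU i))).left := IsOpenImmersion.lift_fac _ _ _
    have hc : ∀ (n) (hn : U i ⊓ U j ≤ U n),
        (projTwOver E (resA S hn)).left ≫ (chartAt E (affPt (hU n))).left = c := by
      intro n hn
      exact congr(($((projTwOver_chartAt _ _).trans (congrArg (chartAt E)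
        (specMap_resA (hU n) hV hn)))).left)
    have ha : a = l ≫ (projTwOver E (resA S (inf_le_left : U i ⊓ U j ≤ U i))).left := by
      refine (cancel_mono (chartAt E (affPt (hU i))).left).mp ?_
      exact hl.symm.trans ((congrArg (l ≫ ·) (hc i inf_le_left).symm).trans
        (Category.assoc _ _ _).symm)
    have hb : b = l ≫ (projTwOver E (resA S (inf_le_right : U i ⊓ U j ≤ U j))).left := by
      refine (cancel_mono (chartAt E (affPt (hU j))).left).mp ?_
      exact (hl.trans hab).symm.trans ((congrArg (l ≫ ·) (hc j inf_le_right).symm).trans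
        (Category.assoc _ _ _).symm)
    change a ≫ _ = b ≫ _
    rw [ha, hb]
    exact (Category.assoc _ _ _).trans ((congr(l ≫ ($(hf i j _ hV inf_le_left inf_le_right)).left)).trans
      (Category.assoc _ _ _).symm)
  let F := (chartCover hU hcov E).glueMorphisms (fun i => (f i).left) hg
  have hF : ∀ i, (chartAt E (affPt (hU i))).left ≫ F = (f i).left :=
    fun i => (chartCover hU hcov E).ι_glueMorphisms (fun i => (f i).left) hg i
  refine ⟨Over.homMk F ?_, fun i => ?_⟩
  · refine (chartCover hU hcov E).hom_ext _ _ fun i => ?_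
    refine (Category.assoc _ _ _).symm.trans ((congrArg (· ≫ _) (hF i)).trans ?_)
    exact (Over.w (f i)).trans (Over.w (chartAt E (affPt (hU i)))).symm
  · ext1
    exact hF i

end Charts

/-! ### Gluing projectivities, and actions on `ℙ(E)` -/

section System

variable {k : Type u} [Field k]

/-- Automorphisms `T` of the modules `𝒪(U) ⊗ E` for the members `U` of an affine open cover of `S`,
which agree up to units on overlaps. -/
structure AutSystem (S : Over (Spec (.of k))) (E : Type u) [AddCommGroup E] [Module k E] where
  I : Type u
  U : I → S.left.Opens
  isAffineOpen : ∀ i, IsAffineOpen (U i)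
  covers : ∀ x, ∃ i, x ∈ U i
  T : ∀ i, Γ(S.left, U i) ⊗[k] E ≃ₗ[Γ(S.left, U i)] Γ(S.left, U i) ⊗[k] E
  compat : ∀ i j (V : S.left.Opens) (_ : IsAffineOpen V) (hi : V ≤ U i) (hj : V ≤ U j),
    Proportional (bc (resA S hi) (T i)) (bc (resA S hj) (T j))

theorem bc_symm {A B E : Type u} [CommRing A] [Algebra k A] [CommRing B] [Algebra k B]
    [AddCommGroup E] [Module k E] (φ : A →ₐ[k] B) (T : A ⊗[k] E ≃ₗ[A] A ⊗[k] E) :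
    bc φ T.symm = (bc φ T).symm := rfl

theorem Proportional.inv {A M : Type*} [CommRing A] [AddCommGroup M] [Module A M]
    {T T' : M ≃ₗ[A] M} (h : Proportional T T') : Proportional T.symm T'.symm := by
  obtain ⟨u, hu⟩ := h
  refine ⟨u⁻¹, fun z => ?_⟩
  rw [LinearEquiv.symm_apply_eq, hu, LinearEquiv.map_smul, LinearEquiv.apply_symm_apply,
    smul_smul, Units.mul_inv, one_smul]

namespace AutSystem

variable {S : Over (Spec (.of k))} {E : Type u} [AddCommGroup E] [Module k E] [IsSeparated S.hom]
  {B : Type u} [CommRing B] [Algebra k B]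

theorem exists_mor (σ : AutSystem S E) : ∃ m : S ⊗ projOver k E ⟶ projOver k E,
    ∀ i, chartAt E (affPt (σ.isAffineOpen i)) ≫ m = projAutOver (σ.T i) ≫ projBPr k _ E := by
  refine exists_glue σ.isAffineOpen σ.covers _ fun i j V hV hi hj => ?_
  rw [← Category.assoc, ← projAutOver_bc, Category.assoc, projTwOver_pr,
    projAutOver_eq (σ.compat i j V hV hi hj), ← projTwOver_pr (resA S hj), ← Category.assoc,
    projAutOver_bc, Category.assoc]

/-- The morphism `S × ℙ(E) → ℙ(E)` defined by a system of automorphisms. -/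
def mor (σ : AutSystem S E) : S ⊗ projOver k E ⟶ projOver k E := σ.exists_mor.choose

/-- The morphism defined by a system acts above the point `g` through the value of the system at
`g`. -/
theorem chartAt_mor (σ : AutSystem S E) (i : σ.I) (g : specOver k B ⟶ S)
    (h : ∀ p, g.left p ∈ σ.U i) :
    chartAt E g ≫ σ.mor = projAutOver (bc (ev g (σ.U i) h) (σ.T i)) ≫ projBPr k B E := by
  have h1 : chartAt E g =
      projTwOver E (ev g (σ.U i) h) ≫ chartAt E (affPt (σ.isAffineOpen i)) := by
    rw [projTwOver_chartAt, specMap_ev_affPt]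
  rw [h1, Category.assoc, mor, σ.exists_mor.choose_spec i, ← Category.assoc, ← projAutOver_bc,
    Category.assoc, projTwOver_pr]

theorem projAutOver_chartAt (T : B ⊗[k] E ≃ₗ[B] B ⊗[k] E) (g : specOver k B ⟶ S) :
    projAutOver T ≫ chartAt E g = lift (projBStr k B E ≫ g) (projAutOver T ≫ projBPr k B E) := by
  rw [chartAt, comp_lift, ← Category.assoc, projAutOver_str]

theorem chartAt_lift_mor (σ : AutSystem S E) (i : σ.I) (g : specOver k B ⟶ S)
    (h : ∀ p, g.left p ∈ σ.U i) : chartAt E g ≫ lift (fst _ _) σ.mor =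
      projAutOver (bc (ev g (σ.U i) h) (σ.T i)) ≫ chartAt E g := by
  rw [comp_lift, σ.chartAt_mor i g h, projAutOver_chartAt]
  congr 1
  rw [chartAt, lift_fst]

theorem isInducedOn (σ : AutSystem S E) (i : σ.I) :
    IsInducedOn (lift (fst _ _) σ.mor) (σ.isAffineOpen i) (σ.T i) := by
  have h := σ.chartAt_lift_mor i _ (affPt_mem (σ.isAffineOpen i))
  rw [ev_affPt, bc_id] at h
  exact congr(($h).left)

/-- The system of the inverse automorphisms. -/
def symm (σ : AutSystem S E) : AutSystem S E where
  I := σ.I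
  U := σ.U
  isAffineOpen := σ.isAffineOpen
  covers := σ.covers
  T i := (σ.T i).symm
  compat i j V hV hi hj := by
    rw [bc_symm, bc_symm]
    exact (σ.compat i j V hV hi hj).inv

theorem isIso_lift_mor (σ : AutSystem S E) : IsIso (lift (fst _ _) σ.mor) := by
  have key : ∀ σ : AutSystem S E, lift (fst S (projOver k E)) σ.mor ≫
      lift (fst S (projOver k E)) σ.symm.mor = 𝟙 _ := by
    intro σ
    refine charts_hom_ext σ.isAffineOpen σ.covers fun i => ?_
    rw [← Category.assoc, σ.chartAt_lift_mor i _ (affPt_mem (σ.isAffineOpen i)), Category.assoc]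
    rw [σ.symm.chartAt_lift_mor i _ (affPt_mem (σ.isAffineOpen i)), ← Category.assoc,
      projAutOver_comp]
    have h1 : (bc (ev (affPt (σ.isAffineOpen i)) (σ.U i) (affPt_mem (σ.isAffineOpen i)))
        (σ.symm.T i)).trans (bc (ev (affPt (σ.isAffineOpen i)) (σ.U i)
          (affPt_mem (σ.isAffineOpen i))) (σ.T i)) = LinearEquiv.refl _ _ :=
      LinearEquiv.symm_trans_self (bc _ (σ.T i))
    refine (congrArg (fun T => projAutOver T ≫ _) h1).trans ?_
    rw [projAutOver_refl, Category.id_comp, Category.comp_id]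
  exact ⟨_, key σ, key σ.symm⟩

end AutSystem

/-- Every point of a scheme has an affine open neighbourhood inside a given open subset. -/
theorem exists_isAffineOpen_mem {Z : Scheme.{u}} (U : Z.Opens) (z : Z) (h : z ∈ U) :
    ∃ W : Z.Opens, IsAffineOpen W ∧ z ∈ W ∧ W ≤ U := by
  obtain ⟨W, hW, hz, hWU⟩ := TopologicalSpace.Opens.isBasis_iff_nbhd.mp Z.isBasis_affineOpens h
  exact ⟨W, hW, hz, hWU⟩

/-- The projection `ℙ_k(k ⊗ E) → ℙ(E)` is an isomorphism. -/
theorem isIso_projBPr_self (E : Type u) [AddCommGroup E] [Module k E] :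
    IsIso (projBPr k k E) := by
  have h := isPullback_projBaseChange k k E
  haveI : IsIso (Spec.map (CommRingCat.ofHom (algebraMap k k))) := by
    have : CommRingCat.ofHom (algebraMap k k) = 𝟙 _ := rfl
    rw [this, Spec.map_id]; infer_instance
  haveI : IsIso (projBaseChange k k E) := h.isIso_fst_of_isIso
  haveI : IsIso ((Over.forget _).map (projBPr k k E)) :=
    inferInstanceAs (IsIso (projBaseChange k k E))
  exact isIso_of_reflects_iso _ (Over.forget _)

/-- A system of automorphisms on a group scheme which is multiplicative up to units defines an
action of the group on the projective space. -/
abbrev AutSystem.modObj {G : Over (Spec (.of k))} [GrpObj G] [IsSeparated G.hom]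
    {E : Type u} [AddCommGroup E] [Module k E] (σ : AutSystem G E)
    (hone : ∃ (i : σ.I) (h : ∀ p, (toUnit (specOver k k) ≫ η[G]).left p ∈ σ.U i),
      Proportional (bc (ev (toUnit (specOver k k) ≫ η[G]) (σ.U i) h) (σ.T i)) (LinearEquiv.refl _ _))
    (hmul : ∀ (W : (G ⊗ G).left.Opens) (hW : IsAffineOpen W) (i₁ i₂ i₃ : σ.I)
      (h₁ : ∀ p, (affPt hW ≫ fst G G).left p ∈ σ.U i₁)
      (h₂ : ∀ p, (affPt hW ≫ snd G G).left p ∈ σ.U i₂)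
      (h₃ : ∀ p, (affPt hW ≫ μ[G]).left p ∈ σ.U i₃), (∃ z, z ∈ W) →
      Proportional (bc (ev (affPt hW ≫ μ[G]) (σ.U i₃) h₃) (σ.T i₃))
        ((bc (ev (affPt hW ≫ fst G G) (σ.U i₁) h₁) (σ.T i₁)).trans
          (bc (ev (affPt hW ≫ snd G G) (σ.U i₂) h₂) (σ.T i₂)))) :
    ModObj G (projOver k E) where
  smul := σ.mor
  one_smul := by
    obtain ⟨i, h, hp⟩ := hone
    haveI := isIso_projBPr_self (k := k) E
    have h1 := σ.chartAt_mor i (toUnit (specOver k k) ≫ η[G]) h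
    rw [projAutOver_eq hp, projAutOver_refl, Category.id_comp] at h1
    have h2 : projBPr k k E ≫ lift (toUnit (projOver k E) ≫ η[G]) (𝟙 _) =
        chartAt E (toUnit (specOver k k) ≫ η[G]) := by
      rw [comp_lift, Category.comp_id, chartAt]
      congr 1
      rw [← Category.assoc, ← Category.assoc]
      congr 1
      exact toUnit_unique _ _
    rw [← h2, Category.assoc] at h1
    have h3 : lift (toUnit (projOver k E) ≫ η[G]) (𝟙 _) ≫ σ.mor = 𝟙 _ := by
      rw [← cancel_epi (projBPr k k E), h1, Category.comp_id]
    have h4 : (λ_ (projOver k E)).inv ≫ η[G] ▷ projOver k E =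
        lift (toUnit (projOver k E) ≫ η[G]) (𝟙 _) := by
      ext1
      · rw [Category.assoc, whiskerRight_fst, lift_fst, ← Category.assoc]
        congr 1
        exact toUnit_unique _ _
      · rw [Category.assoc, whiskerRight_snd, lift_snd, leftUnitor_inv_snd]
    change η[G] ▷ projOver k E ≫ σ.mor = (λ_ (projOver k E)).hom
    rw [← cancel_epi (λ_ (projOver k E)).inv, ← Category.assoc, h4, h3, Iso.inv_hom_id]
  mul_smul := by
    choose i hi using σ.covers
    let W₀ : (G ⊗ G).left → (G ⊗ G).left.Opens := fun z =>
      (fst G G).left ⁻¹ᵁ (σ.U (i ((fst G G).left z))) ⊓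
      ((snd G G).left ⁻¹ᵁ (σ.U (i ((snd G G).left z))) ⊓
      (μ[G]).left ⁻¹ᵁ (σ.U (i ((μ[G]).left z))))
    choose W hW hz hle using fun z => exists_isAffineOpen_mem (W₀ z) z ⟨hi _, hi _, hi _⟩
    refine charts_hom_ext hW (fun z => ⟨z, hz z⟩) fun z => ?_
    have h₁ : ∀ p, (affPt (hW z) ≫ fst G G).left p ∈ σ.U (i ((fst G G).left z)) :=
      fun p => (hle z (affPt_mem (hW z) p)).1
    have h₂ : ∀ p, (affPt (hW z) ≫ snd G G).left p ∈ σ.U (i ((snd G G).left z)) :=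
      fun p => (hle z (affPt_mem (hW z) p)).2.1
    have h₃ : ∀ p, (affPt (hW z) ≫ μ[G]).left p ∈ σ.U (i ((μ[G]).left z)) :=
      fun p => (hle z (affPt_mem (hW z) p)).2.2
    have h := hmul (W z) (hW z) _ _ _ h₁ h₂ h₃ ⟨z, hz z⟩
    have e1 : chartAt E (affPt (hW z)) ≫ μ[G] ▷ projOver k E =
        chartAt E (affPt (hW z) ≫ μ[G]) := by
      rw [chartAt, lift_whiskerRight, Category.assoc, chartAt]
    have e2 : chartAt E (affPt (hW z)) ≫ (α_ G G (projOver k E)).hom =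
        lift (projBStr k _ E ≫ affPt (hW z) ≫ fst G G) (chartAt E (affPt (hW z) ≫ snd G G)) := by
      ext1
      · rw [lift_fst, Category.assoc, associator_hom_fst, chartAt, lift_fst_assoc, Category.assoc]
      · rw [lift_snd]
        ext1
        · rw [Category.assoc, Category.assoc, associator_hom_snd_fst, chartAt, chartAt, lift_fst,
            lift_fst_assoc, Category.assoc]
        · rw [Category.assoc, Category.assoc, associator_hom_snd_snd, chartAt, chartAt, lift_snd,
            lift_snd]
    change _ ≫ _ ▷ _ ≫ _ = _ ≫ (α_ G G (projOver k E)).hom ≫ _ ◁ _ ≫ _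
    rw [← Category.assoc, e1, σ.chartAt_mor _ _ h₃, projAutOver_eq h, ← projAutOver_comp,
      ← Category.assoc (chartAt _ _), e2, ← Category.assoc (lift _ _), lift_whiskerLeft,
      σ.chartAt_mor _ _ h₂, ← AutSystem.projAutOver_chartAt, Category.assoc,
      Category.assoc, σ.chartAt_mor _ _ h₁]

end System

/-! ### Products of open subsets -/

section Box

variable {k : Type u} [Field k] {S S' Y : Over (Spec (.of k))}

/-- The pullback of functions along a morphism of `k`-schemes, as a homomorphism of
`k`-algebras. -/
def appA (f : S ⟶ S') (U : S'.left.Opens) : Γ(S'.left, U) →ₐ[k] Γ(S.left, f.left ⁻¹ᵁ U) where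
  toRingHom := (f.left.app U).hom
  commutes' c := by
    have h1 : (f.left ≫ S'.hom).appTop = S.hom.appTop := congrArg Scheme.Hom.appTop (Over.w f)
    have h2 := f.left.naturality (homOfLE le_top : U ⟶ ⊤).op
    have h3 := congr($(h2).hom (S'.hom.appTop.hom ((Scheme.ΓSpecIso (.of k)).inv.hom c)))
    refine h3.trans ?_
    exact congr((S.left.presheaf.map (homOfLE le_top).op).hom
      ($(h1).hom ((Scheme.ΓSpecIso (.of k)).inv.hom c)))

/-- The product `U × V` of open subsets. -/
def box (U : S.left.Opens) (V : Y.left.Opens) : (S ⊗ Y).left.Opens :=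
  (fst S Y).left ⁻¹ᵁ U ⊓ (snd S Y).left ⁻¹ᵁ V

/-- The canonical homomorphism `𝒪(U) ⊗ 𝒪(V) → 𝒪(U × V)`. -/
def boxHom (U : S.left.Opens) (V : Y.left.Opens) :
    Γ(S.left, U) ⊗[k] Γ(Y.left, V) →ₐ[k] Γ((S ⊗ Y).left, box U V) :=
  Algebra.TensorProduct.productMap ((resA (S ⊗ Y) inf_le_left).comp (appA (fst S Y) U))
    ((resA (S ⊗ Y) inf_le_right).comp (appA (snd S Y) V))

theorem boxHom_tmul (U : S.left.Opens) (V : Y.left.Opens) (a b) :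
    boxHom U V (a ⊗ₜ b) = resA (S ⊗ Y) inf_le_left (appA (fst S Y) U a) *
      resA (S ⊗ Y) inf_le_right (appA (snd S Y) V b) := rfl

theorem isPullback_fst_snd (S Y : Over (Spec (.of k))) :
    IsPullback (fst S Y).left (snd S Y).left S.hom Y.hom :=
  IsPullback.of_hasPullback S.hom Y.hom

theorem isPushout_box {U : S.left.Opens} {V : Y.left.Opens} (hU : IsAffineOpen U)
    (hV : IsAffineOpen V) :
    IsPushout (CommRingCat.ofHom (algebraMap k Γ(S.left, U)))
      (CommRingCat.ofHom (algebraMap k Γ(Y.left, V)))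
      (CommRingCat.ofHom ((resA (S ⊗ Y) inf_le_left).comp (appA (fst S Y) U)).toRingHom)
      (CommRingCat.ofHom ((resA (S ⊗ Y) inf_le_right).comp (appA (snd S Y) V)).toRingHom :
        _ ⟶ Γ((S ⊗ Y).left, box U V)) := by
  have h := (isIso_pushoutSection_iff (isPullback_fst_snd S Y) (US := ⊤) (UT := V) (UX := U)
    (UY := box U V) le_top le_top rfl).mp (isIso_pushoutSection_of_isAffineOpen _ _ _ _
      (isAffineOpen_top _) hV hU)
  have key : ∀ {Z : Over (Spec (.of k))} (U : Z.left.Opens), Z.hom.appLE ⊤ U le_top =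
      (Scheme.ΓSpecIso (.of k)).hom ≫ CommRingCat.ofHom (algebraMap k Γ(Z.left, U)) := by
    intro Z U
    have : CommRingCat.ofHom (algebraMap k Γ(Z.left, U)) = (Scheme.ΓSpecIso (.of k)).inv ≫
      Z.hom.appTop ≫ Z.left.presheaf.map (homOfLE le_top).op := rfl
    rw [this, Iso.hom_inv_id_assoc]
    rfl
  refine h.of_iso (Scheme.ΓSpecIso (.of k)) (Iso.refl _) (Iso.refl _) (Iso.refl _) ?_ ?_ ?_ ?_
  · rw [Iso.refl_hom, Category.comp_id, key]
  · rw [Iso.refl_hom, Category.comp_id, key]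
  · exact (Category.comp_id _).trans (Category.id_comp _).symm
  · exact (Category.comp_id _).trans (Category.id_comp _).symm

theorem productMap_bijective_of_isPushout {A B C : Type u} [CommRing A] [CommRing B] [CommRing C]
    [Algebra k A] [Algebra k B] [Algebra k C] (f : A →ₐ[k] C) (g : B →ₐ[k] C)
    (h : IsPushout (CommRingCat.ofHom (algebraMap k A)) (CommRingCat.ofHom (algebraMap k B))
      (CommRingCat.ofHom f.toRingHom) (CommRingCat.ofHom g.toRingHom)) :
    Function.Bijective (Algebra.TensorProduct.productMap f g) := by
  have h2 := CommRingCat.isPushout_tensorProduct k A B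
  let e := h2.isoIsPushout _ _ h
  let φ : A ⊗[k] B →+* C := e.hom.hom
  have e1 : ∀ a, φ (a ⊗ₜ 1) = f a := fun a => congr($(h2.inl_isoIsPushout_hom _ _ h).hom a)
  have e2 : ∀ b, φ (1 ⊗ₜ b) = g b := fun b => congr($(h2.inr_isoIsPushout_hom _ _ h).hom b)
  have h1 : ∀ z, Algebra.TensorProduct.productMap f g z = φ z := by
    intro z
    induction z using TensorProduct.induction_on with
    | zero => rw [map_zero, map_zero]
    | add x y hx hy => rw [map_add, map_add, hx, hy]
    | tmul a b =>
      have : (a ⊗ₜ[k] b) = (a ⊗ₜ 1) * (1 ⊗ₜ b) := by simp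
      rw [Algebra.TensorProduct.productMap_apply_tmul, this, map_mul, e1, e2]
  have h3 : Function.Bijective φ := e.commRingCatIsoToRingEquiv.bijective
  exact (funext h1 : ⇑(Algebra.TensorProduct.productMap f g) = φ) ▸ h3

theorem boxHom_bijective {U : S.left.Opens} {V : Y.left.Opens} (hU : IsAffineOpen U)
    (hV : IsAffineOpen V) : Function.Bijective (boxHom U V) :=
  productMap_bijective_of_isPushout _ _ (isPushout_box hU hV)

theorem isAffineOpen_box {U : S.left.Opens} {V : Y.left.Opens} (hU : IsAffineOpen U)
    (hV : IsAffineOpen V) : IsAffineOpen (box U V) := by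
  have h := Scheme.Hom.isPullback_resLE (isPullback_fst_snd S Y) (US := ⊤) (UT := V) (UX := U)
    (UY := box U V) le_top le_top rfl
  have : IsAffine _ := hU
  have : IsAffine _ := hV
  have : IsAffine _ := isAffineOpen_top (Spec (.of k))
  exact .of_isIso h.isoPullback.hom

end Box

/-! ### Integrality of smooth connected group schemes and of products -/

section Reduced

/-- An étale algebra over a domain is reduced, as it embeds in an étale algebra over the fraction
field. -/
theorem isReduced_of_etale {R A : Type*} [CommRing R] [IsDomain R] [CommRing A] [Algebra R A]
    [Algebra.Etale R A] : IsReduced A := by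
  have h1 : Function.Injective (Algebra.TensorProduct.includeRight : A →ₐ[R] FractionRing R ⊗[R] A) := by
    refine Algebra.TensorProduct.includeRight_injective ?_
    exact IsFractionRing.injective R (FractionRing R)
  have : IsReduced (FractionRing R ⊗[R] A) :=
    Algebra.FormallyUnramified.isReduced_of_field (FractionRing R) _
  exact isReduced_of_injective (Algebra.TensorProduct.includeRight : A →ₐ[R] FractionRing R ⊗[R] A) h1

theorem isReduced_of_forall_exists {X : Scheme.{u}}
    (h : ∀ x : X, ∃ U : X.Opens, x ∈ U ∧ IsReduced U.toScheme) : IsReduced X := by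
  choose U hx hU using h
  refine @IsReduced.of_openCover _ (X.openCoverOfIsOpenCover U (by
    rw [TopologicalSpace.IsOpenCover, eq_top_iff]
    exact fun x _ => TopologicalSpace.Opens.mem_iSup.mpr ⟨x, hx x⟩)) hU

/-- A scheme which is smooth over an integral scheme is reduced: locally it is étale over an affine
space. -/
theorem isReduced_of_smooth {X Y : Scheme.{u}} [IsIntegral Y] (f : X ⟶ Y) [Smooth f] :
    IsReduced X := by
  refine isReduced_of_forall_exists fun x => ?_
  obtain ⟨U, hU, V, hV, hx, e, h⟩ := Smooth.exists_isStandardSmooth f x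
  obtain ⟨n, g, -, hg⟩ := h.exists_etale_mvPolynomial
  have : Nonempty U := ⟨⟨f x, e hx⟩⟩
  algebraize [g]
  have : _root_.IsReduced Γ(X, V) := isReduced_of_etale (R := MvPolynomial (Fin n) Γ(Y, U))
  have : IsReduced (Spec Γ(X, V)) := inferInstance
  exact ⟨V, hx, isReduced_of_isOpenImmersion hV.isoSpec.hom⟩

/-- A connected noetherian Jacobson space whose homeomorphisms act transitively on the closed points
is irreducible: some closed point lies on a single irreducible component, hence all of them do, so
that the irreducible components are disjoint. -/
theorem irreducibleSpace_of_homogeneous {X : Type*} [TopologicalSpace X]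
    [TopologicalSpace.NoetherianSpace X] [JacobsonSpace X] [ConnectedSpace X]
    (h : ∀ x y : X, IsClosed {x} → IsClosed {y} → ∃ e : X ≃ₜ X, e x = y) : IrreducibleSpace X := by
  obtain ⟨x₀⟩ : Nonempty X := inferInstance
  have hfin : (irreducibleComponents X).Finite :=
    TopologicalSpace.NoetherianSpace.finite_irreducibleComponents
  have hopen : ∀ Z : Set X, IsOpen (⋃₀ (irreducibleComponents X \ {Z}))ᶜ := fun Z => by
    rw [Set.sUnion_eq_biUnion, isOpen_compl_iff]
    exact hfin.sdiff.isClosed_biUnion fun W hW ↦ isClosed_of_mem_irreducibleComponents W hW.1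
  -- a closed point lying on a single irreducible component
  obtain ⟨x, hx, hxu⟩ : ∃ x : X, IsClosed {x} ∧
      ∀ Z ∈ irreducibleComponents X, ∀ Z' ∈ irreducibleComponents X, x ∈ Z → x ∈ Z' → Z = Z' := by
    have hcl := closure_sUnion_irreducibleComponents_sdiff_singleton hfin
      _ (irreducibleComponent_mem_irreducibleComponents x₀)
    have hne : ((⋃₀ (irreducibleComponents X \ {irreducibleComponent x₀}))ᶜ).Nonempty := by
      rw [← closure_nonempty_iff, hcl]
      exact ⟨x₀, mem_irreducibleComponent⟩
    obtain ⟨x, hx, hxc⟩ := nonempty_inter_closedPoints hne (hopen _).isLocallyClosed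
    have key : ∀ Z ∈ irreducibleComponents X, x ∈ Z → Z = irreducibleComponent x₀ := by
      intro Z hZ hxZ
      by_contra hne
      exact hx ⟨Z, ⟨hZ, hne⟩, hxZ⟩
    exact ⟨x, hxc, fun Z hZ Z' hZ' h h' => (key Z hZ h).trans (key Z' hZ' h').symm⟩
  have hpre : ∀ (e : X ≃ₜ X), ∀ Z ∈ irreducibleComponents X, e ⁻¹' Z ∈ irreducibleComponents X := by
    intro e Z hZ
    refine preimage_mem_irreducibleComponents hZ e.isOpenEmbedding ?_
    rw [e.surjective.range_eq, Set.inter_univ]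
    exact hZ.1.nonempty
  -- Transitivity carries the property of `x` to all closed points, and two distinct components
  -- which meet would have a closed point in common.
  have hdisj : ∀ Z ∈ irreducibleComponents X, ∀ Z' ∈ irreducibleComponents X,
      (Z ∩ Z').Nonempty → Z = Z' := by
    intro Z hZ Z' hZ' hne
    obtain ⟨y, hy, hyc⟩ := nonempty_inter_closedPoints hne
      ((isClosed_of_mem_irreducibleComponents Z hZ).inter
        (isClosed_of_mem_irreducibleComponents Z' hZ')).isLocallyClosed
    obtain ⟨e, he⟩ := h x y hx hyc
    have := hxu _ (hpre e Z hZ) _ (hpre e Z' hZ') (by simpa [he] using hy.1)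
      (by simpa [he] using hy.2)
    exact e.surjective.preimage_injective this
  have huniv : irreducibleComponent x₀ = Set.univ := by
    refine IsClopen.eq_univ ⟨isClosed_irreducibleComponent, ?_⟩ ⟨x₀, mem_irreducibleComponent⟩
    convert hopen (irreducibleComponent x₀) using 1
    ext z
    constructor
    · rintro hz ⟨Z, ⟨hZ, hne⟩, hzZ⟩
      exact hne (hdisj _ hZ _ (irreducibleComponent_mem_irreducibleComponents x₀) ⟨z, hzZ, hz⟩)
    · intro hz
      by_contra hz'
      exact hz ⟨irreducibleComponent z, ⟨irreducibleComponent_mem_irreducibleComponents z,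
        fun h => hz' (h ▸ mem_irreducibleComponent)⟩, mem_irreducibleComponent⟩
  rw [irreducibleSpace_def]
  have h1 : IsIrreducible (irreducibleComponent x₀) := isIrreducible_irreducibleComponent
  rwa [huniv] at h1

end Reduced

section Integral

variable {k : Type u} [Field k] [IsAlgClosed k]

theorem genericPoint_mem {Z : Scheme.{u}} [IrreducibleSpace Z] (U : Z.Opens) [Nonempty U] :
    genericPoint Z ∈ U :=
  ((genericPoint_spec Z).mem_open_set_iff U.isOpen).mpr (by simpa using ‹Nonempty U›)

/-- The product of two integral schemes over an algebraically closed field is integral. -/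
theorem isIntegral_tensor (S Y : Over (Spec (.of k))) [IsIntegral S.left] [IsIntegral Y.left] :
    IsIntegral (S ⊗ Y).left := by
  let I := {p : S.left.affineOpens × Y.left.affineOpens // Nonempty p.1.1 ∧ Nonempty p.2.1}
  let W : I → (S ⊗ Y).left.Opens := fun p => box p.1.1.1 p.1.2.1
  have hdom : ∀ p : I, IsDomain Γ((S ⊗ Y).left, W p) := by
    rintro ⟨⟨⟨U, hU⟩, ⟨V, hV⟩⟩, hU', hV'⟩
    have := isDomain_tensor (k := k) (A := Γ(S.left, U)) (B := Γ(Y.left, V))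
    exact MulEquiv.isDomain _ (RingEquiv.ofBijective (boxHom U V) (boxHom_bijective hU hV)).symm.toMulEquiv
  have hW : ∀ p : I, IsAffineOpen (W p) := fun p => isAffineOpen_box p.1.1.2 p.1.2.2
  have hint : ∀ p : I, IsIntegral (W p).toScheme := by
    intro p
    have h1 : IsIntegral (Spec Γ((S ⊗ Y).left, W p)) := by
      have := hdom p
      infer_instance
    have : Nonempty (W p).toScheme :=
      ⟨(hW p).isoSpec.inv (h1.nonempty.some)⟩
    exact isIntegral_of_isOpenImmersion (hW p).isoSpec.hom
  have hcov : ∀ z : (S ⊗ Y).left, ∃ p, z ∈ W p := by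
    intro z
    obtain ⟨U, hU, hzU, -⟩ := exists_isAffineOpen_mem ⊤ ((fst S Y).left z) trivial
    obtain ⟨V, hV, hzV, -⟩ := exists_isAffineOpen_mem ⊤ ((snd S Y).left z) trivial
    exact ⟨⟨⟨⟨U, hU⟩, ⟨V, hV⟩⟩, ⟨_, hzU⟩, ⟨_, hzV⟩⟩, hzU, hzV⟩
  have hne : ∀ p : I, Nonempty (W p) := fun p => by
    have := hint p
    exact (IsIntegral.nonempty : Nonempty (W p).toScheme)
  have hmeet : ∀ p q : I, ¬ Disjoint (W p) (W q) := by
    rintro ⟨⟨⟨U, hU⟩, ⟨V, hV⟩⟩, hU', hV'⟩ ⟨⟨⟨U₁, hU₁⟩, ⟨V₁, hV₁⟩⟩, hU₁', hV₁'⟩ hd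
    have hx : genericPoint S.left ∈ U ⊓ U₁ :=
      ⟨genericPoint_mem U, genericPoint_mem U₁⟩
    have hy : genericPoint Y.left ∈ V ⊓ V₁ :=
      ⟨genericPoint_mem V, genericPoint_mem V₁⟩
    obtain ⟨U₂, hU₂, hxU₂, hle⟩ := exists_isAffineOpen_mem _ _ hx
    obtain ⟨V₂, hV₂, hyV₂, hle'⟩ := exists_isAffineOpen_mem _ _ hy
    obtain ⟨z, hz⟩ := hne ⟨⟨⟨U₂, hU₂⟩, ⟨V₂, hV₂⟩⟩, ⟨_, hxU₂⟩, ⟨_, hyV₂⟩⟩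
    have := hd (x := box U₂ V₂) (fun z hz => ⟨(hle hz.1).1, (hle' hz.2).1⟩)
      (fun z hz => ⟨(hle hz.1).2, (hle' hz.2).2⟩)
    exact this hz
  have hred : IsReduced (S ⊗ Y).left := by
    have := fun p => hint p
    exact isReduced_of_forall_exists fun z => (hcov z).imp' W fun p hp => ⟨hp, inferInstance⟩
  have hirr : PreirreducibleSpace (S ⊗ Y).left :=
    PreirreducibleSpace.of_isOpenCover (U := W) (fun p q _ => hmeet p q)
      (TopologicalSpace.IsOpenCover.mk (by
        ext z
        simp [hcov])) (fun p => by
        have := hint p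
        exact inferInstanceAs (PreirreducibleSpace (W p).toScheme))
  have hnonempty : Nonempty (S ⊗ Y).left := by
    obtain ⟨U, hU, hzU, -⟩ := exists_isAffineOpen_mem ⊤ (genericPoint S.left) trivial
    obtain ⟨V, hV, hzV, -⟩ := exists_isAffineOpen_mem ⊤ (genericPoint Y.left) trivial
    exact ⟨(hne ⟨⟨⟨U, hU⟩, ⟨V, hV⟩⟩, ⟨_, hzU⟩, ⟨_, hzV⟩⟩).some.1⟩
  have : IrreducibleSpace (S ⊗ Y).left := { toPreirreducibleSpace := hirr, toNonempty := hnonempty }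
  exact isIntegral_of_irreducibleSpace_of_isReduced _

/-- A smooth connected group scheme of finite type over an algebraically closed field is integral,
since translations act transitively on its closed points. -/
theorem isIntegral_of_grpObj (G : Over (Spec (.of k))) [GrpObj G] [Smooth G.hom]
    [ConnectedSpace G.left] [QuasiCompact G.hom] : IsIntegral G.left := by
  have hred : IsReduced G.left := isReduced_of_smooth G.hom
  have hjac := LocallyOfFiniteType.jacobsonSpace G.hom
  have hnoeth : IsNoetherian G.left :=
    { LocallyOfFiniteType.isLocallyNoetherian G.hom with
      toCompactSpace := QuasiCompact.compactSpace_of_compactSpace G.hom }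
  have hirr : IrreducibleSpace G.left := by
    refine irreducibleSpace_of_homogeneous fun x y hx hy => ?_
    let x' : 𝟙_ _ ⟶ G := Over.homMk _ ((pointEquivClosedPoint G.hom).symm ⟨x, hx⟩).2
    let y' : 𝟙_ _ ⟶ G := Over.homMk _ ((pointEquivClosedPoint G.hom).symm ⟨y, hy⟩).2
    -- the right translation which moves `x` to `y`
    let α := (GrpObj.mulRight (A := G) x').symm ≪≫ (GrpObj.mulRight (A := G) y')
    have hα : x' ≫ α.hom = y' := by
      dsimp only [Iso.trans_hom, Iso.symm_hom, α]
      rw [← Category.assoc, ← Iso.eq_comp_inv]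
      simp [comp_lift_assoc]
    have hα' : α.hom.left x = y := by
      have := congr(($hα).left (IsLocalRing.closedPoint k))
      refine Eq.trans ?_ (this.trans (pointOfClosedPoint_apply G.hom y hy _))
      exact (congrArg α.hom.left (pointOfClosedPoint_apply G.hom x hx _)).symm
    exact ⟨((Over.forget _).mapIso α).hom.homeomorph, hα'⟩
  exact isIntegral_of_irreducibleSpace_of_isReduced _

end Integral

/-! ### Values of sections at points -/

section Val

variable {k : Type u} [Field k] {S S' : Over (Spec (.of k))} {M N : S.left.Modules}
  {K : Type u} [CommRing K] [Algebra k K] {B : Type u} [CommRing B] [Algebra k B]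

/-- The point `y` with values in a `k`-algebra lies in the open subset `U`. -/
abbrev LiesIn (y : specOver k K ⟶ S) (U : S.left.Opens) : Prop := ∀ p, y.left p ∈ U

theorem LiesIn.inf {y : specOver k K ⟶ S} {U V : S.left.Opens} (h : LiesIn y U) (h' : LiesIn y V) :
    LiesIn y (U ⊓ V) := fun p => ⟨h p, h' p⟩

/-- The value at the point `y` of the coordinate of the section `m` with respect to the frame
`s`. -/
def val {V W : S.left.Opens} {s : Γ(M, V)} (hs : IsFrameOn M s) (y : specOver k K ⟶ S)
    (hV : LiesIn y V) (hW : LiesIn y W) (m : Γ(M, W)) : K :=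
  ev y (V ⊓ W) (hV.inf hW) (hs.coord inf_le_left (resM M inf_le_right m))

variable {V V' W W' : S.left.Opens} {s : Γ(M, V)} (hs : IsFrameOn M s) {s' : Γ(M, V')}
  (hs' : IsFrameOn M s') (y : specOver k K ⟶ S)
  (hV : LiesIn y V) (hV' : LiesIn y V') (hW : LiesIn y W)

theorem val_eq (hW' : LiesIn y W') (h : W' ≤ V) (h' : W' ≤ W) (m : Γ(M, W)) :
    val hs y hV hW m = ev y W' hW' (hs.coord h (resM M h' m)) := by
  rw [val, ← ev_res y (le_inf h h') hW', ← hs.coord_res, resM_resM]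

theorem val_res (hW' : LiesIn y W') (h : W' ≤ W) (m : Γ(M, W)) :
    val hs y hV hW' (resM M h m) = val hs y hV hW m := by
  rw [val, val_eq hs y hV hW (hV.inf hW') inf_le_left (inf_le_right.trans h), resM_resM]

theorem val_add (m m' : Γ(M, W)) :
    val hs y hV hW (m + m') = val hs y hV hW m + val hs y hV hW m' := by
  rw [val, resM_add, map_add, map_add]; rfl

theorem val_smul (r : Γ(S.left, W)) (m : Γ(M, W)) :
    val hs y hV hW (r • m) = ev y W hW r * val hs y hV hW m := by
  rw [val, resM_smul, LinearEquiv.map_smul, smul_eq_mul, map_mul, ev_res]; rfl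

theorem val_self : val hs y hV hV s = 1 := by
  rw [val, hs.coord_eq (r := 1) _ (one_smul _ _), map_one]

/-- The change of frames: values with respect to two frames differ by the value of one frame with
respect to the other. -/
theorem val_trans (m : Γ(M, W)) :
    val hs' y hV' hW m = val hs y hV hW m * val hs' y hV' hV s := by
  have h := (hV.inf hW).inf hV'
  have h1 : V ⊓ W ⊓ V' ≤ V := inf_le_left.trans inf_le_left
  have h2 : V ⊓ W ⊓ V' ≤ W := inf_le_left.trans inf_le_right
  rw [val_eq hs y hV hW h h1 h2, ← val_res hs' y hV' hV h h1, ← val_smul, hs.coord_smul, val_res]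

theorem val_mul_val : val hs y hV hV' s' * val hs' y hV' hV s = 1 := by
  rw [← val_trans, val_self]

theorem val_map (φ : M ≅ N) (m : Γ(M, W)) :
    val (hs.map_iso φ) y hV hW (φ.hom.app W m) = val hs y hV hW m := by
  rw [val, ← app_resM, (hs.map_iso φ).coord_eq (r := hs.coord inf_le_left (resM M inf_le_right m))]
  · rfl
  · rw [← app_resM, ← Scheme.Modules.Hom.app_smul, hs.coord_smul]

theorem val_tens {t : Γ(N, V)} (ht : IsFrameOn N t) (m : Γ(M, W)) (n : Γ(N, W)) :
    val (hs.tens ht) y hV hW (tens m n) = val hs y hV hW m * val ht y hV hW n := by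
  rw [val, resM_tens, (hs.tens ht).coord_eq
    (r := hs.coord inf_le_left (resM M inf_le_right m) * ht.coord inf_le_left
      (resM N inf_le_right n)), map_mul]
  · rfl
  · rw [resM_tens, mul_smul, ← tens_smul, ht.coord_smul, ← smul_tens, hs.coord_smul]

theorem val_pb (f : S' ⟶ S) (y : specOver k K ⟶ S') (hV : LiesIn (y ≫ f) V)
    (hW : LiesIn (y ≫ f) W) (m : Γ(M, W)) :
    val (S := S') (hs.pb f.left) y (V := f.left ⁻¹ᵁ V) (W := f.left ⁻¹ᵁ W) hV hW
      (pb f.left M W m) = val hs (y ≫ f) hV hW m := by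
  have h1 := (hs.pb f.left).coord_eq (W := f.left ⁻¹ᵁ (V ⊓ W)) (f.left.preimage_mono inf_le_left)
    (m := resM _ (f.left.preimage_mono inf_le_right) (pb f.left M W m))
    (r := f.left.app (V ⊓ W) (hs.coord inf_le_left (resM M inf_le_right m))) (by
      rw [← pb_res _ _ inf_le_left, ← pb_res, ← pb_smul, hs.coord_smul])
  rw [val_eq (S := S') (hs.pb f.left) y (V := f.left ⁻¹ᵁ V) (W := f.left ⁻¹ᵁ W) hV hW
    (W' := f.left ⁻¹ᵁ (V ⊓ W)) (hV.inf hW) (f.left.preimage_mono inf_le_left)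
    (f.left.preimage_mono inf_le_right), h1, val, ev_comp]

theorem val_frame_res (h : V' ≤ V) (m : Γ(M, W)) :
    val (hs.res h) y hV' hW m = val hs y hV hW m := by
  rw [val_trans hs (hs.res h) y hV hV' hW m, ← val_res (hs.res h) y hV' hV hV' h, val_self,
    _root_.mul_one]

theorem val_specMap (φ : K →ₐ[k] B) (hV : LiesIn y V) (hW : LiesIn y W) (m : Γ(M, W))
    (hV' : LiesIn (specMap φ ≫ y) V) (hW' : LiesIn (specMap φ ≫ y) W) :
    val hs (specMap φ ≫ y) hV' hW' m = φ (val hs y hV hW m) := by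
  rw [val, ev_specMap y _ (hV.inf hW)]; rfl

end Val

/-! ### Values of global sections -/

section AffineFrames

variable {k : Type u} [Field k]

/-- A nonempty affine open subset `V` of `X` with a frame of `L` over it. -/
structure AffineFrame (X : Over (Spec (.of k))) (L : X.left.Modules) where
  V : X.left.Opens
  isAffineOpen : IsAffineOpen V
  nonempty : ∃ x, x ∈ V
  s : Γ(L, V)
  isFrame : IsFrameOn L s

variable {X : Over (Spec (.of k))} {L : X.left.Modules}
  {K : Type u} [CommRing K] [Algebra k K]

/-- The values at a point `y` of the global sections of `L`, with respect to a frame. -/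
def AffineFrame.valE (i : AffineFrame X L) (y : specOver k K ⟶ X) (hy : LiesIn y i.V) :
    H0 X L →ₗ[k] K where
  toFun e := val (W := ⊤) i.isFrame y hy (fun _ => trivial) e
  map_add' e e' := val_add _ _ _ _ e e'
  map_smul' c e := by
    refine (val_smul i.isFrame y hy _ (algebraMap k Γ(X.left, ⊤) c) e).trans ?_
    rw [AlgHom.commutes, Algebra.smul_def]; rfl

/-- The coordinates of global sections with respect to a frame. -/
def AffineFrame.coordE (i : AffineFrame X L) : H0 X L →ₗ[k] Γ(X.left, i.V) where
  toFun e := i.isFrame.coord le_rfl (resM L le_top e)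
  map_add' e e' := (congrArg (i.isFrame.coord le_rfl) (resM_add L le_top e e')).trans (map_add _ _ _)
  map_smul' c e := by
    refine (congrArg (i.isFrame.coord le_rfl)
      (resM_smul L le_top (algebraMap k Γ(X.left, ⊤) c) e)).trans ?_
    rw [LinearEquiv.map_smul]
    have : resO X.left (le_top : i.V ≤ ⊤) (algebraMap k Γ(X.left, ⊤) c) =
      algebraMap k Γ(X.left, i.V) c := res_algebraMap le_top c
    rw [this, RingHom.id_apply, smul_eq_mul]
    exact (Algebra.smul_def _ _).symm

theorem AffineFrame.ev_coordE (i : AffineFrame X L) (y : specOver k K ⟶ X) (hy : LiesIn y i.V)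
    (e : H0 X L) : ev y i.V hy (i.coordE e) = i.valE y hy e :=
  (val_eq i.isFrame y hy (W := ⊤) (fun _ => trivial) hy le_rfl le_top e).symm

theorem AffineFrame.valE_eq (i j : AffineFrame X L) (y : specOver k K ⟶ X) (hi : LiesIn y i.V)
    (hj : LiesIn y j.V) : j.valE y hj = val j.isFrame y hj hi i.s • i.valE y hi := by
  ext e
  exact (val_trans i.isFrame j.isFrame y hi hj (W := ⊤) (fun _ => trivial) e).trans (mul_comm _ _)

/-- A point of `X` with values in a field lies in the domain of some frame. -/
theorem exists_affineFrame (hL : IsInvertible L) {K : Type u} [Field K] [Algebra k K]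
    (y : specOver k K ⟶ X) : ∃ i : AffineFrame X L, LiesIn y i.V := by
  have : Unique (PrimeSpectrum K) := inferInstance
  let p : (specOver k K).left := (default : PrimeSpectrum K)
  obtain ⟨V, s, hx, -, hV, hs⟩ := hL.exists_frame (y.left p) ⊤ trivial
  refine ⟨⟨V, hV, ⟨_, hx⟩, s, hs⟩, fun q => ?_⟩
  have : q = p := Subsingleton.elim (α := PrimeSpectrum K) q p
  rwa [this]

end AffineFrames

/-! ### The generic point of an integral scheme -/

section GenericPoint

variable {k : Type u} [Field k]

/-- `y` is a generic point of `X`: it lies in every nonempty open subset, and functions are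
determined by their values at `y`. -/
def IsGenericPt {X : Over (Spec (.of k))} {K : Type u} [CommRing K] [Algebra k K]
    (y : specOver k K ⟶ X) : Prop :=
  ∀ V : X.left.Opens, (∃ x, x ∈ V) → ∃ h : LiesIn y V, Function.Injective (ev y V h)

theorem evC_fromSpecStalk {Z : Scheme.{u}} {x : Z} (V : Z.Opens) (hx : x ∈ V)
    (h : ⊤ ≤ Z.fromSpecStalk x ⁻¹ᵁ V) : evC (Z.fromSpecStalk x) V h = Z.presheaf.germ V x hx := by
  have h1 := Scheme.fromSpecStalk_app hx
  rw [evC, Scheme.Hom.appLE, h1]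
  simp only [Category.assoc, ← Functor.map_comp_assoc]
  have : ∀ f : (Opposite.op ⊤ : (Spec (Z.presheaf.stalk x)).Opensᵒᵖ) ⟶ Opposite.op ⊤, f = 𝟙 _ :=
    fun f => Subsingleton.elim _ _
  rw [this (_ ≫ _), CategoryTheory.Functor.map_id, Category.id_comp, Iso.inv_hom_id,
    Category.comp_id]

theorem exists_isGenericPt (X : Over (Spec (.of k))) [IsIntegral X.left] :
    ∃ (F : Type u) (_ : Field F) (_ : Algebra k F) (y : specOver k F ⟶ X), IsGenericPt y := by
  let F := X.left.functionField
  let f : CommRingCat.of k ⟶ .of F := Spec.preimage (X.left.fromSpecStalk (genericPoint X.left) ≫ X.hom)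
  letI : Algebra k F := f.hom.toAlgebra
  let y : specOver k F ⟶ X := Over.homMk (X.left.fromSpecStalk (genericPoint X.left)) (by
    exact (Spec.map_preimage _).symm)
  refine ⟨F, inferInstance, inferInstance, y, fun V hV => ?_⟩
  have : Nonempty V := hV.elim fun x hx => ⟨⟨x, hx⟩⟩
  have hmem : LiesIn y V := by
    intro p
    have h1 : y.left p ∈ Set.range (X.left.fromSpecStalk (genericPoint X.left)) := ⟨p, rfl⟩
    rw [Scheme.range_fromSpecStalk] at h1
    exact Specializes.mem_open h1 V.isOpen (genericPoint_mem V)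
  have h1 : evC (X.left.fromSpecStalk (genericPoint X.left)) V (fun p _ => hmem p) =
      X.left.presheaf.germ V _ (genericPoint_mem V) := evC_fromSpecStalk _ _ _
  refine ⟨hmem, ?_⟩
  have h2 := Scheme.germToFunctionField_injective X.left V
  intro a b hab
  refine h2 ?_
  exact (congr($(h1).hom a)).symm.trans (hab.trans (congr($(h1).hom b)))

end GenericPoint

section Gluing

variable {X : Scheme.{u}} (L : X.Modules)

/-- Sections of a sheaf of modules which agree on overlaps glue. -/
theorem exists_glue_sections {I : Type*} (U : I → X.Opens) (hU : ∀ x, ∃ i, x ∈ U i)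
    (m : ∀ i, Γ(L, U i))
    (h : ∀ i j, resM L (inf_le_left : U i ⊓ U j ≤ U i) (m i) = resM L inf_le_right (m j)) :
    ∃ e : Γ(L, ⊤), ∀ i, resM L le_top e = m i := by
  obtain ⟨e, he, -⟩ := TopCat.Sheaf.existsUnique_gluing' ⟨L.presheaf, L.isSheaf⟩ U ⊤
    (fun i => homOfLE le_top) (fun x _ => TopologicalSpace.Opens.mem_iSup.mpr (hU x)) m
    (fun i j => h i j)
  exact ⟨e, he⟩

theorem section_ext {I : Type*} (U : I → X.Opens) (hU : ∀ x, ∃ i, x ∈ U i)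
    {e e' : Γ(L, ⊤)} (h : ∀ i, resM L (le_top : U i ≤ ⊤) e = resM L le_top e') : e = e' :=
  TopCat.Sheaf.eq_of_locally_eq' ⟨L.presheaf, L.isSheaf⟩ U ⊤
    (fun i => homOfLE le_top) (fun x _ => TopologicalSpace.Opens.mem_iSup.mpr (hU x)) e e' h

end Gluing

section GenericValue

variable {k : Type u} [Field k] {X : Over (Spec (.of k))} {L : X.left.Modules}
  {F : Type u} [Field F] [Algebra k F] {y : specOver k F ⟶ X}

theorem IsGenericPt.liesIn (hy : IsGenericPt y) (i : AffineFrame X L) : LiesIn y i.V :=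
  (hy _ i.nonempty).1

theorem exists_mem_of_liesIn {S : Over (Spec (.of k))} {K : Type u} [Field K] [Algebra k K]
    {y : specOver k K ⟶ S} {U : S.left.Opens} (h : LiesIn y U) : ∃ x, x ∈ U :=
  ⟨_, h (default : PrimeSpectrum K)⟩

/-- A section over an open subset of the domain of a frame is determined by its generic value. -/
theorem IsGenericPt.val_injective (hy : IsGenericPt y) (i j : AffineFrame X L)
    {W : X.left.Opens} (hW : LiesIn y W) (h : W ≤ j.V) {m m' : Γ(L, W)}
    (hm : val i.isFrame y (hy.liesIn i) hW m = val i.isFrame y (hy.liesIn i) hW m') : m = m' := by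
  rw [val_trans j.isFrame i.isFrame y (hy.liesIn j) (hy.liesIn i) hW m,
    val_trans j.isFrame i.isFrame y (hy.liesIn j) (hy.liesIn i) hW m'] at hm
  have h0 := right_ne_zero_of_mul_eq_one
    (val_mul_val i.isFrame j.isFrame y (hy.liesIn i) (hy.liesIn j))
  have h0' := left_ne_zero_of_mul_eq_one
    (val_mul_val i.isFrame j.isFrame y (hy.liesIn i) (hy.liesIn j))
  replace hm := mul_right_cancel₀ (by assumption) hm
  rw [val_eq j.isFrame y (hy.liesIn j) hW hW h le_rfl,
    val_eq j.isFrame y (hy.liesIn j) hW hW h le_rfl, resM_self, resM_self] at hm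
  exact (j.isFrame.coord h).injective ((hy W (exists_mem_of_liesIn hW)).2 hm)

theorem exists_mem_affineFrame (hL : IsInvertible L) (x : X.left) :
    ∃ i : AffineFrame X L, x ∈ i.V := by
  obtain ⟨V, s, hx, -, hV, hs⟩ := hL.exists_frame x ⊤ trivial
  exact ⟨⟨V, hV, ⟨x, hx⟩, s, hs⟩, hx⟩

/-- A global section is determined by its generic value. -/
theorem IsGenericPt.valE_injective (hy : IsGenericPt y) (hL : IsInvertible L)
    (i : AffineFrame X L) : Function.Injective (i.valE y (hy.liesIn i)) := by
  intro e e' h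
  refine section_ext L (fun j : AffineFrame X L => j.V) (exists_mem_affineFrame hL) fun j => ?_
  refine hy.val_injective i j (hy.liesIn j) le_rfl ?_
  exact (val_res (W := ⊤) i.isFrame y (hy.liesIn i) (fun _ => trivial) (hy.liesIn j) le_top e).trans
    (h.trans (val_res (W := ⊤) i.isFrame y (hy.liesIn i) (fun _ => trivial) (hy.liesIn j)
      le_top e').symm)

/-- The `k`-linear map which sends a function `r` on the domain of the frame `s` to the generic
value of the section `r s`. -/
def IsGenericPt.valMul (hy : IsGenericPt y) (i j : AffineFrame X L) : Γ(X.left, j.V) →ₗ[k] F :=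
  LinearMap.mulRight k (val i.isFrame y (hy.liesIn i) (hy.liesIn j) j.s) ∘ₗ
    (ev y j.V (hy.liesIn j)).toLinearMap

theorem IsGenericPt.valMul_apply (hy : IsGenericPt y) (i j : AffineFrame X L) (r) :
    hy.valMul i j r = val i.isFrame y (hy.liesIn i) (hy.liesIn j) (r • j.s) :=
  (val_smul _ _ _ _ _ _).symm

theorem IsGenericPt.valMul_injective (hy : IsGenericPt y) (i j : AffineFrame X L) :
    Function.Injective (hy.valMul i j) := by
  intro r r' h
  rw [valMul_apply, valMul_apply] at h
  have := hy.val_injective i j (hy.liesIn j) le_rfl h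
  have h2 := (j.isFrame j.V le_rfl).1 (a₁ := r) (a₂ := r')
  simp only [resM_self] at h2
  exact h2 this

theorem IsGenericPt.valMul_comp_coordE (hy : IsGenericPt y) (i j : AffineFrame X L) :
    hy.valMul i j ∘ₗ j.coordE = i.valE y (hy.liesIn i) := by
  ext e
  rw [LinearMap.comp_apply, valMul_apply]
  have h1 : j.coordE e • j.s = resM L le_top e := by
    have := j.isFrame.coord_smul le_rfl (resM L le_top e)
    rwa [resM_self] at this
  rw [h1]
  exact val_res (W := ⊤) i.isFrame y (hy.liesIn i) (fun _ => trivial) (hy.liesIn j) le_top e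

/-- An element of the function field which is locally the generic value of a section is the
generic value of a global section. -/
theorem IsGenericPt.iInf_range_le (hy : IsGenericPt y) (hL : IsInvertible L)
    (i : AffineFrame X L) : ⨅ j, LinearMap.range (hy.valMul i j) ≤
      LinearMap.range (i.valE y (hy.liesIn i)) := by
  intro f hf
  rw [Submodule.mem_iInf] at hf
  choose r hr using hf
  obtain ⟨e, he⟩ := exists_glue_sections L (fun j : AffineFrame X L => j.V)
    (exists_mem_affineFrame hL) (fun j => r j • j.s) (fun j l => by
      refine hy.val_injective i j ((hy.liesIn j).inf (hy.liesIn l)) inf_le_left ?_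
      rw [val_res _ _ _ (hy.liesIn j), val_res _ _ _ (hy.liesIn l), ← hy.valMul_apply,
        ← hy.valMul_apply, hr, hr])
  refine ⟨e, ?_⟩
  rw [← hr i, hy.valMul_apply, ← he i, val_res (W := ⊤) i.isFrame y _ (fun _ => trivial)]
  rfl

end GenericValue

/-! ### Sections over a product -/

section Tensor

variable {k : Type u} [Field k] {S X : Over (Spec (.of k))} {L : X.left.Modules}
  {K : Type u} [CommRing K] [Algebra k K]

theorem ev_congr {g g' : specOver k K ⟶ S} (e : g = g') {U : S.left.Opens} (h : LiesIn g U)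
    (h' : LiesIn g' U) : ev g U h = ev g' U h' := by
  subst e; rfl

theorem liesIn_lift {g : specOver k K ⟶ S} {x : specOver k K ⟶ X} {U : S.left.Opens}
    {V : X.left.Opens} (hg : LiesIn g U) (hx : LiesIn x V) : LiesIn (lift g x) (box U V) := by
  have h1 : LiesIn (lift g x ≫ fst S X) U := by rwa [lift_fst]
  have h2 : LiesIn (lift g x ≫ snd S X) V := by rwa [lift_snd]
  exact fun p => ⟨h1 p, h2 p⟩

/-- The value of `a ⊗ b` at the point `(g, x)` is the product of the values of `a` at `g` and of `b`
at `x`. -/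
theorem ev_boxHom (g : specOver k K ⟶ S) (x : specOver k K ⟶ X) {U : S.left.Opens}
    {V : X.left.Opens} (hg : LiesIn g U) (hx : LiesIn x V) (z : Γ(S.left, U) ⊗[k] Γ(X.left, V)) :
    ev (lift g x) (box U V) (liesIn_lift hg hx) (boxHom U V z) =
      evt (ev g U hg) (ev x V hx).toLinearMap z := by
  induction z using TensorProduct.induction_on with
  | zero => rw [map_zero, map_zero, map_zero]
  | add z z' h h' => rw [map_add, map_add, map_add, h, h']
  | tmul a b =>
    refine (congrArg (ev (lift g x) (box U V) _) (boxHom_tmul ..)).trans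
      ((map_mul (ev (lift g x) (box U V) _) _ _).trans ?_)
    rw [evt_tmul]
    have h1 : LiesIn (lift g x ≫ fst S X) U := by rwa [lift_fst]
    have h2 : LiesIn (lift g x ≫ snd S X) V := by rwa [lift_snd]
    congr 1
    · refine (ev_res (lift g x) inf_le_left (liesIn_lift hg hx) _).trans ?_
      refine (ev_comp (lift g x) (fst S X) U h1 a).symm.trans ?_
      rw [ev_congr (lift_fst g x) h1 hg]
    · refine (ev_res (lift g x) inf_le_right (liesIn_lift hg hx) _).trans ?_
      refine (ev_comp (lift g x) (snd S X) V h2 b).symm.trans ?_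
      rw [ev_congr (lift_snd g x) h2 hx]
      rfl

theorem evt_lTensor {A E E' : Type*} [CommRing A] [Algebra k A] [AddCommGroup E] [Module k E]
    [AddCommGroup E'] [Module k E'] (β : A →ₐ[k] K) (q : E' →ₗ[k] K) (f : E →ₗ[k] E')
    (z : A ⊗[k] E) : evt β q (f.lTensor A z) = evt β (q ∘ₗ f) z := by
  induction z using TensorProduct.induction_on with
  | zero => simp
  | add x y hx hy => simp [hx, hy]
  | tmul a e => rw [LinearMap.lTensor_tmul, evt_tmul, evt_tmul]; rfl

variable [IsAlgClosed k]

/-- Let `M` be an invertible sheaf on `S × X` which over `U × X` is a twist of `L`, in the sense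
that it has frames `b` over the sets `U × V` which transform like the frames `s` of `L` over `V`.
Then a section of `M` over `U × X` comes from an element of `𝒪(U) ⊗ H⁰(X, L)`. -/
theorem exists_tensor_of_frames [IsIntegral S.left] [IsIntegral X.left] (hL : IsInvertible L)
    {U : S.left.Opens} (hU : IsAffineOpen U) (hne : ∃ g, g ∈ U) (M : (S ⊗ X).left.Modules)
    {D : (S ⊗ X).left.Opens} (hD : ∀ i : AffineFrame X L, box U i.V ≤ D) (m : Γ(M, D))
    (b : ∀ i : AffineFrame X L, Γ(M, box U i.V)) (hb : ∀ i, IsFrameOn M (b i))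
    (hrel : ∀ (i j : AffineFrame X L) {K : Type u} [Field K] [Algebra k K]
      (g : specOver k K ⟶ S) (x : specOver k K ⟶ X) (hg : LiesIn g U) (hi : LiesIn x i.V)
      (hj : LiesIn x j.V), val (hb j) (lift g x) (liesIn_lift hg hj) (liesIn_lift hg hi) (b i) =
        val j.isFrame x hj hi i.s) :
    ∃ t : Γ(S.left, U) ⊗[k] H0 X L, ∀ (i : AffineFrame X L) {K : Type u} [CommRing K] [Algebra k K]
      (g : specOver k K ⟶ S) (x : specOver k K ⟶ X) (hg : LiesIn g U) (hx : LiesIn x i.V),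
      evt (ev g U hg) (i.valE x hx) t = val (hb i) (lift g x) (liesIn_lift hg hx)
        (fun p => hD i (liesIn_lift hg hx p)) m := by
  obtain ⟨F, _, _, y, hy⟩ := exists_isGenericPt X
  obtain ⟨i₀, hi₀⟩ := exists_affineFrame hL y
  have : Nonempty U := hne.elim fun x hx => ⟨⟨x, hx⟩⟩
  let A := Γ(S.left, U)
  -- `z i` in `𝒪(U) ⊗ 𝒪(V_i)` is the coordinate of `m` over `U × V_i` with respect to the frame
  -- `b i`.
  let c (i : AffineFrame X L) := (hb i).coord le_rfl (resM M (hD i) m)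
  have hbox (i : AffineFrame X L) : Function.Bijective (boxHom U i.V) :=
    boxHom_bijective hU i.isAffineOpen
  choose z hz using fun i => (hbox i).2 (c i)
  -- the generic point of `U × X`
  let K := GenField k A F
  let g : specOver k K ⟶ S := specMap (genLeft k A F) ≫ affPt hU
  have hg : LiesIn g U := fun p => affPt_mem hU _
  have hevg : ev g U hg = genLeft k A F := by
    rw [ev_specMap _ _ (affPt_mem hU), ev_affPt]; rfl
  let x : specOver k K ⟶ X := specMap (genRight k A F) ≫ y
  have hx (i : AffineFrame X L) : LiesIn x i.V := fun p => hy.liesIn i _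
  have hval (i : AffineFrame X L) {K : Type u} [CommRing K] [Algebra k K]
      (g : specOver k K ⟶ S) (x : specOver k K ⟶ X) (hg : LiesIn g U) (hx : LiesIn x i.V) :
      evt (ev g U hg) (ev x i.V hx).toLinearMap (z i) = val (hb i) (lift g x) (liesIn_lift hg hx)
        (fun p => hD i (liesIn_lift hg hx p)) m := by
    rw [← ev_boxHom g x hg hx, hz,
      val_eq (hb i) _ _ _ (liesIn_lift hg hx) le_rfl (hD i)]
  -- The sections described by the `z i` have the same generic value for all `i`.
  have hω (i : AffineFrame X L) : algebraMap (A ⊗[k] F) K ((hy.valMul i₀ i).lTensor A (z i)) =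
      val (hb i₀) (lift g x) (liesIn_lift hg (hx i₀))
        (fun p => hD i₀ (liesIn_lift hg (hx i₀) p)) m := by
    rw [← evt_gen, val_trans (hb i) (hb i₀) _ (liesIn_lift hg (hx i)) _ _ m,
      hrel i i₀ g x hg (hx i) (hx i₀), ← hval i g x hg (hx i), hevg, mul_comm,
      val_specMap i₀.isFrame y (genRight k A F) (hy.liesIn i₀) (hy.liesIn i) i.s, ← evt_smul_right]
    have hq : genRight k A F (val i₀.isFrame y (hy.liesIn i₀) (hy.liesIn i) i.s) •
        (ev x i.V (hx i)).toLinearMap = (genRight k A F).toLinearMap ∘ₗ hy.valMul i₀ i := by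
      ext r
      change _ * ev x i.V (hx i) r = genRight k A F (ev y i.V (hy.liesIn i) r * _)
      rw [ev_specMap y _ (hy.liesIn i), map_mul, mul_comm]; rfl
    rw [hq]
  have hinj := IsFractionRing.injective (A ⊗[k] F) K
  -- The common generic value lies in `𝒪(U) ⊗ P i` for all `i`, where `P i` is the space of generic
  -- values of sections over `V_i`, and the intersection of the `P i` is `H⁰(X, L)`.
  obtain ⟨t, ht⟩ := mem_range_lTensor (A := A) (fun i => LinearMap.range (hy.valMul i₀ i))
    (i₀.valE y (hy.liesIn i₀)) (hy.iInf_range_le hL i₀) ((hy.valMul i₀ i₀).lTensor A (z i₀))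
    (fun i => by
      rw [hinj ((hω i₀).trans (hω i).symm)]
      refine ⟨(hy.valMul i₀ i).rangeRestrict.lTensor A (z i), ?_⟩
      rw [← LinearMap.comp_apply, ← LinearMap.lTensor_comp]
      rfl)
  have hcoord (i : AffineFrame X L) : i.coordE.lTensor A t = z i := by
    apply Module.Flat.lTensor_preserves_injective_linearMap (M := A) (hy.valMul i₀ i)
      (hy.valMul_injective i₀ i)
    rw [← LinearMap.comp_apply, ← LinearMap.lTensor_comp, hy.valMul_comp_coordE, ht]
    exact hinj ((hω i₀).trans (hω i).symm)
  refine ⟨t, fun i K _ _ g x hg hx => ?_⟩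
  have hq : i.valE x hx = (ev x i.V hx).toLinearMap ∘ₗ i.coordE :=
    LinearMap.ext fun e => (i.ev_coordE x hx e).symm
  rw [← hval i g x hg hx, ← hcoord, evt_lTensor, hq]

end Tensor

/-! ### Actions on points -/

section Points

variable {k : Type u} [Field k] {G X Z : Over (Spec (.of k))} [GrpObj G] [ModObj G X]

variable (G X) in
/-- The automorphism `(g, y) ↦ (g, g⁻¹ y)` of `G × X`. -/
def invSmul : G ⊗ X ⟶ G ⊗ X := lift (fst G X) ((fst G X)⁻¹ • snd G X)

theorem lift_invSmul (g : Z ⟶ G) (y : Z ⟶ X) : lift g y ≫ invSmul G X = lift g (g⁻¹ • y) := by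
  rw [invSmul, comp_lift, ModObj.comp_smul, GrpObj.comp_inv, lift_fst, lift_snd]

theorem invSmul_smul : invSmul G X ≫ γ[G, X] = snd G X := smul_inv_smul (fst G X) (snd G X)

end Points

/-! ### Families of sections over a product -/

section LinearMaps

section

/-- A map `t : E → A ⊗ E` which is linear after an injective linear map `θ` extends to an `A`-linear
endomorphism of `A ⊗ E`. -/
theorem exists_linearMap_of_injective {k A E K : Type*} [Field k] [CommRing A] [Algebra k A]
    [AddCommGroup E] [Module k E] [AddCommGroup K] [Module k K] {t : E → A ⊗[k] E}
    {θ : A ⊗[k] E →ₗ[k] K} (hθ : Function.Injective θ) {f : E →ₗ[k] K}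
    (h : ∀ e, θ (t e) = f e) : ∃ T : A ⊗[k] E →ₗ[A] A ⊗[k] E, ∀ e, T (1 ⊗ₜ e) = t e := by
  refine ⟨LinearMap.liftBaseChange A
    { toFun := t
      map_add' e e' := hθ (by rw [map_add, h, h, h, map_add])
      map_smul' c e := hθ (by rw [LinearMap.map_smul, h, h, LinearMap.map_smul]; rfl) },
    fun e => ?_⟩
  rw [LinearMap.liftBaseChange_tmul, one_smul]
  rfl

variable {k : Type u} [Field k] [IsAlgClosed k] {S X : Over (Spec (.of k))} {L : X.left.Modules}
  {B : Type u} [CommRing B] [IsDomain B] [Algebra k B] {F : Type u} [Field F] [Algebra k F]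

theorem AffineFrame.valE_specMap {K : Type u} [CommRing K] [Algebra k K] {K' : Type u}
    [CommRing K'] [Algebra k K'] (i : AffineFrame X L) (φ : K →ₐ[k] K') {y : specOver k K ⟶ X}
    (hi : LiesIn y i.V) (hi' : LiesIn (specMap φ ≫ y) i.V) :
    i.valE (specMap φ ≫ y) hi' = φ.toLinearMap ∘ₗ i.valE y hi :=
  LinearMap.ext fun e => val_specMap (W := ⊤) i.isFrame y φ hi (fun _ => trivial) e hi'
    (fun _ => trivial)

theorem evt_generic (g : specOver k B ⟶ S) (y : specOver k F ⟶ X) {U : S.left.Opens}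
    (hg : LiesIn g U) (i : AffineFrame X L) (hi : LiesIn y i.V)
    (hg' : LiesIn (specMap (genLeft k B F) ≫ g) U)
    (hi' : LiesIn (specMap (genRight k B F) ≫ y) i.V) (z : Γ(S.left, U) ⊗[k] H0 X L) :
    evt (ev (specMap (genLeft k B F) ≫ g) U hg') (i.valE (specMap (genRight k B F) ≫ y) hi') z =
      evt (genLeft k B F) ((genRight k B F).toLinearMap ∘ₗ i.valE y hi)
        (tw _ (ev g U hg) z) := by
  rw [evt_tw, ← ev_specMap g U hg _ hg', ← i.valE_specMap]

/-- Elements of `𝒪(U) ⊗ H⁰(X, L)` are determined by their values at the generic point of `U × X`. -/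
theorem evt_affPt_injective [IsIntegral X.left] {y : specOver k F ⟶ X} (hy : IsGenericPt y)
    (hL : IsInvertible L) {U : S.left.Opens} [IsDomain Γ(S.left, U)] (hU : IsAffineOpen U)
    (i : AffineFrame X L)
    (hg' : LiesIn (specMap (genLeft k Γ(S.left, U) F) ≫ affPt hU) U)
    (hi' : LiesIn (specMap (genRight k Γ(S.left, U) F) ≫ y) i.V) : Function.Injective
      (evt (ev (specMap (genLeft k Γ(S.left, U) F) ≫ affPt hU) U hg')
        (i.valE (specMap (genRight k Γ(S.left, U) F) ≫ y) hi')) := by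
  intro z z' h
  have key (z) := (evt_generic (affPt hU) y (affPt_mem hU) i (hy.liesIn i) hg' hi' z).trans
    (congrArg _ ((congrArg (fun φ => tw _ φ z) (ev_affPt hU)).trans (tw_id z)))
  exact evt_gen_injective (hy.valE_injective hL i) ((key z).symm.trans (h.trans (key z')))

end

variable {k : Type u} [Field k] [IsAlgClosed k] {S X : Over (Spec (.of k))} {L : X.left.Modules}

/-- Let `M` be an invertible sheaf on `S × X` which over `U × X` is a twist of `L`. A map from
`H⁰(X, L)` to the sections of `M` which is linear at every point comes from an endomorphism of
`𝒪(U) ⊗ H⁰(X, L)`. -/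
theorem exists_linearMap_of_frames [IsIntegral S.left] [IsIntegral X.left] (hL : IsInvertible L)
    {U : S.left.Opens} (hU : IsAffineOpen U) (hne : ∃ g, g ∈ U) (M : (S ⊗ X).left.Modules)
    {D : (S ⊗ X).left.Opens} (hD : ∀ i : AffineFrame X L, box U i.V ≤ D) (m : H0 X L → Γ(M, D))
    (b : ∀ i : AffineFrame X L, Γ(M, box U i.V)) (hb : ∀ i, IsFrameOn M (b i))
    (hrel : ∀ (i j : AffineFrame X L) {K : Type u} [Field K] [Algebra k K]
      (g : specOver k K ⟶ S) (x : specOver k K ⟶ X) (hg : LiesIn g U) (hi : LiesIn x i.V)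
      (hj : LiesIn x j.V), val (hb j) (lift g x) (liesIn_lift hg hj) (liesIn_lift hg hi) (b i) =
        val j.isFrame x hj hi i.s)
    (hlin : ∀ (i : AffineFrame X L) {K : Type u} [Field K] [Algebra k K] (g : specOver k K ⟶ S)
      (x : specOver k K ⟶ X) (hg : LiesIn g U) (hi : LiesIn x i.V),
      ∃ f : H0 X L →ₗ[k] K, ∀ e, val (hb i) (lift g x) (liesIn_lift hg hi)
        (fun p => hD i (liesIn_lift hg hi p)) (m e) = f e) :
    ∃ T : Γ(S.left, U) ⊗[k] H0 X L →ₗ[Γ(S.left, U)] Γ(S.left, U) ⊗[k] H0 X L,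
      ∀ (i : AffineFrame X L) {K : Type u} [Field K] [Algebra k K]
      (g : specOver k K ⟶ S) (x : specOver k K ⟶ X) (hg : LiesIn g U) (hi : LiesIn x i.V) (e),
      evt (ev g U hg) (i.valE x hi) (T (1 ⊗ₜ e)) = val (hb i) (lift g x) (liesIn_lift hg hi)
        (fun p => hD i (liesIn_lift hg hi p)) (m e) := by
  have h e := exists_tensor_of_frames hL hU hne M hD (m e) b hb hrel
  let t e := (h e).choose
  have ht e := (h e).choose_spec
  obtain ⟨F, _, _, y, hy⟩ := exists_isGenericPt X
  obtain ⟨i, hi⟩ := exists_affineFrame hL y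
  have : Nonempty U := hne.elim fun x hx => ⟨⟨x, hx⟩⟩
  have hg : LiesIn (specMap (genLeft k Γ(S.left, U) F) ≫ affPt hU) U := fun p => affPt_mem hU _
  have hx : LiesIn (specMap (genRight k Γ(S.left, U) F) ≫ y) i.V := fun p => hi _
  obtain ⟨f, hf⟩ := hlin i _ _ hg hx
  obtain ⟨T, hT⟩ := exists_linearMap_of_injective (evt_affPt_injective hy hL hU i hg hx)
    fun e => (ht e i _ _ hg hx).trans (hf e)
  refine ⟨T, fun i K _ _ g x hg hi e => ?_⟩
  rw [hT]
  exact ht e i g x hg hi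

end LinearMaps

/-! ### The twisted sheaf `p₁^* N ⊗ p₂^* L` -/

section Twist

variable {k : Type u} [Field k] {G X : Over (Spec (.of k))} [GrpObj G] [ModObj G X]
  {L : X.left.Modules} {N : G.left.Modules}
  (φ : (Scheme.Modules.pullback (γ[G, X] : G ⊗ X ⟶ X).left).obj L ≅
      modTensor ((Scheme.Modules.pullback (fst G X).left).obj N)
        ((Scheme.Modules.pullback (snd G X).left).obj L))
  {K : Type u} [CommRing K] [Algebra k K]

/-- The section of `τ^* L` which corresponds to the section `n ⊠ s` of `p₁^* N ⊗ p₂^* L`. -/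
def twist {U : G.left.Opens} (n : Γ(N, U)) {V : X.left.Opens} (s : Γ(L, V)) :
    Γ((Scheme.Modules.pullback (γ[G, X] : G ⊗ X ⟶ X).left).obj L, box U V) :=
  φ.symm.hom.app (box U V) (tens (resM _ inf_le_left (pb (fst G X).left N U n))
    (resM _ inf_le_right (pb (snd G X).left L V s)))

variable {U U' : G.left.Opens} {V V' : X.left.Opens} {n : Γ(N, U)} (hn : IsFrameOn N n)
  {s : Γ(L, V)} (hs : IsFrameOn L s)

theorem isFrameOn_twist (hn : IsFrameOn N n) (hs : IsFrameOn L s) : IsFrameOn _ (twist φ n s) :=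
  (((hn.pb _).res inf_le_left).tens ((hs.pb _).res inf_le_right)).map_iso φ.symm

theorem val_congr_pt {S : Over (Spec (.of k))} {M : S.left.Modules} {V W : S.left.Opens}
    {s : Γ(M, V)} (hs : IsFrameOn M s) {y y' : specOver k K ⟶ S} (e : y = y') (hV : LiesIn y V)
    (hW : LiesIn y W) (hV' : LiesIn y' V) (hW' : LiesIn y' W) (m : Γ(M, W)) :
    val hs y hV hW m = val hs y' hV' hW' m := by
  subst e; rfl

theorem val_pb_res {S S' : Over (Spec (.of k))} {M : S.left.Modules} {V W : S.left.Opens}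
    {s : Γ(M, V)} (hs : IsFrameOn M s) (f : S' ⟶ S) {y : specOver k K ⟶ S'}
    {z : specOver k K ⟶ S} (e : y ≫ f = z) (hV : LiesIn z V) (hW : LiesIn z W)
    {V' W' : S'.left.Opens} (h : V' ≤ f.left ⁻¹ᵁ V) (h' : W' ≤ f.left ⁻¹ᵁ W) (hV' : LiesIn y V')
    (hW' : LiesIn y W') (m : Γ(M, W)) :
    val (S := S') ((hs.pb f.left).res h) y hV' hW' (resM _ h' (pb f.left M W m)) =
      val hs z hV hW m := by
  subst e
  rw [val_res (S := S') (W := f.left ⁻¹ᵁ W) _ y hV' hW hW',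
    val_frame_res (S := S') (hs.pb f.left) y hV hV' hW, val_pb]

/-- The value at `(g, x)` of the section `n' ⊠ s'` with respect to the frame `n ⊠ s`. -/
theorem val_twist (g : specOver k K ⟶ G) (x : specOver k K ⟶ X) (hU : LiesIn g U)
    (hU' : LiesIn g U') (hV : LiesIn x V) (hV' : LiesIn x V') (n' : Γ(N, U')) (s' : Γ(L, V')) :
    val (isFrameOn_twist φ hn hs) (lift g x) (liesIn_lift hU hV) (liesIn_lift hU' hV')
      (twist φ n' s') = val hn g hU hU' n' * val hs x hV hV' s' := by
  refine (val_map (S := G ⊗ X) (((hn.pb _).res inf_le_left).tens ((hs.pb _).res inf_le_right))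
    (lift g x) (liesIn_lift hU hV) (liesIn_lift hU' hV') φ.symm _).trans ?_
  refine (val_tens (S := G ⊗ X) ((hn.pb _).res inf_le_left) (lift g x) (liesIn_lift hU hV)
    (liesIn_lift hU' hV') ((hs.pb _).res inf_le_right) _ _).trans ?_
  exact congrArg₂ (· * ·) (val_pb_res hn (fst G X) (lift_fst g x) hU hU' inf_le_left inf_le_left _ _ _)
    (val_pb_res hs (snd G X) (lift_snd g x) hV hV' inf_le_right inf_le_right _ _ _)

end Twist

/-! ### Transport of sections along the action -/

section Transport

variable {k : Type u} [Field k] {G X : Over (Spec (.of k))} [GrpObj G] [ModObj G X]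
  {L : X.left.Modules} {N : G.left.Modules}
  (φ : (Scheme.Modules.pullback (γ[G, X] : G ⊗ X ⟶ X).left).obj L ≅
      modTensor ((Scheme.Modules.pullback (fst G X).left).obj N)
        ((Scheme.Modules.pullback (snd G X).left).obj L))
  {U : G.left.Opens} {n : Γ(N, U)} (hn : IsFrameOn N n)

section Factor

variable {K : Type u} [CommRing K] [Algebra k K] {g : specOver k K ⟶ G} {x y : specOver k K ⟶ X}

/-- The value at the point `(g, x)` of the section `τ^* s_j` of `τ^* L`, with respect to the frame
`n ⊠ s_i`. -/
def factor (i j : AffineFrame X L) (hg : LiesIn g U) (hi : LiesIn x i.V)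
    (hj : LiesIn (g • x) j.V) : K :=
  val (isFrameOn_twist φ hn i.isFrame) (lift g x) (liesIn_lift hg hi)
    (W := (γ[G, X] : G ⊗ X ⟶ X).left ⁻¹ᵁ j.V) hj (pb (γ[G, X] : G ⊗ X ⟶ X).left L j.V j.s)

/-- The value at the point `(g, x)` of the section `n ⊠ s_i`, with respect to the frame `τ^* s_j` of
`τ^* L`; it is the inverse of `factor`. -/
def factorInv (n : Γ(N, U)) (i j : AffineFrame X L) (hg : LiesIn g U) (hi : LiesIn x i.V)
    (hj : LiesIn (g • x) j.V) : K :=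
  val (S := G ⊗ X) (j.isFrame.pb (γ[G, X] : G ⊗ X ⟶ X).left) (lift g x)
    (V := (γ[G, X] : G ⊗ X ⟶ X).left ⁻¹ᵁ j.V) hj (liesIn_lift hg hi) (twist φ n i.s)

variable (i j : AffineFrame X L) (hg : LiesIn g U) (hi : LiesIn x i.V)
    (hj : LiesIn (g • x) j.V)

theorem factor_mul_factorInv :
    factor φ hn i j hg hi hj * factorInv φ n i j hg hi hj = 1 :=
  val_mul_val (isFrameOn_twist φ hn i.isFrame) (j.isFrame.pb (γ[G, X] : G ⊗ X ⟶ X).left) (lift g x)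
    (liesIn_lift hg hi) hj

/-- The value of `τ^* e` at the point `(g, x)` is the value of `e` at `g x`, up to a factor. -/
theorem val_twist_pb (e : H0 X L) :
    val (isFrameOn_twist φ hn i.isFrame) (lift g x) (liesIn_lift hg hi)
      (W := (γ[G, X] : G ⊗ X ⟶ X).left ⁻¹ᵁ ⊤) (fun _ => trivial)
      (pb (γ[G, X] : G ⊗ X ⟶ X).left L ⊤ e) = factor φ hn i j hg hi hj * j.valE (g • x) hj e := by
  refine (val_trans (S := G ⊗ X) (j.isFrame.pb (γ[G, X] : G ⊗ X ⟶ X).left)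
    (isFrameOn_twist φ hn i.isFrame) (lift g x) hj (liesIn_lift hg hi)
    (W := (γ[G, X] : G ⊗ X ⟶ X).left ⁻¹ᵁ ⊤) (fun _ => trivial) _).trans
    ((mul_comm _ _).trans (congrArg (factor φ hn i j hg hi hj * ·) ?_))
  exact val_pb j.isFrame (γ[G, X] : G ⊗ X ⟶ X) (lift g x) hj (W := ⊤) (fun _ => trivial) _

/-- The value of `n ⊠ e` at the point `(g, x)`, with respect to the frame `τ^* s_j`, is the value of
`e` at `x`, up to a factor. -/
theorem val_pb_twist (hn : IsFrameOn N n) (hg' : LiesIn (lift g x) (box U ⊤)) (e : H0 X L) :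
    val (S := G ⊗ X) (j.isFrame.pb (γ[G, X] : G ⊗ X ⟶ X).left) (lift g x)
      (V := (γ[G, X] : G ⊗ X ⟶ X).left ⁻¹ᵁ j.V) hj hg'
      (twist φ n (V := ⊤) e) = factorInv φ n i j hg hi hj * i.valE x hi e := by
  refine (val_trans (S := G ⊗ X) (isFrameOn_twist φ hn i.isFrame)
    (j.isFrame.pb (γ[G, X] : G ⊗ X ⟶ X).left) (lift g x) (liesIn_lift hg hi) hj hg' _).trans
    ((mul_comm _ _).trans (congrArg (factorInv φ n i j hg hi hj * ·) ?_))
  refine (val_twist φ hn i.isFrame g x hg hg hi (V' := ⊤) (fun _ => trivial) n _).trans ?_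
  rw [val_self, _root_.one_mul]
  rfl

end Factor

theorem box_le_invSmul (U : G.left.Opens) (V : X.left.Opens) :
    box U V ≤ (invSmul G X).left ⁻¹ᵁ box U ⊤ := by
  intro p hp
  have h : invSmul G X ≫ fst G X = fst G X := lift_fst _ _
  refine ⟨?_, trivial⟩
  change (invSmul G X ≫ fst G X).left p ∈ U
  rw [h]
  exact hp.1

theorem box_le_invSmul_smul (U : G.left.Opens) (V : X.left.Opens) :
    box U V ≤ (invSmul G X).left ⁻¹ᵁ (γ[G, X] : G ⊗ X ⟶ X).left ⁻¹ᵁ V := by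
  intro p hp
  change (invSmul G X ≫ γ[G, X]).left p ∈ V
  rw [invSmul_smul]
  exact hp.2

variable [IsAlgClosed k] [IsIntegral G.left] [IsIntegral X.left]

/-- The endomorphism `T` which describes the sections `τ^* e` of `τ^* L ≃ p₁^* N ⊗ p₂^* L`. -/
theorem exists_transport_hom (hL : IsInvertible L) (hU : IsAffineOpen U) (hne : ∃ g, g ∈ U) :
    ∃ T : Γ(G.left, U) ⊗[k] H0 X L →ₗ[Γ(G.left, U)] Γ(G.left, U) ⊗[k] H0 X L,
      ∀ (i j : AffineFrame X L) {K : Type u} [Field K] [Algebra k K] (g : specOver k K ⟶ G)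
      (x : specOver k K ⟶ X) (hg : LiesIn g U) (hi : LiesIn x i.V) (hj : LiesIn (g • x) j.V) (z),
      evt (ev g U hg) (i.valE x hi) (T z) = factor φ hn i j hg hi hj *
        evt (ev g U hg) (j.valE (g • x) hj) z := by
  obtain ⟨T, hT⟩ := exists_linearMap_of_frames hL hU hne _
    (D := (γ[G, X] : G ⊗ X ⟶ X).left ⁻¹ᵁ ⊤) (fun i => le_top)
    (fun e => pb (γ[G, X] : G ⊗ X ⟶ X).left L ⊤ e) (fun i => twist φ n i.s)
    (fun i => isFrameOn_twist φ hn i.isFrame) (by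
      intro i j K _ _ g x hg hi hj
      refine (val_twist φ hn j.isFrame g x hg hg hj hi n i.s).trans ?_
      rw [val_self, _root_.one_mul]) (by
      intro i K _ _ g x hg hi
      obtain ⟨j, hj⟩ := exists_affineFrame hL (g • x)
      exact ⟨factor φ hn i j hg hi hj • j.valE (g • x) hj,
        val_twist_pb φ hn i j hg hi hj⟩)
  refine ⟨T, fun i j K _ _ g x hg hi hj =>
    evt_eq_of_one_tmul (T' := LinearMap.id) _ _ fun e => ?_⟩
  refine (hT i g x hg hi e).trans ((val_twist_pb φ hn i j hg hi hj e).trans ?_)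
  rw [LinearMap.id_apply, evt_one_tmul]

/-- The inverse transport of sections. Under the automorphism `(g, y) ↦ (g, g⁻¹ y)` the sheaf
`τ^* L` pulls back to `p₂^* L`, so that the pullbacks of the sections `n ⊠ e` of `τ^* L` are described by
an endomorphism of `𝒪(U) ⊗ H⁰(X, L)`. -/
theorem exists_transport_inv (hn : IsFrameOn N n) (hL : IsInvertible L) (hU : IsAffineOpen U)
    (hne : ∃ g, g ∈ U) :
    ∃ T : Γ(G.left, U) ⊗[k] H0 X L →ₗ[Γ(G.left, U)] Γ(G.left, U) ⊗[k] H0 X L,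
      ∀ (i j : AffineFrame X L) {K : Type u} [Field K] [Algebra k K] (g : specOver k K ⟶ G)
      (x : specOver k K ⟶ X) (hg : LiesIn g U) (hi : LiesIn x i.V) (hj : LiesIn (g • x) j.V) (z),
      evt (ev g U hg) (j.valE (g • x) hj) (T z) = factorInv φ n i j hg hi hj *
        evt (ev g U hg) (i.valE x hi) z := by
  have hpt {K : Type u} [Field K] [Algebra k K] (g : specOver k K ⟶ G) (y : specOver k K ⟶ X)
      {x : specOver k K ⟶ X} (e : g • x = y) : lift g y ≫ invSmul G X = lift g x := by
    rw [lift_invSmul, ← e, inv_smul_smul]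
  -- The pullback of `n ⊠ e` has at `(g, g x)` the value of `n ⊠ e` at `(g, x)`.
  have key (i j : AffineFrame X L) {K : Type u} [Field K] [Algebra k K] (g : specOver k K ⟶ G)
      (x : specOver k K ⟶ X) (hg : LiesIn g U) (hi : LiesIn x i.V) (y) (e : g • x = y)
      (hj : LiesIn y j.V) (hj' : LiesIn (g • x) j.V)
      (hg' : LiesIn (lift g y) ((invSmul G X).left ⁻¹ᵁ box U ⊤)) (e) :
      val (S := G ⊗ X) (((j.isFrame.pb (γ[G, X] : G ⊗ X ⟶ X).left).pb (invSmul G X).left).res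
        (box_le_invSmul_smul U j.V)) (lift g y) (liesIn_lift hg hj)
        (W := (invSmul G X).left ⁻¹ᵁ box U ⊤) hg'
        (pb (invSmul G X).left _ (box U ⊤) (twist φ n (V := ⊤) e)) =
      factorInv φ n i j hg hi hj' * i.valE x hi e :=
    (congrArg _ (resM_self _ _).symm).trans
      ((val_pb_res (S := G ⊗ X) (S' := G ⊗ X) (j.isFrame.pb (γ[G, X] : G ⊗ X ⟶ X).left) (invSmul G X)
        (hpt g y ‹_›) hj' (liesIn_lift (V := ⊤) hg (fun _ => trivial)) (box_le_invSmul_smul U j.V) le_rfl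
        (liesIn_lift hg hj) hg' _).trans (val_pb_twist φ i j hg hi hj' hn _ e))
  obtain ⟨T, hT⟩ := exists_linearMap_of_frames hL hU hne _
    (D := (invSmul G X).left ⁻¹ᵁ box U ⊤) (fun i => box_le_invSmul U i.V)
    (fun e => pb (invSmul G X).left _ (box U ⊤) (twist φ n (V := ⊤) e))
    (fun i => resM _ (box_le_invSmul_smul U i.V)
      (pb (invSmul G X).left _ _ (pb (γ[G, X] : G ⊗ X ⟶ X).left L i.V i.s)))
    (fun i => ((i.isFrame.pb (γ[G, X] : G ⊗ X ⟶ X).left).pb (invSmul G X).left).res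
        (box_le_invSmul_smul U i.V)) (by
      intro i j K _ _ g y hg hi hj
      have e : lift g (g⁻¹ • y) ≫ γ[G, X] = y := smul_inv_smul g y
      have hi' : LiesIn (lift g (g⁻¹ • y) ≫ γ[G, X]) i.V := by rwa [e]
      have hj' : LiesIn (lift g (g⁻¹ • y) ≫ γ[G, X]) j.V := by rwa [e]
      exact (val_pb_res (S := G ⊗ X) (S' := G ⊗ X) (j.isFrame.pb (γ[G, X] : G ⊗ X ⟶ X).left)
        (invSmul G X) (lift_invSmul g y) hj' hi' (box_le_invSmul_smul U j.V)
        (box_le_invSmul_smul U i.V) (liesIn_lift hg hj) (liesIn_lift hg hi) _).trans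
        ((val_pb j.isFrame (γ[G, X] : G ⊗ X ⟶ X) _ hj' hi' _).trans
          (val_congr_pt j.isFrame e hj' hi' hj hi _))) (by
      intro j K _ _ g y hg hj
      obtain ⟨i, hi⟩ := exists_affineFrame hL (g⁻¹ • y)
      have e : g • g⁻¹ • y = y := smul_inv_smul g y
      have hj' : LiesIn (g • g⁻¹ • y) j.V := by rwa [e]
      exact ⟨factorInv φ n i j hg hi hj' • i.valE (g⁻¹ • y) hi,
        key i j g _ hg hi y e hj hj' _⟩)
  refine ⟨T, fun i j K _ _ g x hg hi hj =>
    evt_eq_of_one_tmul (T' := LinearMap.id) _ _ fun e => ?_⟩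
  refine (hT j g (g • x) hg hj e).trans ((key i j g x hg hi _ rfl hj hj _ e).trans ?_)
  rw [LinearMap.id_apply, evt_one_tmul]

/-- Over an affine open subset `U` on which `N` has the frame `n`, the action of `G` on the sections
of `L` is given by an automorphism `T` of `𝒪(U) ⊗ H⁰(X, L)`: the value of `T e` at the point
`(g, x)` is the value of `e` at `g x`, up to the factor by which `τ^* L` and `p₁^* N ⊗ p₂^* L` differ. -/
theorem exists_transport (hn : IsFrameOn N n) (hL : IsInvertible L) (hU : IsAffineOpen U)
    (hne : ∃ g, g ∈ U) :
    ∃ T : Γ(G.left, U) ⊗[k] H0 X L ≃ₗ[Γ(G.left, U)] Γ(G.left, U) ⊗[k] H0 X L,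
      ∀ (i j : AffineFrame X L) {K : Type u} [Field K] [Algebra k K] (g : specOver k K ⟶ G)
      (x : specOver k K ⟶ X) (hg : LiesIn g U) (hi : LiesIn x i.V) (hj : LiesIn (g • x) j.V) (z),
      evt (ev g U hg) (i.valE x hi) (T z) = factor φ hn i j hg hi hj *
        evt (ev g U hg) (j.valE (g • x) hj) z := by
  obtain ⟨T, hT⟩ := exists_transport_hom φ hn hL hU hne
  obtain ⟨T', hT'⟩ := exists_transport_inv φ hn hL hU hne
  obtain ⟨F, _, _, y, hy⟩ := exists_isGenericPt X
  obtain ⟨i, hi⟩ := exists_affineFrame hL y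
  have : Nonempty U := hne.elim fun x hx => ⟨⟨x, hx⟩⟩
  have hg : LiesIn (specMap (genLeft k Γ(G.left, U) F) ≫ affPt hU) U := fun p => affPt_mem hU _
  have hx : LiesIn (specMap (genRight k Γ(G.left, U) F) ≫ y) i.V := fun p => hi _
  have hinj := evt_affPt_injective hy hL hU i hg hx
  generalize specMap (genRight k Γ(G.left, U) F) ≫ y = x at hx hinj
  generalize specMap (genLeft k Γ(G.left, U) F) ≫ affPt hU = g at hg hinj
  -- The factors cancel at the generic point, which determines the elements of `𝒪(U) ⊗ H⁰(X, L)`.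
  have h1 (z) : T (T' z) = z := by
    obtain ⟨j, hj⟩ := exists_affineFrame hL (g • x)
    apply hinj
    rw [hT i j g x hg hx hj, hT' i j g x hg hx hj, ← _root_.mul_assoc, factor_mul_factorInv,
      _root_.one_mul]
  have h2 (z) : T' (T z) = z := by
    obtain ⟨j, hj⟩ := exists_affineFrame hL (g⁻¹ • x)
    apply hinj
    have key (x') (e : g • x' = x) (hx' : LiesIn x' j.V) :
        evt (ev g U hg) (i.valE x hx) (T' (T z)) = evt (ev g U hg) (i.valE x hx) z := by
      subst e
      rw [hT' j i g x' hg hx' hx, hT j i g x' hg hx' hx, ← _root_.mul_assoc,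
        mul_comm (factorInv _ _ _ _ _ _ _), factor_mul_factorInv, _root_.one_mul]
    exact key _ (smul_inv_smul g x) hj
  exact ⟨LinearEquiv.ofLinearMap T T' (LinearMap.ext h1) (LinearMap.ext h2), hT⟩

end Transport

/-! ### Automorphisms which lift the action of an element of `G` -/

section IsTransport

variable {k : Type u} [Field k] {G X : Over (Spec (.of k))} [GrpObj G] [ModObj G X]
  {L : X.left.Modules} {B C : Type u} [CommRing B] [Algebra k B] [CommRing C] [Algebra k C]

/-- An automorphism `T` of `B ⊗ H⁰(X, L)` lifts the action on sections of the `B`-valued point `g`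
of `G` if for every point `x` of `X` with values in a field the value of `T e` at `x` is
proportional to the value of `e` at `g x`. -/
def IsTransport (g : specOver k B ⟶ G) (T : B ⊗[k] H0 X L ≃ₗ[B] B ⊗[k] H0 X L) : Prop :=
  ∀ (i j : AffineFrame X L) {K : Type u} [Field K] [Algebra k K] (β : B →ₐ[k] K)
    (x y : specOver k K ⟶ X) (hi : LiesIn x i.V) (hj : LiesIn y j.V), (specMap β ≫ g) • x = y →
    ∃ c : K, c ≠ 0 ∧ ∀ z, evt β (i.valE x hi) (T z) = c * evt β (j.valE y hj) z

theorem IsTransport.bc {g : specOver k B ⟶ G} {T : B ⊗[k] H0 X L ≃ₗ[B] B ⊗[k] H0 X L}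
    (hT : IsTransport g T) (φ : B →ₐ[k] C) : IsTransport (specMap φ ≫ g) (bc φ T) := by
  intro i j K _ _ β x y hi hj e
  rw [← Category.assoc, specMap_comp] at e
  obtain ⟨c, hc, h⟩ := hT i j (β.comp φ) x y hi hj e
  refine ⟨c, hc, evt_eq_of_one_tmul (T := (ProjAction.bc φ T).toLinearMap) (T' := LinearMap.id) _ _
    fun e => ?_⟩
  rw [LinearEquiv.coe_coe, bc_one_tmul, evt_tw, h, evt_one_tmul, LinearMap.id_apply, evt_one_tmul]

theorem IsTransport.trans (hL : IsInvertible L) {g h : specOver k B ⟶ G}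
    {T T' : B ⊗[k] H0 X L ≃ₗ[B] B ⊗[k] H0 X L} (hT : IsTransport g T) (hT' : IsTransport h T') :
    IsTransport (g * h) (T.trans T') := by
  intro i j K _ _ β x y hi hj e
  obtain ⟨l, hl⟩ := exists_affineFrame hL ((specMap β ≫ h) • x)
  obtain ⟨c, hc, H⟩ := hT' i l β x _ hi hl rfl
  obtain ⟨c', hc', H'⟩ := hT l j β _ y hl hj (by
    rw [smul_smul, ← MonObj.comp_mul, e])
  exact ⟨c * c', mul_ne_zero hc hc', fun z => by
    rw [LinearEquiv.trans_apply, H, H', _root_.mul_assoc]⟩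

theorem IsTransport.symm {g : specOver k B ⟶ G} {T : B ⊗[k] H0 X L ≃ₗ[B] B ⊗[k] H0 X L}
    (hT : IsTransport g T) : IsTransport g⁻¹ T.symm := by
  intro i j K _ _ β x y hi hj e
  obtain ⟨c, hc, h⟩ := hT j i β y x hj hi (by
    rw [← e, GrpObj.comp_inv, smul_inv_smul])
  refine ⟨c⁻¹, inv_ne_zero hc, fun z => ?_⟩
  rw [eq_inv_mul_iff_mul_eq₀ hc, ← h, LinearEquiv.apply_symm_apply]

variable [IsAlgClosed k] [IsDomain B] [IsIntegral X.left]

/-- Two lifts of the same element are proportional at the generic point of `Spec B × X`. -/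
theorem IsTransport.exists_generic (hL : IsInvertible L) {g : specOver k B ⟶ G}
    {T T' : B ⊗[k] H0 X L ≃ₗ[B] B ⊗[k] H0 X L} (hT : IsTransport g T) (hT' : IsTransport g T') :
    ∃ (F : Type u) (_ : Field F) (_ : Algebra k F) (j : H0 X L →ₗ[k] F) (c : GenField k B F),
      Function.Injective j ∧ c ≠ 0 ∧
      ∀ e, evt (genLeft k B F) ((genRight k B F).toLinearMap ∘ₗ j) (T (1 ⊗ₜ e)) =
        c * evt (genLeft k B F) ((genRight k B F).toLinearMap ∘ₗ j) (T' (1 ⊗ₜ e)) := by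
  obtain ⟨F, _, _, y, hy⟩ := exists_isGenericPt X
  obtain ⟨i, hi⟩ := exists_affineFrame hL y
  have hx : LiesIn (specMap (genRight k B F) ≫ y) i.V := fun p => hi _
  obtain ⟨j, hj⟩ := exists_affineFrame hL ((specMap (genLeft k B F) ≫ g) •
    (specMap (genRight k B F) ≫ y))
  obtain ⟨c, hc, h⟩ := hT i j _ _ _ hx hj rfl
  obtain ⟨c', hc', h'⟩ := hT' i j _ _ _ hx hj rfl
  refine ⟨F, _, _, i.valE y hi, c * c'⁻¹, hy.valE_injective hL i,
    mul_ne_zero hc (inv_ne_zero hc'), fun e => ?_⟩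
  rw [i.valE_specMap _ hi] at h h'
  rw [h, h', _root_.mul_assoc, inv_mul_cancel_left₀ hc']

/-- Two lifts of a family of elements of `G` are proportional if they are so at one point. -/
theorem IsTransport.proportional (hL : IsInvertible L) {g : specOver k B ⟶ G}
    {T T' : B ⊗[k] H0 X L ≃ₗ[B] B ⊗[k] H0 X L} (hT : IsTransport g T) (hT' : IsTransport g T')
    (ε : B →ₐ[k] k) (hε : Proportional (ProjAction.bc ε T) (ProjAction.bc ε T')) :
    Proportional T T' := by
  obtain ⟨F, _, _, j, c, hj, hc, h⟩ := hT.exists_generic hL hT'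
  exact proportional_of_generic hj hc h ε hε

/-- Two lifts of a family of elements of `G` are proportional if they are so generically. -/
theorem IsTransport.proportional_of_injective [IsDomain C] (hL : IsInvertible L)
    {g : specOver k B ⟶ G} {T T' : B ⊗[k] H0 X L ≃ₗ[B] B ⊗[k] H0 X L} (hT : IsTransport g T)
    (hT' : IsTransport g T') (ψ : B →ₐ[k] C) (hψ : Function.Injective ψ)
    (h : Proportional (ProjAction.bc ψ T) (ProjAction.bc ψ T')) : Proportional T T' := by
  obtain ⟨F, _, _, j, c, hj, hc, h'⟩ := hT.exists_generic hL hT'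
  exact proportional_of_generic_of_injective hj hc h' ψ hψ h

end IsTransport

/-! ### The system of automorphisms given by an invariant sheaf -/

section Cocycle

variable {k : Type u} [Field k] {G X : Over (Spec (.of k))} [GrpObj G] [ModObj G X]
  {L : X.left.Modules} {N : G.left.Modules}
  (φ : (Scheme.Modules.pullback (γ[G, X] : G ⊗ X ⟶ X).left).obj L ≅
      modTensor ((Scheme.Modules.pullback (fst G X).left).obj N)
        ((Scheme.Modules.pullback (snd G X).left).obj L))

/-- The property which characterizes the automorphism given by `exists_transport`. -/
def IsTransportOf (a : AffineFrame G N)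
    (T : Γ(G.left, a.V) ⊗[k] H0 X L ≃ₗ[Γ(G.left, a.V)] Γ(G.left, a.V) ⊗[k] H0 X L) : Prop :=
  ∀ (i j : AffineFrame X L) {K : Type u} [Field K] [Algebra k K] (g : specOver k K ⟶ G)
    (x : specOver k K ⟶ X) (hg : LiesIn g a.V) (hi : LiesIn x i.V) (hj : LiesIn (g • x) j.V) (z),
    evt (ev g a.V hg) (i.valE x hi) (T z) = factor φ a.isFrame i j hg hi hj *
      evt (ev g a.V hg) (j.valE (g • x) hj) z

variable {φ}

theorem IsTransportOf.isTransport {a : AffineFrame G N}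
    {T : Γ(G.left, a.V) ⊗[k] H0 X L ≃ₗ[Γ(G.left, a.V)] Γ(G.left, a.V) ⊗[k] H0 X L}
    (hT : IsTransportOf φ a T) : IsTransport (affPt a.isAffineOpen) T := by
  intro i j K _ _ β x y hi hj e
  subst e
  have hg : LiesIn (specMap β ≫ affPt a.isAffineOpen) a.V := fun p => affPt_mem a.isAffineOpen _
  have h := hT i j _ x hg hi hj
  rw [ev_specMap _ _ (affPt_mem a.isAffineOpen), ev_affPt] at h
  exact ⟨_, left_ne_zero_of_mul_eq_one (factor_mul_factorInv φ a.isFrame i j hg hi hj), h⟩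

/-- The automorphisms for two frames of `N` differ by the ratio of the frames. -/
theorem IsTransportOf.proportional [IsAlgClosed k] [IsIntegral G.left] [IsIntegral X.left]
    (hL : IsInvertible L) {a b : AffineFrame G N} {T T'} (hT : IsTransportOf φ a T)
    (hT' : IsTransportOf φ b T') {V : G.left.Opens} (hV : IsAffineOpen V) (ha : V ≤ a.V)
    (hb : V ≤ b.V) : Proportional (bc (resA G ha) T) (bc (resA G hb) T') := by
  -- over the empty set every two automorphisms are proportional, as `𝒪(∅) = 0`
  by_cases hne : Nonempty V
  swap
  · have : Subsingleton Γ(G.left, V) := by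
      have : V = ⊥ := by
        ext x; exact ⟨fun h => (hne ⟨⟨x, h⟩⟩).elim, fun h => h.elim⟩
      subst this
      infer_instance
    have : Subsingleton (Γ(G.left, V) ⊗[k] H0 X L) := Module.subsingleton Γ(G.left, V) _
    exact ⟨1, fun z => Subsingleton.elim _ _⟩
  let u := b.isFrame.coord hb (resM N ha a.s)
  let u' := a.isFrame.coord ha (resM N hb b.s)
  have huu : u * u' = 1 := by
    apply (b.isFrame V hb).1
    change (u * u') • resM N hb b.s = (1 : Γ(G.left, V)) • resM N hb b.s
    have h1 : u • resM N hb b.s = resM N ha a.s := b.isFrame.coord_smul hb _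
    have h2 : u' • resM N ha a.s = resM N hb b.s := a.isFrame.coord_smul ha _
    rw [mul_comm, mul_smul, h1, h2, one_smul]
  obtain ⟨F, _, _, y, hy⟩ := exists_isGenericPt X
  obtain ⟨i, hi⟩ := exists_affineFrame hL y
  have hg : LiesIn (specMap (genLeft k Γ(G.left, V) F) ≫ affPt hV) V := fun p => affPt_mem hV _
  have hx : LiesIn (specMap (genRight k Γ(G.left, V) F) ≫ y) i.V := fun p => hi _
  have hinj := evt_affPt_injective hy hL hV i hg hx
  generalize specMap (genRight k Γ(G.left, V) F) ≫ y = x at hx hinj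
  generalize specMap (genLeft k Γ(G.left, V) F) ≫ affPt hV = g at hg hinj
  have hga : LiesIn g a.V := fun p => ha (hg p)
  have hgb : LiesIn g b.V := fun p => hb (hg p)
  obtain ⟨j, hj⟩ := exists_affineFrame hL (g • x)
  -- `u` is the ratio of the two frames of `N`.
  have h1 : factor φ b.isFrame i j hgb hx hj = ev g V hg u * factor φ a.isFrame i j hga hx hj := by
    refine (val_trans (S := G ⊗ X) (isFrameOn_twist φ a.isFrame i.isFrame)
      (isFrameOn_twist φ b.isFrame i.isFrame) (lift g x) (liesIn_lift hga hx) (liesIn_lift hgb hx)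
      (W := (γ[G, X] : G ⊗ X ⟶ X).left ⁻¹ᵁ j.V) hj _).trans ((mul_comm _ _).trans
      (congrArg (· * factor φ a.isFrame i j hga hx hj) ?_))
    refine (val_twist φ b.isFrame i.isFrame g x hgb hga hx hx a.s i.s).trans ?_
    rw [val_self, _root_.mul_one, val_eq b.isFrame g hgb hga hg hb ha]
  have h2 : (bc (resA G hb) T').toLinearMap = u • (bc (resA G ha) T).toLinearMap := by
    refine ext_one_tmul fun e => hinj ?_
    rw [LinearMap.smul_apply, evt_smul, LinearEquiv.coe_coe, LinearEquiv.coe_coe, bc_one_tmul,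
      bc_one_tmul, evt_tw, evt_tw, ev_resA, ev_resA, hT i j g x hga hx hj, hT' i j g x hgb hx hj, h1,
      evt_one_tmul, evt_one_tmul, _root_.mul_assoc]
  refine Proportional.symm ⟨⟨u, u', huu, by rwa [mul_comm]⟩, fun z => congr($h2 z)⟩

end Cocycle

section EvalAt

variable {k : Type u} [Field k] {S : Over (Spec (.of k))} {E : Type u} [AddCommGroup E] [Module k E]
  {B C : Type u} [CommRing B] [Algebra k B] [CommRing C] [Algebra k C]

/-- The value at the point `g` of the automorphism `T` with index `i` of a system. -/
def AutSystem.evalAt (σ : AutSystem S E) (i : σ.I) (g : specOver k B ⟶ S) (h : LiesIn g (σ.U i)) :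
    B ⊗[k] E ≃ₗ[B] B ⊗[k] E :=
  bc (ev g (σ.U i) h) (σ.T i)

theorem AutSystem.bc_evalAt (σ : AutSystem S E) {i : σ.I} {g : specOver k B ⟶ S}
    (h : LiesIn g (σ.U i)) (φ : B →ₐ[k] C) {g' : specOver k C ⟶ S} (e : specMap φ ≫ g = g')
    (h' : LiesIn g' (σ.U i)) : bc φ (σ.evalAt i g h) = σ.evalAt i g' h' := by
  subst e
  rw [evalAt, evalAt, bc_bc, ev_specMap g _ h]

/-- The value of a system at a point does not depend on the index, up to units. -/
theorem AutSystem.proportional_evalAt [IsSeparated S.hom] (σ : AutSystem S E) (i j : σ.I)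
    (g : specOver k B ⟶ S) (hi : LiesIn g (σ.U i)) (hj : LiesIn g (σ.U j)) :
    Proportional (σ.evalAt i g hi) (σ.evalAt j g hj) := by
  have h := (σ.compat i j (σ.U i ⊓ σ.U j) (isAffineOpen_inf (σ.isAffineOpen i) (σ.isAffineOpen j))
    inf_le_left inf_le_right).bc (ev g _ (hi.inf hj))
  rwa [bc_bc, bc_bc, ev_resA, ev_resA] at h

end EvalAt

section System

variable {k : Type u} [Field k] {G X : Over (Spec (.of k))} [GrpObj G] [ModObj G X]
  {L : X.left.Modules} {B C : Type u} [CommRing B] [Algebra k B] [CommRing C] [Algebra k C]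

theorem IsTransport.evalAt {σ : AutSystem G (H0 X L)} {i : σ.I}
    (hσ : IsTransport (affPt (σ.isAffineOpen i)) (σ.T i)) (g : specOver k B ⟶ G)
    (h : LiesIn g (σ.U i)) : IsTransport g (σ.evalAt i g h) := by
  have := hσ.bc (ev g (σ.U i) h)
  rwa [specMap_ev_affPt] at this

variable [IsAlgClosed k] [IsIntegral G.left] [IsIntegral X.left] [IsSeparated G.hom]

/-- The action of `G` on the sections of an invariant invertible sheaf is given by a system of
automorphisms, normalized to be the identity at the neutral element. -/
theorem exists_transportSystem (hL : IsInvertible L) (hGL : IsInvariant G X L) :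
    ∃ σ : AutSystem G (H0 X L), (∀ i, IsTransport (affPt (σ.isAffineOpen i)) (σ.T i)) ∧
      (∀ i, ∃ g, g ∈ σ.U i) ∧
      ∃ (i : σ.I) (h : LiesIn (1 : specOver k k ⟶ G) (σ.U i)),
        σ.evalAt i 1 h = LinearEquiv.refl k _ := by
  obtain ⟨N, hN, ⟨φ⟩⟩ := hGL
  choose T hT using fun a : AffineFrame G N =>
    exists_transport φ a.isFrame hL a.isAffineOpen a.nonempty
  have hT (a) : IsTransportOf φ a (T a) := hT a
  obtain ⟨a₀, ha₀⟩ := exists_affineFrame hN (1 : specOver k k ⟶ G)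
  -- `R` is the inverse of the value of `T` at the neutral element; the composites with it are
  -- normalized.
  let R := (bc (ev (1 : specOver k k ⟶ G) a₀.V ha₀) (T a₀)).symm
  have hR : IsTransport (L := L) (1 : specOver k k ⟶ G) R := by
    have h := ((hT a₀).isTransport.bc (ev (1 : specOver k k ⟶ G) a₀.V ha₀)).symm
    rwa [specMap_ev_affPt, inv_one] at h
  refine ⟨⟨AffineFrame G N, fun a => a.V, fun a => a.isAffineOpen, exists_mem_affineFrame hN,
    fun a => (T a).trans (bc (Algebra.ofId k _) R), fun a b V hV ha hb => ?_⟩, fun a => ?_,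
    fun a => a.nonempty, a₀, ha₀, ?_⟩
  · have h := (hT a).proportional hL (hT b) hV ha hb
    have h1 : (resA G ha).comp (Algebra.ofId k _) = (resA G hb).comp (Algebra.ofId k _) :=
      Subsingleton.elim _ _
    rw [bc_trans, bc_trans, bc_bc, bc_bc, h1]
    exact h.comp ⟨1, fun z => by rw [Units.val_one, one_smul]⟩
  · have h := (hT a).isTransport.trans hL (hR.bc (Algebra.ofId k _))
    rwa [MonObj.comp_one, _root_.mul_one] at h
  · change bc _ ((T a₀).trans (bc (Algebra.ofId k _) R)) = _
    have h1 : (ev (1 : specOver k k ⟶ G) a₀.V ha₀).comp (Algebra.ofId k _) = AlgHom.id k k :=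
      Subsingleton.elim _ _
    rw [bc_trans, bc_bc, h1, bc_id]
    exact LinearEquiv.self_trans_symm _

/-- A normalized system of lifts of the elements of `G` is multiplicative up to units. -/
theorem AutSystem.proportional_mul (hL : IsInvertible L)
    (σ : AutSystem G (H0 X L))
    (hσ : ∀ i, IsTransport (affPt (σ.isAffineOpen i)) (σ.T i)) {i₀ : σ.I}
    {h₀ : LiesIn (1 : specOver k k ⟶ G) (σ.U i₀)}
    (hone : σ.evalAt i₀ 1 h₀ = LinearEquiv.refl k _) {W : (G ⊗ G).left.Opens} (hW : IsAffineOpen W)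
    (i₁ i₂ i₃ : σ.I) (h₁ : LiesIn (affPt hW ≫ fst G G) (σ.U i₁))
    (h₂ : LiesIn (affPt hW ≫ snd G G) (σ.U i₂)) (h₃ : LiesIn (affPt hW ≫ μ[G]) (σ.U i₃))
    (hne : ∃ z, z ∈ W) :
    Proportional (σ.evalAt i₃ (affPt hW ≫ μ[G]) h₃)
      ((σ.evalAt i₁ (affPt hW ≫ fst G G) h₁).trans (σ.evalAt i₂ (affPt hW ≫ snd G G) h₂)) := by
  have : IsIntegral (G ⊗ G).left := isIntegral_tensor G G
  have hmul {B : Type u} [CommRing B] [Algebra k B] (g : specOver k B ⟶ G ⊗ G) :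
      (g ≫ fst G G) * (g ≫ snd G G) = g ≫ μ[G] := by
    rw [Hom.mul_def, ← comp_lift, lift_fst_snd, Category.comp_id]
  have hR {W : (G ⊗ G).left.Opens} (hW : IsAffineOpen W) (i₁ i₂ : σ.I)
      (h₁ : LiesIn (affPt hW ≫ fst G G) (σ.U i₁)) (h₂ : LiesIn (affPt hW ≫ snd G G) (σ.U i₂)) :
      IsTransport (affPt hW ≫ μ[G]) ((σ.evalAt i₁ (affPt hW ≫ fst G G) h₁).trans
        (σ.evalAt i₂ (affPt hW ≫ snd G G) h₂)) := by
    rw [← hmul]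
    exact ((hσ i₁).evalAt _ h₁).trans hL ((hσ i₂).evalAt _ h₂)
  let e : specOver k k ⟶ G ⊗ G := lift 1 1
  have e1 : e ≫ fst G G = 1 := lift_fst _ _
  have e2 : e ≫ snd G G = 1 := lift_snd _ _
  have e3 : e ≫ μ[G] = 1 := by rw [← hmul, e1, e2, _root_.mul_one]
  -- a neighbourhood `W₀` of `(1, 1)` on which `g`, `h` and `g h` are close to the neutral element
  let U := σ.U i₀
  obtain ⟨W₀, hW₀, heW₀, hle⟩ := exists_isAffineOpen_mem
    ((fst G G).left ⁻¹ᵁ U ⊓ ((snd G G).left ⁻¹ᵁ U ⊓ (μ[G] : G ⊗ G ⟶ G).left ⁻¹ᵁ U))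
    (e.left (default : PrimeSpectrum k)) (by
      have a1 : LiesIn (e ≫ fst G G) U := by rwa [e1]
      have a2 : LiesIn (e ≫ snd G G) U := by rwa [e2]
      have a3 : LiesIn (e ≫ μ[G]) U := by rwa [e3]
      exact ⟨a1 _, a2 _, a3 _⟩)
  have heW₀' : LiesIn e W₀ := by
    intro p
    have : p = (default : PrimeSpectrum k) := Subsingleton.elim (α := PrimeSpectrum k) _ _
    rwa [this]
  have b1 : LiesIn (affPt hW₀ ≫ fst G G) U := fun p => (hle (affPt_mem hW₀ p)).1
  have b2 : LiesIn (affPt hW₀ ≫ snd G G) U := fun p => (hle (affPt_mem hW₀ p)).2.1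
  have b3 : LiesIn (affPt hW₀ ≫ μ[G]) U := fun p => (hle (affPt_mem hW₀ p)).2.2
  have : Nonempty W₀ := ⟨⟨_, heW₀⟩⟩
  -- Over `W₀` the two families are proportional, because they agree at `(1, 1)`.
  have key : Proportional (σ.evalAt i₀ (affPt hW₀ ≫ μ[G]) b3)
      ((σ.evalAt i₀ (affPt hW₀ ≫ fst G G) b1).trans (σ.evalAt i₀ (affPt hW₀ ≫ snd G G) b2)) := by
    refine ((hσ i₀).evalAt _ b3).proportional hL (hR hW₀ i₀ i₀ b1 b2) (ev e W₀ heW₀') ?_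
    rw [bc_trans, σ.bc_evalAt b3 (ev e W₀ heW₀') (g' := 1) _ h₀,
      σ.bc_evalAt b1 (ev e W₀ heW₀') (g' := 1) _ h₀, σ.bc_evalAt b2 (ev e W₀ heW₀') (g' := 1) _ h₀,
      hone]
    · exact ⟨1, fun z => by rw [Units.val_one, one_smul]; rfl⟩
    · rw [← Category.assoc, specMap_ev_affPt, e2]
    · rw [← Category.assoc, specMap_ev_affPt, e1]
    · rw [← Category.assoc, specMap_ev_affPt, e3]
  obtain ⟨z, hz⟩ := hne
  have : Nonempty W := ⟨⟨z, hz⟩⟩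
  -- `W` meets `W₀`, since `G × G` is irreducible; proportionality over the intersection suffices.
  obtain ⟨W', hW', hη, hle'⟩ := exists_isAffineOpen_mem (W ⊓ W₀) _
    ⟨genericPoint_mem W, genericPoint_mem W₀⟩
  have : Nonempty W' := ⟨⟨_, hη⟩⟩
  have hres : Function.Injective (resA (G ⊗ G) (hle'.trans inf_le_left)) := by
    exact map_injective_of_isIntegral (G ⊗ G).left (homOfLE (hle'.trans inf_le_left))
  have d1 : LiesIn (affPt hW' ≫ fst G G) U := fun p => (hle (hle' (affPt_mem hW' p)).2).1
  have d2 : LiesIn (affPt hW' ≫ snd G G) U := fun p => (hle (hle' (affPt_mem hW' p)).2).2.1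
  have d3 : LiesIn (affPt hW' ≫ μ[G]) U := fun p => (hle (hle' (affPt_mem hW' p)).2).2.2
  have e (Y) (f : G ⊗ G ⟶ Y) : specMap (resA (G ⊗ G) (hle'.trans inf_le_left)) ≫ affPt hW ≫ f =
      affPt hW' ≫ f := by rw [← Category.assoc, specMap_resA]
  have e' (Y) (f : G ⊗ G ⟶ Y) : specMap (resA (G ⊗ G) (hle'.trans inf_le_right)) ≫ affPt hW₀ ≫ f =
      affPt hW' ≫ f := by rw [← Category.assoc, specMap_resA]
  have c1 : LiesIn (affPt hW' ≫ fst G G) (σ.U i₁) := by rw [← e]; exact fun p => h₁ _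
  have c2 : LiesIn (affPt hW' ≫ snd G G) (σ.U i₂) := by rw [← e]; exact fun p => h₂ _
  have c3 : LiesIn (affPt hW' ≫ μ[G]) (σ.U i₃) := by rw [← e]; exact fun p => h₃ _
  refine ((hσ i₃).evalAt _ h₃).proportional_of_injective hL (hR hW i₁ i₂ h₁ h₂) _ hres ?_
  rw [bc_trans, σ.bc_evalAt h₁ _ (e _ _) c1, σ.bc_evalAt h₂ _ (e _ _) c2, σ.bc_evalAt h₃ _ (e _ _) c3]
  have key' := key.bc (resA (G ⊗ G) (hle'.trans inf_le_right))
  rw [bc_trans, σ.bc_evalAt b1 _ (e' _ _) d1, σ.bc_evalAt b2 _ (e' _ _) d2,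
    σ.bc_evalAt b3 _ (e' _ _) d3] at key'
  exact (σ.proportional_evalAt _ _ _ _ _).trans (key'.trans
    ((σ.proportional_evalAt _ _ _ _ _).comp (σ.proportional_evalAt _ _ _ _ _)))

end System

/-! ### Stable finite-dimensional subspaces -/

section Coefficients

variable {k : Type u} [Field k] {A₀ A B E : Type u} [CommRing A₀] [Algebra k A₀] [CommRing A]
  [Algebra k A] [CommRing B] [Algebra k B] [AddCommGroup E] [Module k E]

theorem mem_baseChange_iff (V : Submodule k E) (z : A ⊗[k] E) :
    z ∈ V.baseChange A ↔ V.mkQ.lTensor A z = 0 := by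
  have h := lTensor_exact A (f := V.subtype) (g := V.mkQ) (LinearMap.exact_subtype_mkQ V)
    V.mkQ_surjective
  rw [h z]
  rfl

theorem lTensor_smul {Q : Type u} [AddCommGroup Q] [Module k Q] (f : E →ₗ[k] Q) (b : B)
    (z : B ⊗[k] E) : f.lTensor B (b • z) = b • f.lTensor B z := by
  induction z using TensorProduct.induction_on with
  | zero => simp
  | add x y hx hy => rw [smul_add, map_add, map_add, hx, hy, smul_add]
  | tmul b' e => simp [TensorProduct.smul_tmul']

/-- Let `V` be the space of coefficients of `t ∈ A₀ ⊗ E`. If `A₀ ⊗ A → B` is injective and `T t` is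
proportional to the image of `t` under another homomorphism `A₀ → B`, then `V` is stable under
`T`. -/
theorem map_baseChange_le_of_coefficients (α α' : A₀ →ₐ[k] B) (β : A →ₐ[k] B)
    (hinj : Function.Injective (evt α β.toLinearMap)) (t : A₀ ⊗[k] E) (V : Submodule k E)
    (ht : t ∈ V.baseChange A₀)
    (hV : ∀ {M : Type u} [AddCommGroup M] [Module k M] (f : E →ₗ[k] M),
      f.lTensor A₀ t = 0 → V ≤ LinearMap.ker f)
    (T : A ⊗[k] E ≃ₗ[A] A ⊗[k] E) (u : B) (h : bc β T (tw E α t) = u • tw E α' t) :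
    (V.baseChange A).map T.toLinearMap ≤ V.baseChange A := by
  -- `f e` is the class of `T e` modulo `V`. As the minimality of `V` reduces the assertion to
  -- `f t = 0`, it is enough to test this after the injective map to `B ⊗ E / V`.
  let f : E →ₗ[k] A ⊗[k] (E ⧸ V) := V.mkQ.lTensor A ∘ₗ T.toLinearMap.restrictScalars k ∘ₗ
    TensorProduct.mk k A E 1
  let Ψ : A₀ ⊗[k] (A ⊗[k] (E ⧸ V)) →ₗ[k] B ⊗[k] (E ⧸ V) :=
    (evt α β.toLinearMap).rTensor (E ⧸ V) ∘ₗ (TensorProduct.assoc k A₀ A (E ⧸ V)).symm.toLinearMap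
  have hΨ : Function.Injective Ψ :=
    (Module.Flat.rTensor_preserves_injective_linearMap (M := E ⧸ V) _ hinj).comp
      (TensorProduct.assoc k A₀ A (E ⧸ V)).symm.injective
  have hΨ' (a₀ : A₀) (z : A ⊗[k] E) : Ψ (a₀ ⊗ₜ V.mkQ.lTensor A z) =
      α a₀ • V.mkQ.lTensor B (tw E β z) := by
    induction z using TensorProduct.induction_on with
    | zero => simp
    | add x y hx hy => rw [map_add, TensorProduct.tmul_add, map_add, hx, hy, map_add, map_add, smul_add]
    | tmul a e => simp [Ψ, tw_tmul, evt_tmul, TensorProduct.smul_tmul']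
  have key (z : A₀ ⊗[k] E) : Ψ (f.lTensor A₀ z) = V.mkQ.lTensor B (bc β T (tw E α z)) := by
    induction z using TensorProduct.induction_on with
    | zero => simp
    | add x y hx hy => simp only [map_add, hx, hy]
    | tmul a e =>
      have h1 : tw E α (a ⊗ₜ[k] e) = α a • (1 ⊗ₜ e) := by
        rw [tw_tmul, TensorProduct.smul_tmul', smul_eq_mul, _root_.mul_one]
      rw [h1, LinearEquiv.map_smul, lTensor_smul, bc_one_tmul, ← hΨ', LinearMap.lTensor_tmul]
      rfl
  have hf : f.lTensor A₀ t = 0 := by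
    apply hΨ
    rw [key, h, map_zero, lTensor_smul]
    have h2 (z : A₀ ⊗[k] E) : V.mkQ.lTensor B (tw E α' z) = tw _ α' (V.mkQ.lTensor A₀ z) := by
      induction z using TensorProduct.induction_on with
      | zero => simp
      | add x y hx hy => simp only [map_add, hx, hy]
      | tmul a e => simp [tw_tmul]
    rw [h2, (mem_baseChange_iff V t).mp ht, map_zero, smul_zero]
  have hle := hV f hf
  conv_lhs => rw [← Submodule.span_eq V, Submodule.baseChange_span]
  rw [Submodule.map_span, Submodule.span_le]
  rintro _ ⟨_, ⟨v, hv, rfl⟩, rfl⟩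
  exact (mem_baseChange_iff V _).mpr (hle hv)

/-- The value at a `k`-point of an element of `A ⊗ V` lies in `V`. -/
theorem mem_of_tw_eq (ε : A →ₐ[k] k) {V : Submodule k E} {t : A ⊗[k] E} (ht : t ∈ V.baseChange A)
    {e : E} (h : tw E ε t = 1 ⊗ₜ e) : e ∈ V := by
  have h2 (z : A ⊗[k] E) : V.mkQ.lTensor k (tw E ε z) = tw _ ε (V.mkQ.lTensor A z) := by
    induction z using TensorProduct.induction_on with
    | zero => simp
    | add x y hx hy => simp only [map_add, hx, hy]
    | tmul a e => simp [tw_tmul]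
  have h3 := h2 t
  rw [(mem_baseChange_iff V t).mp ht, map_zero, h, LinearMap.lTensor_tmul] at h3
  have h4 := congrArg (TensorProduct.lid k _) h3
  rw [TensorProduct.lid_tmul, one_smul, map_zero] at h4
  exact (Submodule.Quotient.mk_eq_zero V).mp h4

end Coefficients

section Stable

variable {k : Type u} [Field k] {G X : Over (Spec (.of k))} [GrpObj G] [ModObj G X]
  {L : X.left.Modules} [IsAlgClosed k] [IsIntegral G.left] [IsIntegral X.left] [IsSeparated G.hom]

/-- Every section lies in a finite-dimensional space of sections which is stable under `G`: the
space of coefficients of the family of its translates by the elements near the neutral element. -/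
theorem AutSystem.exists_stable (hL : IsInvertible L) (σ : AutSystem G (H0 X L))
    (hσ : ∀ i, IsTransport (affPt (σ.isAffineOpen i)) (σ.T i)) (hne : ∀ i, ∃ g, g ∈ σ.U i)
    {i₀ : σ.I} {h₀ : LiesIn (1 : specOver k k ⟶ G) (σ.U i₀)}
    (hone : σ.evalAt i₀ 1 h₀ = LinearEquiv.refl k _) (e : H0 X L) :
    ∃ V : Submodule k (H0 X L), FiniteDimensional k V ∧ e ∈ V ∧
      ∀ i, (V.baseChange Γ(G.left, σ.U i)).map (σ.T i).toLinearMap ≤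
        V.baseChange Γ(G.left, σ.U i) := by
  have : IsIntegral (G ⊗ G).left := isIntegral_tensor G G
  obtain ⟨V, hfd, ht, hV⟩ := exists_coefficientSpace (σ.T i₀ (1 ⊗ₜ e))
  replace ht : σ.T i₀ (1 ⊗ₜ e) ∈ V.baseChange Γ(G.left, σ.U i₀) := ht
  refine ⟨V, hfd, ?_, fun i => ?_⟩
  · refine mem_of_tw_eq (ev (1 : specOver k k ⟶ G) _ h₀) ht ?_
    rw [← bc_one_tmul]
    exact congr($hone (1 ⊗ₜ e))
  obtain ⟨F, _, _, y, hy⟩ := exists_isGenericPt G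
  -- An affine open `W` near `(1, η)`, with `η` the generic point, is needed for `g` to be near the
  -- neutral element, `h` in `U_i` and `g h` in `U_{i₀}`.
  let z : specOver k F ⟶ G ⊗ G := lift 1 y
  have e1 : z ≫ fst G G = 1 := lift_fst _ _
  have e2 : z ≫ snd G G = y := lift_snd _ _
  have e3 : z ≫ μ[G] = y := one_mul y
  obtain ⟨W, hW, hzW, hle⟩ := exists_isAffineOpen_mem (box (σ.U i₀) (σ.U i) ⊓
    (μ[G] : G ⊗ G ⟶ G).left ⁻¹ᵁ (σ.U i₀)) (z.left (default : PrimeSpectrum F)) (by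
      have a1 : LiesIn (z ≫ fst G G) (σ.U i₀) := by
        rw [e1, ← MonObj.comp_one (specMap (Algebra.ofId k F))]
        exact fun p => h₀ _
      have a2 : LiesIn (z ≫ snd G G) (σ.U i) := by
        rw [e2]
        exact (hy _ (hne i)).1
      have a3 : LiesIn (z ≫ μ[G]) (σ.U i₀) := by
        rw [e3]
        exact (hy _ (hne i₀)).1
      exact ⟨⟨a1 _, a2 _⟩, a3 _⟩)
  have : Nonempty W := ⟨⟨_, hzW⟩⟩
  have hbox := hle.trans inf_le_left
  have b1 : LiesIn (affPt hW ≫ fst G G) (σ.U i₀) := fun p => (hle (affPt_mem hW p)).1.1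
  have b2 : LiesIn (affPt hW ≫ snd G G) (σ.U i) := fun p => (hle (affPt_mem hW p)).1.2
  have b3 : LiesIn (affPt hW ≫ μ[G]) (σ.U i₀) := fun p => (hle (affPt_mem hW p)).2
  obtain ⟨u, hu⟩ := σ.proportional_mul hL hσ hone hW i₀ i i₀ b1 b2 b3 ⟨_, hzW⟩
  refine map_baseChange_le_of_coefficients (ev (affPt hW ≫ fst G G) _ b1)
    (ev (affPt hW ≫ μ[G]) _ b3) (ev (affPt hW ≫ snd G G) _ b2) ?_ _ V ht hV _
    ((u⁻¹ : Γ((G ⊗ G).left, W)ˣ) : Γ((G ⊗ G).left, W)) ?_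
  · have h1 := (boxHom_bijective (σ.isAffineOpen i₀) (σ.isAffineOpen i)).1
    have h2 : Function.Injective (resA (G ⊗ G) hbox) :=
      map_injective_of_isIntegral (G ⊗ G).left (homOfLE hbox)
    have h3 (t) : evt (ev (affPt hW ≫ fst G G) _ b1) (ev (affPt hW ≫ snd G G) _ b2).toLinearMap t =
        resA (G ⊗ G) hbox (boxHom (σ.U i₀) (σ.U i) t) := by
      rw [← ev_boxHom]
      have h4 : lift (affPt hW ≫ fst G G) (affPt hW ≫ snd G G) = affPt hW := by
        rw [← comp_lift, lift_fst_snd, Category.comp_id]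
      rw [ev_congr h4 _ (fun p => hbox (affPt_mem hW p)),
        ← ev_resA (affPt hW) hbox (affPt_mem hW), ev_affPt]
      rfl
    have h5 : (⇑(evt (ev (affPt hW ≫ fst G G) _ b1) (ev (affPt hW ≫ snd G G) _ b2).toLinearMap)) =
      resA (G ⊗ G) hbox ∘ boxHom (σ.U i₀) (σ.U i) := funext h3
    rw [h5]
    exact h2.comp h1
  · have h6 := hu (1 ⊗ₜ e)
    rw [LinearEquiv.trans_apply] at h6
    have h7 : σ.evalAt i₀ (affPt hW ≫ fst G G) b1 (1 ⊗ₜ e) = _ := bc_one_tmul _ _ _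
    have h8 : σ.evalAt i₀ (affPt hW ≫ μ[G]) b3 (1 ⊗ₜ e) = _ := bc_one_tmul _ _ _
    rw [h7, h8] at h6
    rw [h6, smul_smul, Units.inv_mul, one_smul]
    rfl

end Stable

/-! ### Points of `ℙ(E)` with values in fields -/

section QuotientPoints

variable {K M : Type u} [Field K] [AddCommGroup M] [Module K M] {k E : Type u} [Field k]
  [Algebra k K] [AddCommGroup E] [Module k E]

/-- The `K`-valued point of `ℙ(E)` given by a nonzero functional `q : E → K`. -/
def quotPt (q : E →ₗ[k] K) (e : E) (he : q e ≠ 0) : specOver k K ⟶ projOver k E :=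
  Over.homMk (pt (SymmetricAlgebra.lift q).toRingHom e (by
    change IsUnit (SymmetricAlgebra.lift q (SymmetricAlgebra.ι k E e))
    rw [SymmetricAlgebra.lift_ι_apply]
    exact isUnit_iff_ne_zero.mpr he)) (by
    refine (pt_str _ _ _).trans (congrArg (fun f => Spec.map (CommRingCat.ofHom f)) ?_)
    exact (SymmetricAlgebra.lift q).comp_algebraMap)

/-- Proportional functionals define the same point. -/
theorem quotPt_eq {q q' : E →ₗ[k] K} {e e' : E} (he : q e ≠ 0) (he' : q' e' ≠ 0) (c : K)
    (hc : c ≠ 0) (h : ∀ e, q e = c * q' e) : quotPt q e he = quotPt q' e' he' := by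
  ext1
  refine pt_eq c (isUnit_iff_ne_zero.mpr hc) (fun r => ?_) (fun m => ?_)
  · exact (AlgHom.commutes _ _).trans (AlgHom.commutes _ _).symm
  · change SymmetricAlgebra.lift q _ = _ * SymmetricAlgebra.lift q' _
    rw [SymmetricAlgebra.lift_ι_apply, SymmetricAlgebra.lift_ι_apply, h]

/-- The `K`-valued point of `ℙ_K(K ⊗ E)` over `Spec K` given by a functional `r`. -/
def quotPtB (r : K ⊗[k] E →ₗ[K] K) (m : K ⊗[k] E) (hm : r m ≠ 0) : specOver k K ⟶ projB k K E :=
  Over.homMk (pt (SymmetricAlgebra.lift r).toRingHom m (by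
    change IsUnit (SymmetricAlgebra.lift r (SymmetricAlgebra.ι K _ m))
    rw [SymmetricAlgebra.lift_ι_apply]
    exact isUnit_iff_ne_zero.mpr hm)) (by
    refine (Category.assoc _ _ _).symm.trans ((congrArg (· ≫ _) (pt_str _ _ _)).trans ?_)
    have : (SymmetricAlgebra.lift r).toRingHom.comp (algebraMap K _) = RingHom.id K :=
      (SymmetricAlgebra.lift r).comp_algebraMap
    refine (congrArg (fun f => Spec.map (CommRingCat.ofHom f) ≫ _) this).trans ?_
    exact (congrArg (· ≫ _) (Spec.map_id _)).trans (Category.id_comp _))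

theorem quotPtB_str (r : K ⊗[k] E →ₗ[K] K) (m : K ⊗[k] E) (hm : r m ≠ 0) :
    quotPtB r m hm ≫ projBStr k K E = 𝟙 _ := by
  ext1
  have : (SymmetricAlgebra.lift r).toRingHom.comp (algebraMap K _) = RingHom.id K :=
      (SymmetricAlgebra.lift r).comp_algebraMap
  refine (pt_str _ _ _).trans ((congrArg (fun f => Spec.map (CommRingCat.ofHom f)) this).trans ?_)
  exact Spec.map_id _

theorem quotPtB_eq (r : K ⊗[k] E →ₗ[K] K) (m m' : K ⊗[k] E) (hm : r m ≠ 0) (hm' : r m' ≠ 0) :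
    quotPtB r m hm = quotPtB r m' hm' := by
  ext1
  exact pt_eq 1 isUnit_one (fun r => rfl) (fun m => (_root_.one_mul _).symm)

theorem quotPtB_pr (r : K ⊗[k] E →ₗ[K] K) (e : E) (hm : r (1 ⊗ₜ e) ≠ 0) (q : E →ₗ[k] K)
    (hq : ∀ e, q e = r (1 ⊗ₜ e)) :
    quotPtB r (1 ⊗ₜ e) hm ≫ projBPr k K E = quotPt q e (by rwa [hq]) := by
  have h1 (e) : (SymmetricAlgebra.lift r) (symAlgMap (S := K) (TensorProduct.mk k K E 1)
      (SymmetricAlgebra.ι k E e)) = r (1 ⊗ₜ e) := by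
    rw [symAlgMap_ι, SymmetricAlgebra.lift_ι_apply]; rfl
  ext1
  refine (pt_projMap (TensorProduct.mk k K E 1) (span_range_mk k K E)
    (SymmetricAlgebra.lift r).toRingHom e _ (by
      change IsUnit (SymmetricAlgebra.lift r (symAlgMap (S := K) _ _))
      rw [h1]
      exact isUnit_iff_ne_zero.mpr hm)).trans ?_
  refine pt_eq 1 isUnit_one (fun c => ?_) (fun m => ?_)
  · refine Eq.trans ?_ (AlgHom.commutes (SymmetricAlgebra.lift q) c).symm
    change (SymmetricAlgebra.lift r) (symAlgMap (S := K) (TensorProduct.mk k K E 1) _) = _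
    rw [AlgHom.commutes, IsScalarTower.algebraMap_apply k K (SymmetricAlgebra K _),
      AlgHom.commutes]
    rfl
  · rw [_root_.one_mul]
    refine (h1 m).trans ((hq m).symm.trans (SymmetricAlgebra.lift_ι_apply ..).symm)

/-- A projectivity acts on points by composition of functionals. -/
theorem quotPtB_projAutOver (T : K ⊗[k] E ≃ₗ[K] K ⊗[k] E) (r : K ⊗[k] E →ₗ[K] K) (m : K ⊗[k] E)
    (hm : r (T m) ≠ 0) : quotPtB r (T m) hm ≫ projAutOver T =
      quotPtB (r ∘ₗ T.toLinearMap) m hm := by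
  have h1 (e) : (SymmetricAlgebra.lift r) (symAlgMap (S := K) T.toLinearMap
      (SymmetricAlgebra.ι K _ e)) = r (T e) := by
    rw [symAlgMap_ι, SymmetricAlgebra.lift_ι_apply]; rfl
  ext1
  refine (pt_projMap T.toLinearMap (by
      rw [← LinearMap.coe_range, Submodule.span_eq]; exact LinearEquiv.range T)
    (SymmetricAlgebra.lift r).toRingHom m _ (by
      change IsUnit (SymmetricAlgebra.lift r (symAlgMap (S := K) _ _))
      rw [h1]
      exact isUnit_iff_ne_zero.mpr hm)).trans ?_
  refine pt_eq 1 isUnit_one (fun c => ?_) (fun m => ?_)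
  · refine Eq.trans ?_ (AlgHom.commutes (SymmetricAlgebra.lift (r ∘ₗ T.toLinearMap)) c).symm
    change (SymmetricAlgebra.lift r) (symAlgMap (S := K) T.toLinearMap _) = _
    rw [AlgHom.commutes, AlgHom.commutes]
  · rw [_root_.one_mul]
    exact (h1 m).trans (SymmetricAlgebra.lift_ι_apply (f := r ∘ₗ T.toLinearMap) m).symm

/-- The `K`-linear extension of a functional `q : E → K`. -/
def extendFunctional (q : E →ₗ[k] K) : K ⊗[k] E →ₗ[K] K where
  toFun := evt (AlgHom.id k K) q
  map_add' := map_add _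
  map_smul' c z := evt_smul _ _ _ _

theorem exists_ne_zero_of_ne_zero {r : K ⊗[k] E →ₗ[K] K} {m : K ⊗[k] E} (h : r m ≠ 0) :
    ∃ e, r (1 ⊗ₜ e) ≠ 0 := by
  by_contra! h0
  have : r = 0 := ext_one_tmul h0
  exact h (by rw [this]; rfl)

/-- The action of an element `g` with values in a field: it sends the point given by a functional
`q` to the point given by `q ∘ T`. -/
theorem AutSystem.lift_quotPt_mor {S : Over (Spec (.of k))} [IsSeparated S.hom] (σ : AutSystem S E)
    (i : σ.I) (g : specOver k K ⟶ S) (h : LiesIn g (σ.U i)) (q : E →ₗ[k] K) (e : E) (he : q e ≠ 0)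
    (q' : E →ₗ[k] K) (hq : ∀ e, q' e = evt (AlgHom.id k K) q (σ.evalAt i g h (1 ⊗ₜ e))) :
    ∃ (e' : E) (he' : q' e' ≠ 0), lift g (quotPt q e he) ≫ σ.mor = quotPt q' e' he' := by
  let r := extendFunctional q
  have hr : r (1 ⊗ₜ e) ≠ 0 := by
    change evt (AlgHom.id k K) q _ ≠ 0
    rwa [evt_one_tmul]
  have hr' : (r ∘ₗ (σ.evalAt i g h).toLinearMap) ((σ.evalAt i g h).symm (1 ⊗ₜ e)) ≠ 0 := by
    rwa [LinearMap.comp_apply, LinearEquiv.coe_coe, LinearEquiv.apply_symm_apply]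
  obtain ⟨e', he'⟩ := exists_ne_zero_of_ne_zero hr'
  refine ⟨e', by rw [hq]; exact he', ?_⟩
  -- The point `(g, q)` of `S × ℙ(E)` is the image of a point of the fibre `ℙ_K(K ⊗ E)` above `g`.
  have h1 : lift g (quotPt q e he) = quotPtB r (1 ⊗ₜ e) hr ≫ chartAt E g := by
    rw [chartAt, comp_lift, quotPtB_pr r e hr q (fun e => (evt_one_tmul _ _ _).symm),
      ← Category.assoc, quotPtB_str, Category.id_comp]
  rw [h1, Category.assoc, σ.chartAt_mor i g h, ← Category.assoc,
    quotPtB_eq r _ (σ.evalAt i g h (1 ⊗ₜ e')) hr he']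
  exact (congrArg (· ≫ _) (quotPtB_projAutOver (σ.evalAt i g h) r (1 ⊗ₜ e') he')).trans
    (quotPtB_pr _ e' he' q' hq)

end QuotientPoints

/-! ### The base locus and the morphism `ν` -/

section BaseLocus

variable {k : Type u} [Field k] {X : Over (Spec (.of k))} {L : X.left.Modules}
  {K : Type u} [Field K] [Algebra k K]

theorem Frame.isFrameOn (F : Frame X L) : IsFrameOn L (resTo X L F.U F.s) := by
  intro V h
  have : resM L h (resTo X L F.U F.s) = resTo X L V F.s := resTo_res h F.s
  rw [this]
  exact F.isFrame V h

theorem liesIn_of_mem {S : Over (Spec (.of k))} {y : specOver k K ⟶ S} {U : S.left.Opens}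
    {p} (h : y.left p ∈ U) : LiesIn y U := by
  intro q
  have : q = p := Subsingleton.elim (α := PrimeSpectrum K) q p
  rwa [this]

/-- A point with values in a field lies in `D(r)` if the value of `r` at it is not zero. -/
theorem mem_basicOpen_of_evC_ne_zero {Z : Scheme.{u}} {K : Type u} [Field K]
    (f : Spec (.of K) ⟶ Z) {U : Z.Opens} (h : ⊤ ≤ f ⁻¹ᵁ U) {r : Γ(Z, U)} (hr : evC f U h r ≠ 0)
    (p : Spec (.of K)) : f p ∈ Z.basicOpen r := by
  have h1 : IsUnit (f.appLE U ⊤ h r) := by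
    have h2 : IsUnit ((Scheme.ΓSpecIso (.of K)).hom (f.appLE U ⊤ h r)) :=
      isUnit_iff_ne_zero.mpr hr
    have h3 := h2.map (Scheme.ΓSpecIso (.of K)).inv.hom
    simpa using h3
  have h3 := Scheme.basicOpen_of_isUnit _ h1
  have h4 := Scheme.basicOpen_appLE f ⊤ U h r
  exact (h4.le (h3.ge trivial)).2

theorem mem_basicOpen_of_ev_ne_zero {S : Over (Spec (.of k))} {y : specOver k K ⟶ S}
    {U : S.left.Opens} (h : LiesIn y U) {r : Γ(S.left, U)} (hr : ev y U h r ≠ 0) :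
    LiesIn y (S.left.basicOpen r) := by
  exact fun p => mem_basicOpen_of_evC_ne_zero y.left (fun p _ => h p) hr p

/-- A point lies outside the base locus if and only if some section does not vanish at it. -/
theorem liesIn_nonBase_iff (x : specOver k K ⟶ X) (i : AffineFrame X L) (hi : LiesIn x i.V) :
    LiesIn x (nonBase X L) ↔ ∃ e, i.valE x hi e ≠ 0 := by
  constructor
  · intro h
    obtain ⟨F, hF⟩ := TopologicalSpace.Opens.mem_iSup.mp (h (default : PrimeSpectrum K))
    have hF' := liesIn_of_mem hF
    have h1 := val_mul_val i.isFrame F.isFrameOn x hi hF'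
    refine ⟨F.s, ?_⟩
    have h2 : i.valE x hi F.s = val i.isFrame x hi hF' (resTo X L F.U F.s) :=
      (val_res (W := ⊤) i.isFrame x hi (fun _ => trivial) hF' le_top F.s).symm
    rw [h2]
    exact left_ne_zero_of_mul_eq_one h1
  · rintro ⟨e, he⟩
    rw [← i.ev_coordE] at he
    have hD : X.left.basicOpen (i.coordE e) ≤ i.V := X.left.basicOpen_le _
    -- `e` is a frame over the set `D(r)` on which its coordinate `r` is invertible.
    let F : Frame X L := ⟨e, X.left.basicOpen (i.coordE e), fun V hV => by
      have h1 : IsUnit (resO X.left (hV.trans hD) (i.coordE e)) := by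
        have := (RingedSpace.isUnit_res_basicOpen X.left.toLocallyRingedSpace.toRingedSpace
          (i.coordE e)).map (resO X.left hV)
        have h5 : resO X.left hV (resO X.left hD (i.coordE e)) =
            resO X.left (hV.trans hD) (i.coordE e) :=
          resM_resM (X := X.left) (SheafOfModules.unit X.left.ringCatSheaf) hD hV (i.coordE e)
        rw [← h5]
        exact this
      have h2 : resTo X L V e =
          resO X.left (hV.trans hD) (i.coordE e) • resM L (hV.trans hD) i.s := by
        rw [← resM_smul]
        have h3 : i.coordE e • i.s = resM L le_top e := by
          have := i.isFrame.coord_smul le_rfl (resM L le_top e)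
          rwa [resM_self] at this
        rw [h3]
        exact (resM_resM L le_top _ e).symm
      have h4 : (fun r : Γ(X.left, V) => r • resTo X L V e) =
          (fun r : Γ(X.left, V) => r • resM L (hV.trans hD) i.s) ∘
            (fun r => r * resO X.left (hV.trans hD) (i.coordE e)) := by
        funext r
        rw [h2, Function.comp_apply, mul_smul]
      rw [h4]
      exact (i.isFrame V _).comp (IsUnit.isUnit_iff_mulRight_bijective.mp h1)⟩
    exact fun p => F.le_nonBase (mem_basicOpen_of_ev_ne_zero hi he p)

/-- A point with values in a field of an open subscheme `N` which lies in the affine open subset `W`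
factors through `W`. -/
theorem eq_comp_homOfLE {Z : Scheme.{u}} {K : Type u} [Field K] {W N : Z.Opens}
    (hW : IsAffineOpen W) (hWN : W ≤ N) (x : Spec (.of K) ⟶ N.toScheme) (h : ⊤ ≤ (x ≫ N.ι) ⁻¹ᵁ W) :
    x = (Spec.map (evC (x ≫ N.ι) W h) ≫ hW.isoSpec.inv) ≫ Z.homOfLE hWN := by
  rw [← cancel_mono N.ι, Category.assoc, Category.assoc, Scheme.homOfLE_ι]
  have := SpecMap_evC (x ≫ N.ι) hW h
  rw [hW.isoSpec_inv_ι]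
  exact this.symm

/-- The point `ν(x)` for a point `x` in the domain of the frame `F`. -/
theorem comp_nu (F : Frame X L) (hF : IsAffineOpen F.U) (x : Spec (.of K) ⟶ (nonBase X L).toScheme)
    (h : ⊤ ≤ (x ≫ (nonBase X L).ι) ⁻¹ᵁ F.U) : ∃ hu,
    x ≫ nu X L = pt ((evC (x ≫ (nonBase X L).ι) F.U h).hom.comp F.ringHom.toRingHom) F.s hu := by
  refine ⟨(show IsUnit (F.ringHom.toRingHom _) by
    change IsUnit (F.ringHom _)
    rw [F.ringHom_self]; exact isUnit_one).map (evC (x ≫ (nonBase X L).ι) F.U h).hom, ?_⟩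
  have h1 := eq_comp_homOfLE hF F.le_nonBase x h
  have h2 : x ≫ nu X L =
      (Spec.map (evC (x ≫ (nonBase X L).ι) F.U h) ≫ hF.isoSpec.inv) ≫ F.toProj := by
    rw [← homOfLE_nu F, ← Category.assoc, ← h1]
  rw [h2, Frame.toProj, Category.assoc, hF.isoSpec_inv_toSpecΓ_assoc]
  exact SpecMap_pt F.ringHom.toRingHom F.s _ _

/-- The point `ν(x)` is given by the functional `e ↦ e(x)`. -/
theorem comp_nuOver (x : specOver k K ⟶ nonBaseOver X L) (i : AffineFrame X L)
    (hi : LiesIn (x ≫ nonBaseι X L) i.V) (e : H0 X L)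
    (he : i.valE (x ≫ nonBaseι X L) hi e ≠ 0) :
    x ≫ nuOver X L = quotPt (i.valE (x ≫ nonBaseι X L) hi) e he := by
  obtain ⟨F, hF⟩ := TopologicalSpace.Opens.mem_iSup.mp (x.left (default : PrimeSpectrum K)).2
  obtain ⟨W, hW, hxW, hle⟩ := exists_isAffineOpen_mem F.U _ hF
  have hx : LiesIn (x ≫ nonBaseι X L) W := liesIn_of_mem (p := (default : PrimeSpectrum K)) hxW
  have hx' : ⊤ ≤ (x ≫ nonBaseι X L).left ⁻¹ᵁ W := fun p _ => hx p
  -- the restriction of the frame `F` to an affine open neighbourhood `W` of `x`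
  obtain ⟨F', hF', hFU⟩ : ∃ F' : Frame X L, F'.s = F.s ∧ F'.U = W :=
    ⟨⟨F.s, W, fun V hV => F.isFrame V (hV.trans hle)⟩, rfl, rfl⟩
  subst hFU
  obtain ⟨hu, hnu⟩ := comp_nu F' hW x.left hx'
  let j : AffineFrame X L := ⟨F'.U, hW, ⟨_, hxW⟩, resTo X L F'.U F'.s, F'.isFrameOn⟩
  have hq (m) : ev (x ≫ nonBaseι X L) F'.U hx (F'.quot m) =
      val j.isFrame (x ≫ nonBaseι X L) hx hi i.s * i.valE (x ≫ nonBaseι X L) hi m := by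
    have h1 : j.coordE m = F'.quot m :=
      j.isFrame.coord_eq le_rfl ((congrArg _ (resM_self L _)).trans (F'.quot_smul m))
    refine (congrArg (ev (x ≫ nonBaseι X L) F'.U hx) h1.symm).trans
      ((j.ev_coordE (x ≫ nonBaseι X L) hx m).trans ?_)
    rw [AffineFrame.valE_eq i j (x ≫ nonBaseι X L) hi hx]
    rfl
  ext1
  refine hnu.trans ?_
  refine pt_eq (val j.isFrame (x ≫ nonBaseι X L) hx hi i.s) (isUnit_iff_ne_zero.mpr
    (left_ne_zero_of_mul_eq_one (val_mul_val j.isFrame i.isFrame _ hx hi))) (fun c => ?_)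
    (fun m => ?_)
  · refine Eq.trans ?_ (AlgHom.commutes (SymmetricAlgebra.lift (i.valE _ hi)) c).symm
    refine (congrArg (ev (x ≫ nonBaseι X L) F'.U hx) (F'.ringHom.commutes c)).trans ?_
    exact (ev (x ≫ nonBaseι X L) F'.U hx).commutes c
  · refine (congrArg (ev (x ≫ nonBaseι X L) F'.U hx)
      (SymmetricAlgebra.lift_ι_apply (f := F'.quot) m)).trans ((hq m).trans ?_)
    exact congrArg (_ * ·) (SymmetricAlgebra.lift_ι_apply (f := i.valE _ hi) m).symm

end BaseLocus

/-! ### Equivariance of `ν` -/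

section ResiduePoints

variable {k : Type u} [Field k]

/-- Every point `p` of a `k`-scheme is the image of a point `y` with values in an extension field of
`k`, namely in its residue field; the last clause says that `y` is `Spec κ(p) → Z`. -/
theorem exists_residuePt (Z : Over (Spec (.of k))) (p : Z.left) :
    ∃ (K : Type u) (_ : Field K) (_ : Algebra k K) (y : specOver k K ⟶ Z),
      (∀ q, y.left q = p) ∧ ∀ {Y : Scheme.{u}} (f f' : Z.left ⟶ Y), y.left ≫ f = y.left ≫ f' →
        Z.left.fromSpecResidueField p ≫ f = Z.left.fromSpecResidueField p ≫ f' := by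
  let f : CommRingCat.of k ⟶ Z.left.residueField p :=
    Spec.preimage (Z.left.fromSpecResidueField p ≫ Z.hom)
  letI : Algebra k (Z.left.residueField p) := f.hom.toAlgebra
  let y : specOver k (Z.left.residueField p) ⟶ Z :=
    Over.homMk (Z.left.fromSpecResidueField p) (Spec.map_preimage _).symm
  exact ⟨Z.left.residueField p, inferInstance, inferInstance, y,
    fun q => Scheme.fromSpecResidueField_apply p q, fun f f' h => h⟩

/-- Morphisms from a reduced scheme to a separated scheme agree if they agree on points with values
in fields. -/
theorem hom_ext_of_points {Z Y : Over (Spec (.of k))} [IsReduced Z.left] [IsSeparated Y.hom]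
    (f f' : Z ⟶ Y) (h : ∀ (K : Type u) [Field K] [Algebra k K] (y : specOver k K ⟶ Z),
      y ≫ f = y ≫ f') : f = f' := by
  ext1
  refine ext_of_fromSpecResidueField_eq f.left f'.left Y.hom Set.univ dense_univ (fun p _ => ?_)
    ((Over.w f).trans (Over.w f').symm)
  obtain ⟨K, _, _, y, -, hy⟩ := exists_residuePt Z p
  exact hy _ _ congr(($(h K y)).left)

instance isSeparated_projOver (E : Type u) [AddCommGroup E] [Module k E] :
    IsSeparated (projOver k E).hom := by
  change IsSeparated (Proj.toSpecZero (symGrading k E) ≫ _)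
  infer_instance

end ResiduePoints

section BaseLocus

variable {k : Type u} [Field k] {G X : Over (Spec (.of k))} [GrpObj G] [ModObj G X]
  {L : X.left.Modules} {K : Type u} [Field K] [Algebra k K] {σ : AutSystem G (H0 X L)}

/-- The value at `g` of a system of lifts, as an automorphism of `K ⊗ H⁰(X, L)`. -/
theorem AutSystem.evalAt_transport (hσ : ∀ i, IsTransport (affPt (σ.isAffineOpen i)) (σ.T i))
    {l : σ.I} (g : specOver k K ⟶ G) (hg : LiesIn g (σ.U l)) (x : specOver k K ⟶ X)
    (i j : AffineFrame X L) (hi : LiesIn x i.V) (hj : LiesIn (g • x) j.V) :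
    ∃ c : K, c ≠ 0 ∧ ∀ z, evt (AlgHom.id k K) (i.valE x hi) (σ.evalAt l g hg z) =
      c * evt (AlgHom.id k K) (j.valE (g • x) hj) z := by
  refine (hσ l).evalAt g hg i j (AlgHom.id k K) x (g • x) hi hj ?_
  have : specMap (AlgHom.id k K) = 𝟙 _ := by
    ext1
    exact Spec.map_id _
  rw [this, Category.id_comp]

/-- The complement of the base locus is stable under elements of `G` with values in fields. -/
theorem liesIn_nonBase_smul (hL : IsInvertible L)
    (hσ : ∀ i, IsTransport (affPt (σ.isAffineOpen i)) (σ.T i)) (g : specOver k K ⟶ G)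
    (x : specOver k K ⟶ X) (hx : LiesIn x (nonBase X L)) : LiesIn (g • x) (nonBase X L) := by
  obtain ⟨l, hl⟩ := σ.covers (g.left (default : PrimeSpectrum K))
  have hg : LiesIn g (σ.U l) := liesIn_of_mem hl
  obtain ⟨i, hi⟩ := exists_affineFrame hL x
  obtain ⟨j, hj⟩ := exists_affineFrame hL (g • x)
  obtain ⟨c, hc, hT⟩ := AutSystem.evalAt_transport hσ g hg x i j hi hj
  obtain ⟨e, he⟩ := (liesIn_nonBase_iff x i hi).mp hx
  have h1 : extendFunctional (j.valE (g • x) hj) ((σ.evalAt l g hg).symm (1 ⊗ₜ e)) ≠ 0 := by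
    intro h0
    have h2 := hT ((σ.evalAt l g hg).symm (1 ⊗ₜ e))
    rw [LinearEquiv.apply_symm_apply, evt_one_tmul] at h2
    exact he (h2.trans ((congrArg (c * ·) h0).trans (mul_zero c)))
  obtain ⟨e', he'⟩ := exists_ne_zero_of_ne_zero h1
  refine (liesIn_nonBase_iff (g • x) j hj).mpr ⟨e', fun h0 => he' ?_⟩
  exact (evt_one_tmul _ _ _).trans h0

theorem comp_whiskerLeft_smul {Y : Over (Spec (.of k))} (f : Y ⟶ X) {B : Type u} [CommRing B]
    [Algebra k B] (y : specOver k B ⟶ G ⊗ Y) :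
    y ≫ G ◁ f ≫ γ[G, X] = (y ≫ fst G Y) • (y ≫ snd G Y ≫ f) := by
  change _ = lift _ _ ≫ _
  rw [← Category.assoc]
  congr 1
  ext <;> simp

instance isOpenImmersion_nonBaseι : IsOpenImmersion (nonBaseι X L).left := by
  have h : IsOpenImmersion (Scheme.Opens.ι (nonBase X L)) := inferInstance
  exact h

/-- The complement of the base locus is stable under the action. -/
theorem exists_smul_nonBase (hL : IsInvertible L)
    (hσ : ∀ i, IsTransport (affPt (σ.isAffineOpen i)) (σ.T i)) :
    ∃ a : G ⊗ nonBaseOver X L ⟶ nonBaseOver X L,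
      a ≫ nonBaseι X L = G ◁ nonBaseι X L ≫ γ[G, X] := by
  let f := G ◁ nonBaseι X L ≫ γ[G, X]
  have hf : Set.range f.left ⊆ Set.range (nonBaseι X L).left := by
    rintro _ ⟨p, rfl⟩
    refine (Scheme.Opens.range_ι (nonBase X L)).symm.subset ?_
    obtain ⟨K, _, _, y, hy, -⟩ := exists_residuePt (G ⊗ nonBaseOver X L) p
    have h1 : LiesIn (y ≫ snd G (nonBaseOver X L) ≫ nonBaseι X L) (nonBase X L) :=
      fun q => ((y ≫ snd G (nonBaseOver X L)).left q).2
    have h2 := liesIn_nonBase_smul hL hσ (y ≫ fst G (nonBaseOver X L)) _ h1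
    rw [← comp_whiskerLeft_smul] at h2
    have h3 : (y ≫ f).left (default : PrimeSpectrum K) ∈ nonBase X L := h2 _
    have h4 : (y ≫ f).left (default : PrimeSpectrum K) = f.left p :=
      congrArg f.left (hy (default : PrimeSpectrum K))
    rw [← h4]
    exact h3
  have h : IsOpenImmersion.lift (nonBaseι X L).left f.left hf ≫ (nonBaseι X L).left = f.left :=
    IsOpenImmersion.lift_fac _ _ hf
  refine ⟨Over.homMk (IsOpenImmersion.lift (nonBaseι X L).left f.left hf) ?_, ?_⟩
  · exact (congrArg (_ ≫ ·) (Over.w (nonBaseι X L)).symm).trans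
      ((Category.assoc _ _ _).symm.trans ((congrArg (· ≫ X.hom) h).trans (Over.w f)))
  · ext1
    exact h

variable (G X L) in
theorem isReduced_tensor_nonBase [IsIntegral G.left] [IsIntegral X.left] [IsAlgClosed k] :
    IsReduced (G ⊗ nonBaseOver X L).left := by
  have : IsIntegral (G ⊗ X).left := isIntegral_tensor G X
  have : IsOpenImmersion (G ◁ nonBaseι X L).left := by
    rw [Over.whiskerLeft_left]
    infer_instance
  exact isReduced_of_isOpenImmersion (G ◁ nonBaseι X L).left

/-- The morphism `ν : X - B → ℙ(E)` is equivariant. -/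
theorem nuOver_equivariant [IsIntegral G.left] [IsIntegral X.left] [IsAlgClosed k]
    [IsSeparated G.hom] (hL : IsInvertible L)
    (hσ : ∀ i, IsTransport (affPt (σ.isAffineOpen i)) (σ.T i))
    (a : G ⊗ nonBaseOver X L ⟶ nonBaseOver X L)
    (ha : a ≫ nonBaseι X L = G ◁ nonBaseι X L ≫ γ[G, X]) :
    a ≫ nuOver X L = G ◁ nuOver X L ≫ σ.mor := by
  have := isReduced_tensor_nonBase G X L
  refine hom_ext_of_points _ _ fun K _ _ y => ?_
  obtain ⟨g, hgy⟩ : ∃ g, g = y ≫ fst G (nonBaseOver X L) := ⟨_, rfl⟩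
  obtain ⟨x, hxy⟩ : ∃ x, x = y ≫ snd G (nonBaseOver X L) := ⟨_, rfl⟩
  have h1 : (y ≫ a) ≫ nonBaseι X L = g • (x ≫ nonBaseι X L) := by
    rw [Category.assoc, ha, comp_whiskerLeft_smul, hgy, hxy, Category.assoc]
  have h2 : y ≫ G ◁ nuOver X L ≫ σ.mor = lift g (x ≫ nuOver X L) ≫ σ.mor := by
    rw [← Category.assoc, hgy, hxy]
    congr 1
    ext1 <;> simp
  obtain ⟨l, hl⟩ := σ.covers (g.left (default : PrimeSpectrum K))
  have hg : LiesIn g (σ.U l) := liesIn_of_mem hl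
  obtain ⟨i, hi⟩ := exists_affineFrame hL (x ≫ nonBaseι X L)
  obtain ⟨j, hj⟩ := exists_affineFrame hL (g • (x ≫ nonBaseι X L))
  obtain ⟨c, hc, hT⟩ := AutSystem.evalAt_transport hσ g hg _ i j hi hj
  have hx : LiesIn (x ≫ nonBaseι X L) (nonBase X L) := fun q => (x.left q).2
  have hx' : LiesIn ((y ≫ a) ≫ nonBaseι X L) (nonBase X L) := fun q => ((y ≫ a).left q).2
  have hj' : LiesIn ((y ≫ a) ≫ nonBaseι X L) j.V := by rwa [h1]
  obtain ⟨e, he⟩ := (liesIn_nonBase_iff _ i hi).mp hx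
  obtain ⟨e', he'⟩ := (liesIn_nonBase_iff _ j hj').mp hx'
  have h3 (e) : j.valE ((y ≫ a) ≫ nonBaseι X L) hj' e =
      j.valE (g • (x ≫ nonBaseι X L)) hj e := by
    congr 1
    congr 1
  obtain ⟨e₁, he₁, h4⟩ := σ.lift_quotPt_mor l g hg (i.valE (x ≫ nonBaseι X L) hi) e he
    (c • j.valE (g • (x ≫ nonBaseι X L)) hj) (fun e => by
      rw [hT, evt_one_tmul]; rfl)
  rw [h2, comp_nuOver x i hi e he, h4, ← Category.assoc, comp_nuOver (y ≫ a) j hj' e' he']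
  exact (quotPt_eq _ _ c hc fun e => congrArg (c * ·) (h3 e).symm).symm

end BaseLocus

end

end ProjAction

theorem theorem3p6 {k : Type u} [Field k] [IsAlgClosed k]
    (G : Over (Spec (.of k))) [GrpObj G] [Smooth G.hom] [ConnectedSpace G.left]
    [IsSeparated G.hom] [QuasiCompact G.hom]
    (X : Over (Spec (.of k))) [IsIntegral X.left] [IsSeparated X.hom] [LocallyOfFiniteType X.hom]
    [QuasiCompact X.hom] [ModObj G X]
    (L : X.left.Modules) (hL : ProjAction.IsInvertible L) (hGL : ProjAction.IsInvariant G X L) :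
    ∃ act : ModObj G (ProjAction.projOver k (ProjAction.H0 X L)),
      (∃ σ : G ⊗ ProjAction.nonBaseOver X L ⟶ ProjAction.nonBaseOver X L,
        σ ≫ ProjAction.nonBaseι X L = G ◁ ProjAction.nonBaseι X L ≫ γ[G, X] ∧
        σ ≫ ProjAction.nuOver X L = G ◁ ProjAction.nuOver X L ≫ act.smul) ∧
      ProjAction.IsCoherentProjectivity (lift (fst G _) act.smul) ∧
      ∀ e : ProjAction.H0 X L, ∃ V : Submodule k (ProjAction.H0 X L),
        FiniteDimensional k V ∧ e ∈ V ∧ ProjAction.IsStableUnder (lift (fst G _) act.smul) V := by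
  have : IsIntegral G.left := ProjAction.isIntegral_of_grpObj G
  obtain ⟨σ, hσ, hne, i₀, h₀, hone⟩ := ProjAction.exists_transportSystem hL hGL
  have hstable := ProjAction.AutSystem.exists_stable hL σ hσ hne hone
  obtain ⟨a, ha⟩ := ProjAction.exists_smul_nonBase hL hσ
  refine ⟨σ.modObj ⟨i₀, h₀, 1, fun z => ?_⟩ fun W hW i₁ i₂ i₃ h₁ h₂ h₃ hW' =>
    σ.proportional_mul hL hσ hone hW i₁ i₂ i₃ h₁ h₂ h₃ hW',
    ⟨a, ha, ProjAction.nuOver_equivariant hL hσ a ha⟩, ⟨σ.isIso_lift_mor, lift_fst _ _,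
      fun s => ?_⟩, fun e => ?_⟩
  · rw [Units.val_one, one_smul]
    exact congr($hone z)
  · obtain ⟨i, hi⟩ := σ.covers s
    have : IsLocallyNoetherian G.left := LocallyOfFiniteType.isLocallyNoetherian G.hom
    have : IsNoetherianRing Γ(G.left, σ.U i) :=
      IsLocallyNoetherian.component_noetherian ⟨σ.U i, σ.isAffineOpen i⟩
    refine ⟨σ.U i, σ.isAffineOpen i, σ.T i, hi, σ.isInducedOn i,
      ProjAction.isCoherentEnd_of_stable _ fun e => ?_⟩
    obtain ⟨V, hfd, he, hV⟩ := hstable e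
    exact ⟨V, hfd, he, hV i⟩
  · obtain ⟨V, hfd, he, hV⟩ := hstable e
    refine ⟨V, hfd, he, fun s => ?_⟩
    obtain ⟨i, hi⟩ := σ.covers s
    exact ⟨σ.U i, σ.isAffineOpen i, σ.T i, hi, σ.isInducedOn i, hV i⟩
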